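/- Let $B$ be a stable $C^*$-algebra (that is, $B\cong B_0\otimes\mathcal K$ for some $C^*$-algebra $B_0$, where $\mathcal K$ is the algebra of compact operators on $\ell^2(\mathbb N)$), with multiplier algebra $M(B)$. A Cuntz pair is a pair $(\phi,\psi)$ of $*$-homomorphisms $\mathbb C\to M(B)$ with $\phi(z)-\psi(z)\in B$ for all $z$; a homotopy of Cuntz pairs is a Cuntz pair $\mathbb C\to M(C([0,1])\otimes B)$; and $KK_h(\mathbb C,B)$ is the set of homotopy classes $[\phi,\psi]$. There are inner isomorphisms $\Theta:M_2(B)\to B$, $\Theta((b_{ij}))=\sum_{i,j}v_ib_{ij}v_j^*$, where $v_1,v_2\in M(B)$ are isometries with $v_1v_1^*+v_2v_2^*=1$, and $KK_h(\mathbb C,B)$ is an abelian group whose addition satisfies $$[\phi,\psi]+[\phi',\psi']=\left[\Theta\circ\begin{pmatrix}\phi&0\\0&\phi'\end{pmatrix},\ \Theta\circ\begin{pmatrix}\psi&0\\0&\psi'\end{pmatrix}\right]$$ for every such $\Theta$. It is identified with $K_0(B)$ by the canonical isomorphism $\kappa:KK_h(\mathbb C,B)\to K_0(B)$: with $D(B)=\{(x,y)\in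 M(B)\oplus M(B): x-y\in B\}$ and $\iota:B\to D(B)$, $\iota(b)=(b,0)$ (which is injective on $K_0$), $\kappa([\phi,\psi])$ is the element of $K_0(B)$ with $\iota_*\kappa([\phi,\psi])=[(\phi(1),\psi(1))]_0-[(\psi(1),\psi(1))]_0$ in $K_0(D(B))$. For projections $p,q\in M(B)$ with $p-q\in B$, let the generalized essential codimension $[p:q]\in KK_h(\mathbb C,B)\cong K_0(B)$ be the class $[\phi,\psi]$ of the Cuntz pair with $\phi(1)=p$, $\psi(1)=q$. Then, for projections $p_i,q_i\in M(B)$: 1. If $p_1-p_2\in B$ and one of $p_1,p_2$ belongs to $B$, then both do, and $[p_1:p_2]=[p_1]_0-[p_2]_0$ in $K_0(B)$, where $[p_i]_0$ is the $K_0$-class of $p_i$. 2. If $p_1-p_2\in B$, then $[p_1:p_2]=-[p_2:p_1]$. 3. If $p_1-p_2\in B$ and $p_2-p_3\in B$, then $[p_1:p_3]=[p_1:p_2]+[p_2:p_3]$. 4. If $p_1-p_2\in B$, $q_1-q_2\in B$ and $p_1q_1=0=p_2q_2$, then $[p_1+q_1:p_2+q_2]=[p_1:p_2]+[q_1:q_2]$.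 -/

import Mathlib

open scoped Matrix MultiplierAlgebra unitInterval

noncomputable section

universe u v

/-! ### The group `K₀` -/

namespace KTheory

/-- The projections in the matrix algebras `Mₙ(A)`, `n = 0, 1, 2, …`. -/
abbrev MatProj (A : Type u) [Ring A] [StarRing A] : Type u :=
  Σ n : ℕ, {P : Matrix (Fin n) (Fin n) A // IsStarProjection P}

/-- The block-diagonal sum of two square matrices, as a matrix indexed by `Fin (m + n)`. -/
def dsum {A : Type u} [Zero A] {m n : ℕ} (P : Matrix (Fin m) (Fin m) A)
    (Q : Matrix (Fin n) (Fin n) A) : Matrix (Fin (m + n)) (Fin (m + n)) A :=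
  Matrix.reindex finSumFinEquiv finSumFinEquiv (Matrix.fromBlocks P 0 0 Q)

lemma isStarProjection_dsum {A : Type u} [Ring A] [StarRing A] {m n : ℕ}
    {P : Matrix (Fin m) (Fin m) A} {Q : Matrix (Fin n) (Fin n) A}
    (hP : IsStarProjection P) (hQ : IsStarProjection Q) : IsStarProjection (dsum P Q) where
  isIdempotentElem := by
    have h1 := hP.isIdempotentElem
    have h2 := hQ.isIdempotentElem
    unfold IsIdempotentElem at h1 h2 ⊢
    simp [dsum, Matrix.submatrix_mul_equiv, Matrix.fromBlocks_multiply, h1, h2]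
  isSelfAdjoint := by
    have h1 := hP.isSelfAdjoint
    have h2 := hQ.isSelfAdjoint
    unfold IsSelfAdjoint at h1 h2 ⊢
    rw [Matrix.star_eq_conjTranspose] at h1 h2 ⊢
    simp [dsum, Matrix.conjTranspose_submatrix, Matrix.fromBlocks_conjTranspose, h1, h2]

/-- The block-diagonal sum of two projections in matrix algebras. -/
def MatProj.dsum {A : Type u} [Ring A] [StarRing A] (x y : MatProj A) : MatProj A :=
  ⟨x.1 + y.1, KTheory.dsum x.2.1 y.2.1, isStarProjection_dsum x.2.2 y.2.2⟩

/-- The relations of `K₀` of a unital algebra: Murray-von Neumann equivalent projections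
(possibly of different sizes) have the same class, and the class of a block-diagonal sum
is the sum of the classes. -/
inductive K0Rel (A : Type u) [Ring A] [StarRing A] : FreeAbelianGroup (MatProj A) → Prop
  | equiv (x y : MatProj A) (w : Matrix (Fin x.1) (Fin y.1) A)
      (hx : w * wᴴ = x.2.1) (hy : wᴴ * w = y.2.1) :
      K0Rel A (FreeAbelianGroup.of x - FreeAbelianGroup.of y)
  | dsum (x y : MatProj A) :
      K0Rel A (FreeAbelianGroup.of (x.dsum y) -
        (FreeAbelianGroup.of x + FreeAbelianGroup.of y))

/-- `K₀` of a unital C⋆-algebra: the Grothendieck group of the monoid of Murray-von Neumann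
classes of projections in matrices over `A`, by generators and relations. -/
abbrev K0Unital (A : Type u) [Ring A] [StarRing A] : Type u :=
  FreeAbelianGroup (MatProj A) ⧸ AddSubgroup.closure {x | K0Rel A x}

/-- The class in `K₀(A)` of a projection in `Mₙ(A)`. -/
def K0Unital.mk {A : Type u} [Ring A] [StarRing A] {n : ℕ} (P : Matrix (Fin n) (Fin n) A)
    (hP : IsStarProjection P) : K0Unital A :=
  QuotientAddGroup.mk (FreeAbelianGroup.of ⟨n, P, hP⟩)

section map

variable {A : Type u} {C : Type v} [Ring A] [StarRing A] [Algebra ℂ A]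
  [Ring C] [StarRing C] [Algebra ℂ C]

lemma conjTranspose_map' {m n : Type} (f : A →⋆ₐ[ℂ] C) (M : Matrix m n A) :
    (M.map f)ᴴ = Mᴴ.map f := by
  ext i j; simp [Matrix.conjTranspose_apply, map_star]

lemma isStarProjection_map (f : A →⋆ₐ[ℂ] C) {n : ℕ} {P : Matrix (Fin n) (Fin n) A}
    (hP : IsStarProjection P) : IsStarProjection (P.map f) where
  isIdempotentElem := by
    have h := hP.isIdempotentElem
    unfold IsIdempotentElem at h ⊢
    rw [← Matrix.map_mul, h]
  isSelfAdjoint := by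
    have h := hP.isSelfAdjoint
    unfold IsSelfAdjoint at h ⊢
    rw [Matrix.star_eq_conjTranspose] at h ⊢
    rw [conjTranspose_map', h]

/-- A unital ⋆-homomorphism acts on projections in matrix algebras entrywise. -/
def MatProj.map (f : A →⋆ₐ[ℂ] C) (x : MatProj A) : MatProj C :=
  ⟨x.1, x.2.1.map f, isStarProjection_map f x.2.2⟩

lemma K0Rel.map (f : A →⋆ₐ[ℂ] C) {x : FreeAbelianGroup (MatProj A)} (h : K0Rel A x) :
    K0Rel C (FreeAbelianGroup.map (MatProj.map f) x) := by
  cases h with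
  | equiv x y w hx hy =>
    rw [map_sub, FreeAbelianGroup.map_of_apply, FreeAbelianGroup.map_of_apply]
    refine K0Rel.equiv _ _ (w.map f) ?_ ?_
    · change w.map f * (w.map f)ᴴ = x.2.1.map f
      rw [conjTranspose_map', ← Matrix.map_mul, hx]
    · change (w.map f)ᴴ * w.map f = y.2.1.map f
      rw [conjTranspose_map', ← Matrix.map_mul, hy]
  | dsum x y =>
    rw [map_sub, map_add, FreeAbelianGroup.map_of_apply, FreeAbelianGroup.map_of_apply,
      FreeAbelianGroup.map_of_apply]
    have e : MatProj.map f (x.dsum y) = (MatProj.map f x).dsum (MatProj.map f y) := by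
      have e' : (KTheory.dsum x.2.1 y.2.1).map f = KTheory.dsum (x.2.1.map f) (y.2.1.map f) := by
        simp only [KTheory.dsum, Matrix.reindex_apply, ← Matrix.submatrix_map, Matrix.fromBlocks_map]
        congr 2 <;> (ext i j; simp)
      exact congrArg (Sigma.mk (x.1 + y.1)) (Subtype.ext e')
    rw [e]
    exact K0Rel.dsum _ _

/-- Functoriality of `K₀` for unital ⋆-homomorphisms. -/
def K0Unital.map (f : A →⋆ₐ[ℂ] C) : K0Unital A →+ K0Unital C :=
  QuotientAddGroup.map _ _ (FreeAbelianGroup.map (MatProj.map f)) (by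
    rw [AddSubgroup.closure_le]
    intro x hx
    exact AddSubgroup.subset_closure (K0Rel.map f hx))

lemma K0Unital.map_mk (f : A →⋆ₐ[ℂ] C) {n : ℕ} (P : Matrix (Fin n) (Fin n) A)
    (hP : IsStarProjection P) :
    K0Unital.map f (K0Unital.mk P hP) = K0Unital.mk (P.map f) (isStarProjection_map f hP) := by
  change ((FreeAbelianGroup.map (MatProj.map f) (FreeAbelianGroup.of _) :
    FreeAbelianGroup (MatProj C)) : K0Unital C) = _
  rw [FreeAbelianGroup.map_of_apply]
  rfl

end map

/-- A matrix with a single entry that is a projection is a projection. -/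
lemma isStarProjection_single {A : Type u} [Ring A] [StarRing A] {p : A}
    (hp : IsStarProjection p) : IsStarProjection (!![p] : Matrix (Fin 1) (Fin 1) A) where
  isIdempotentElem := by
    have := hp.isIdempotentElem
    unfold IsIdempotentElem at this ⊢
    ext i j
    fin_cases i; fin_cases j
    simp [Matrix.mul_apply, this]
  isSelfAdjoint := by
    have := hp.isSelfAdjoint
    unfold IsSelfAdjoint at this ⊢
    ext i j
    fin_cases i; fin_cases j
    simp [Matrix.star_apply, this]

/-- The class in `K₀(A)`, `A` unital, of a projection of `A` itself. -/
def K0Unital.ofProj {A : Type u} [Ring A] [StarRing A] (p : A) (hp : IsStarProjection p) :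
    K0Unital A :=
  K0Unital.mk !![p] (isStarProjection_single hp)

lemma K0Unital.mk_zero {A : Type u} [Ring A] [StarRing A] {n : ℕ}
    (h : IsStarProjection (0 : Matrix (Fin n) (Fin n) A)) : K0Unital.mk 0 h = 0 := by
  have h2 : IsStarProjection (0 : Matrix (Fin (n + n)) (Fin (n + n)) A) := IsStarProjection.zero _
  have e1 : K0Unital.mk 0 h2 = K0Unital.mk 0 h :=
    QuotientAddGroup.eq_iff_sub_mem.2 (AddSubgroup.subset_closure
      (K0Rel.equiv ⟨_, 0, h2⟩ ⟨_, 0, h⟩ 0 (by simp) (by simp)))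
  have e3 : K0Rel A (FreeAbelianGroup.of ⟨n + n, 0, h2⟩ -
      (FreeAbelianGroup.of ⟨n, 0, h⟩ + FreeAbelianGroup.of ⟨n, 0, h⟩)) := by
    have e : MatProj.dsum ⟨n, 0, h⟩ ⟨n, 0, h⟩ = ⟨n + n, 0, h2⟩ :=
      congrArg (Sigma.mk (n + n)) (Subtype.ext (by simp [dsum]))
    rw [← e]
    exact K0Rel.dsum _ _
  have e2 : K0Unital.mk 0 h2 = K0Unital.mk 0 h + K0Unital.mk 0 h :=
    QuotientAddGroup.eq_iff_sub_mem.2 (AddSubgroup.subset_closure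
      e3)
  rw [e1] at e2
  simpa using e2

variable (B : Type u) [NonUnitalCStarAlgebra B]

/-- The scalar part `b + λ ↦ λ` of the unitization, as a unital ⋆-homomorphism. -/
def scalarPart : Unitization ℂ B →⋆ₐ[ℂ] ℂ :=
  Unitization.starLift 0

/-- `K₀` of a (possibly non-unital) C⋆-algebra: the kernel of the map `K₀(B~) → K₀(ℂ)` induced
by the scalar part. -/
abbrev K0 : Type u := (K0Unital.map (scalarPart B)).ker

variable {B}

/-- The class `[p]₀ ∈ K₀(B)` of a projection `p` of `B`. -/
def K0.ofProj (p : B) (hp : IsStarProjection p) : K0 B :=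
  ⟨K0Unital.ofProj (Unitization.inrNonUnitalStarAlgHom ℂ B p) (hp.map _), by
    rw [AddMonoidHom.mem_ker, K0Unital.ofProj, K0Unital.map_mk]
    have : (!![Unitization.inrNonUnitalStarAlgHom ℂ B p] :
        Matrix (Fin 1) (Fin 1) (Unitization ℂ B)).map (scalarPart B) = 0 := by
      ext i j
      fin_cases i; fin_cases j
      exact congrArg (fun g : B →⋆ₙₐ[ℂ] ℂ => g p)
        (Unitization.starLift.symm_apply_apply (0 : B →⋆ₙₐ[ℂ] ℂ))
    simp only [this]
    exact K0Unital.mk_zero _⟩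

end KTheory

/-! ### Stable algebras -/

/-- `Stabilization B₀ B` exhibits `B` as `B₀ ⊗ 𝒦`, where `𝒦` is the algebra of compact operators on
`ℓ²(ℕ)`: the element `unit i j b` is `b ⊗ e i j` with `e i j` the standard matrix units, so the
elements `unit i j b` span a copy of the ⋆-algebra of finite matrices over `B₀`, which has to be
dense in `B`. (That ⋆-algebra has exactly one C⋆-norm, and `B₀ ⊗ 𝒦` is its completion.) -/
structure Stabilization (B₀ B : Type u) [NonUnitalCStarAlgebra B₀] [NonUnitalCStarAlgebra B] where
  unit : ℕ → ℕ → B₀ →ₗ[ℂ] B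
  unit_mul_unit : ∀ i j k l b c,
    unit i j b * unit k l c = if j = k then unit i l (b * c) else 0
  star_unit : ∀ i j b, star (unit i j b) = unit j i (star b)
  injective : ∀ i j, Function.Injective (unit i j)
  dense : Dense ((⨆ i, ⨆ j, LinearMap.range (unit i j) : Submodule ℂ B) : Set B)

/-- `B` is stable: it is isomorphic to `B₀ ⊗ 𝒦` for some C⋆-algebra `B₀`. -/
def IsStable (B : Type u) [NonUnitalCStarAlgebra B] : Prop :=
  ∃ (B₀ : Type u) (_ : NonUnitalCStarAlgebra B₀), Nonempty (Stabilization B₀ B)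

/-! ### The group `KK_h(A, B)` in the Cuntz picture

The multiplier algebra `M(B)` is `𝓜(ℂ, B)`, and `DoubleCentralizer.coeHom : B →⋆ₙₐ[ℂ] 𝓜(ℂ, B)` is
the canonical embedding. -/

section multiplier

variable {B : Type u} [NonUnitalCStarAlgebra B]

/-- The multiplier `m` belongs to `B ⊆ M(B)`. -/
def InAlg (m : 𝓜(ℂ, B)) : Prop := m ∈ Set.range (DoubleCentralizer.coeHom (𝕜 := ℂ) (A := B))

lemma coeHom_apply' (b : B) :
    (DoubleCentralizer.coeHom (𝕜 := ℂ) (A := B)) b = (b : 𝓜(ℂ, B)) := rfl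

lemma InAlg.zero : InAlg (0 : 𝓜(ℂ, B)) := ⟨0, map_zero _⟩

lemma InAlg.add {m n : 𝓜(ℂ, B)} (hm : InAlg m) (hn : InAlg n) : InAlg (m + n) := by
  obtain ⟨a, rfl⟩ := hm
  obtain ⟨b, rfl⟩ := hn
  exact ⟨a + b, map_add _ _ _⟩

lemma InAlg.neg {m : 𝓜(ℂ, B)} (hm : InAlg m) : InAlg (-m) := by
  obtain ⟨a, rfl⟩ := hm
  exact ⟨-a, map_neg _ _⟩

lemma InAlg.smul {m : 𝓜(ℂ, B)} (c : ℂ) (hm : InAlg m) : InAlg (c • m) := by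
  obtain ⟨a, rfl⟩ := hm
  exact ⟨c • a, map_smul _ _ _⟩

lemma InAlg.star {m : 𝓜(ℂ, B)} (hm : InAlg m) : InAlg (star m) := by
  obtain ⟨a, rfl⟩ := hm
  exact ⟨Star.star a, map_star _ _⟩

lemma InAlg.mul_left {m : 𝓜(ℂ, B)} (n : 𝓜(ℂ, B)) (hm : InAlg m) : InAlg (n * m) := by
  obtain ⟨a, rfl⟩ := hm
  refine ⟨n.fst a, ?_⟩
  refine DoubleCentralizer.ext ℂ B _ _ (Prod.ext ?_ ?_)
  · ext x
    have key : ∀ z : B, z * (n.fst a * x - n.fst (a * x)) = 0 := fun z => by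
      rw [mul_sub, ← n.central, ← mul_assoc, ← mul_assoc, ← n.central, sub_self]
    have := CStarRing.star_mul_self_eq_zero_iff (n.fst a * x - n.fst (a * x)) |>.1 (key _)
    exact sub_eq_zero.1 this
  · ext x
    exact (n.central x a).symm

lemma InAlg.mul_right {m : 𝓜(ℂ, B)} (n : 𝓜(ℂ, B)) (hm : InAlg m) : InAlg (m * n) := by
  simpa using (hm.star.mul_left (Star.star n)).star

end multiplier

/-- A Cuntz pair: two representations `φ, ψ : A → M(B)` with `φ(a) - ψ(a) ∈ B` for all `a`. -/
structure CuntzPair (A : Type v) (B : Type u) [NonUnitalCStarAlgebra A]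
    [NonUnitalCStarAlgebra B] where
  φ : A →⋆ₙₐ[ℂ] 𝓜(ℂ, B)
  ψ : A →⋆ₙₐ[ℂ] 𝓜(ℂ, B)
  sub_mem : ∀ a, InAlg (φ a - ψ a)

section KK

variable {A : Type v} {B : Type u} [NonUnitalCStarAlgebra A] [NonUnitalCStarAlgebra B]

/-- The multiplier `n` of `B` is the value at `t` of the multiplier `m` of `C([0,1], B)`, i.e. its
image under the extension to multiplier algebras of the surjection `C([0,1], B) → B`,
`f ↦ f(t)`. -/
def EvalAt (t : I) (m : 𝓜(ℂ, C(I, B))) (n : 𝓜(ℂ, B)) : Prop :=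
  ∀ f : C(I, B), m.fst f t = n.fst (f t) ∧ m.snd f t = n.snd (f t)

/-- Homotopy of Cuntz pairs: a Cuntz pair `A → M(C([0,1]) ⊗ B)` with the given end points, where
`C([0,1]) ⊗ B = C([0,1], B)`. -/
def CuntzPair.Homotopic (c d : CuntzPair A B) : Prop :=
  ∃ H : CuntzPair A C(I, B), ∀ a,
    EvalAt 0 (H.φ a) (c.φ a) ∧ EvalAt 0 (H.ψ a) (c.ψ a) ∧
    EvalAt 1 (H.φ a) (d.φ a) ∧ EvalAt 1 (H.ψ a) (d.ψ a)

variable (A B) in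
/-- `KK_h(A, B)` for stable `B`: Cuntz pairs modulo homotopy. -/
def KKh : Type (max u v) := Quot (CuntzPair.Homotopic (A := A) (B := B))

/-- The class `[φ, ψ]` of a Cuntz pair. -/
def KKh.mk (c : CuntzPair A B) : KKh A B := Quot.mk _ c

variable (B) in
/-- An inner isomorphism `Θ : M₂(B) → B`, namely `Θ (bᵢⱼ) = ∑ vᵢ bᵢⱼ vⱼ⋆` for two isometries
`v₁, v₂ ∈ M(B)` with `v₁ v₁⋆ + v₂ v₂⋆ = 1`. -/
structure InnerIso where
  v₁ : 𝓜(ℂ, B)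
  v₂ : 𝓜(ℂ, B)
  isometry₁ : star v₁ * v₁ = 1
  isometry₂ : star v₂ * v₂ = 1
  range_add_range : v₁ * star v₁ + v₂ * star v₂ = 1

lemma InnerIso.orthogonal (Θ : InnerIso B) : star Θ.v₁ * Θ.v₂ = 0 := by
  have h := congrArg (fun x => star Θ.v₁ * x * Θ.v₂) Θ.range_add_range
  have e : star Θ.v₁ * (Θ.v₁ * star Θ.v₁ + Θ.v₂ * star Θ.v₂) * Θ.v₂ =
      (star Θ.v₁ * Θ.v₁) * (star Θ.v₁ * Θ.v₂) +
        (star Θ.v₁ * Θ.v₂) * (star Θ.v₂ * Θ.v₂) := by noncomm_ring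
  simp only [e, Θ.isometry₁, Θ.isometry₂, one_mul, mul_one] at h
  simpa using h

lemma InnerIso.orthogonal' (Θ : InnerIso B) : star Θ.v₂ * Θ.v₁ = 0 := by
  have h := congrArg star Θ.orthogonal
  simpa using h

/-- `Θ (diag (x, y))`, extended to multipliers. -/
def InnerIso.diag (Θ : InnerIso B) (x y : 𝓜(ℂ, B)) : 𝓜(ℂ, B) :=
  Θ.v₁ * x * star Θ.v₁ + Θ.v₂ * y * star Θ.v₂

lemma InnerIso.diag_mul (Θ : InnerIso B) (x y x' y' : 𝓜(ℂ, B)) :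
    Θ.diag (x * x') (y * y') = Θ.diag x y * Θ.diag x' y' := by
  have e : Θ.diag x y * Θ.diag x' y' =
      Θ.v₁ * x * (star Θ.v₁ * Θ.v₁) * x' * star Θ.v₁ +
      Θ.v₁ * x * (star Θ.v₁ * Θ.v₂) * y' * star Θ.v₂ +
      Θ.v₂ * y * (star Θ.v₂ * Θ.v₁) * x' * star Θ.v₁ +
      Θ.v₂ * y * (star Θ.v₂ * Θ.v₂) * y' * star Θ.v₂ := by
    unfold InnerIso.diag
    noncomm_ring
  rw [e, Θ.isometry₁, Θ.isometry₂, Θ.orthogonal, Θ.orthogonal']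
  simp [InnerIso.diag, mul_assoc]

/-- `Θ ∘ diag (φ, φ')`, a representation of `A` in `M(B)`. -/
def InnerIso.sum (Θ : InnerIso B) (φ φ' : A →⋆ₙₐ[ℂ] 𝓜(ℂ, B)) : A →⋆ₙₐ[ℂ] 𝓜(ℂ, B) where
  toFun a := Θ.diag (φ a) (φ' a)
  map_smul' c a := by simp [InnerIso.diag, smul_add]
  map_zero' := by simp [InnerIso.diag]
  map_add' a b := by
    simp only [InnerIso.diag, map_add, mul_add, add_mul]
    abel
  map_mul' a b := by
    rw [map_mul, map_mul, Θ.diag_mul]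
  map_star' a := by simp [InnerIso.diag, map_star, mul_assoc]

/-- The sum of two Cuntz pairs, `(Θ ∘ diag (φ, φ'), Θ ∘ diag (ψ, ψ'))`. -/
def CuntzPair.sum (Θ : InnerIso B) (c d : CuntzPair A B) : CuntzPair A B where
  φ := Θ.sum c.φ d.φ
  ψ := Θ.sum c.ψ d.ψ
  sub_mem a := by
    change InAlg (Θ.diag (c.φ a) (d.φ a) - Θ.diag (c.ψ a) (d.ψ a))
    have e : Θ.diag (c.φ a) (d.φ a) - Θ.diag (c.ψ a) (d.ψ a) =
        Θ.v₁ * (c.φ a - c.ψ a) * star Θ.v₁ + Θ.v₂ * (d.φ a - d.ψ a) * star Θ.v₂ := by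
      simp only [InnerIso.diag, mul_sub, sub_mul]
      abel
    rw [e]
    exact (((c.sub_mem a).mul_left _).mul_right _).add (((d.sub_mem a).mul_left _).mul_right _)

end KK

/-! ### The identification of `KK_h(ℂ, B)` with `K₀(B)` -/

section identification

open KTheory

variable (B : Type u) [NonUnitalCStarAlgebra B]

/-- The double `D(B) = {(x, y) ∈ M(B) ⊕ M(B) : x - y ∈ B}` of `M(B)` along `B`. -/
def Double : StarSubalgebra ℂ (𝓜(ℂ, B) × 𝓜(ℂ, B)) where
  carrier := {x | InAlg (x.1 - x.2)}
  mul_mem' {x y} hx hy := by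
    change InAlg (x.1 * y.1 - x.2 * y.2)
    have e : x.1 * y.1 - x.2 * y.2 = (x.1 - x.2) * y.1 + x.2 * (y.1 - y.2) := by noncomm_ring
    rw [e]
    exact (InAlg.mul_right _ hx).add (InAlg.mul_left _ hy)
  add_mem' {x y} hx hy := by
    change InAlg (x.1 + y.1 - (x.2 + y.2))
    rw [add_sub_add_comm]
    exact InAlg.add hx hy
  algebraMap_mem' r := by
    change InAlg (algebraMap ℂ 𝓜(ℂ, B) r - algebraMap ℂ 𝓜(ℂ, B) r)
    rw [sub_self]
    exact InAlg.zero
  star_mem' {x} hx := by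
    change InAlg (star x.1 - star x.2)
    rw [← star_sub]
    exact InAlg.star hx

/-- The inclusion `b ↦ (b, 0)` of `B` as an ideal of `D(B)`. -/
def inclDouble : B →⋆ₙₐ[ℂ] Double B where
  toFun b := ⟨(DoubleCentralizer.coeHom (𝕜 := ℂ) b, 0), ⟨b, (sub_zero _).symm⟩⟩
  map_smul' c b := by
    apply Subtype.ext
    refine Prod.ext (map_smul _ _ _) (smul_zero _).symm
  map_zero' := by
    apply Subtype.ext
    exact Prod.ext (map_zero _) rfl
  map_add' a b := by
    apply Subtype.ext
    exact Prod.ext (map_add _ _ _) (add_zero _).symm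
  map_mul' a b := by
    apply Subtype.ext
    exact Prod.ext (map_mul _ _ _) (mul_zero _).symm
  map_star' b := by
    apply Subtype.ext
    exact Prod.ext (map_star _ _) (star_zero _).symm

/-- The map `K₀(B) → K₀(D(B))` induced by `b ↦ (b, 0)`. It is injective, because the extension
`0 → B → D(B) → M(B) → 0`, `(x, y) ↦ y`, is split by `y ↦ (y, y)`. -/
def K0.toDouble : K0 B →+ K0Unital (Double B) :=
  (K0Unital.map (Unitization.starLift (inclDouble B))).comp (AddSubgroup.subtype _)

variable {B}

lemma CuntzPair.isStarProjection_pair (φ ψ : ℂ →⋆ₙₐ[ℂ] 𝓜(ℂ, B))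
    (h : InAlg (φ 1 - ψ 1)) :
    IsStarProjection (⟨(φ 1, ψ 1), h⟩ : Double B) where
  isIdempotentElem := by
    apply Subtype.ext
    refine Prod.ext ?_ ?_
    · change φ 1 * φ 1 = φ 1
      rw [← map_mul, one_mul]
    · change ψ 1 * ψ 1 = ψ 1
      rw [← map_mul, one_mul]
  isSelfAdjoint := by
    apply Subtype.ext
    refine Prod.ext ?_ ?_
    · change star (φ 1) = φ 1
      rw [← map_star, star_one]
    · change star (ψ 1) = ψ 1
      rw [← map_star, star_one]

/-- The class `[(φ(1), ψ(1))] ∈ K₀(D(B))` of two representations `φ, ψ` of `ℂ` in `M(B)` with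
`φ(1) - ψ(1) ∈ B`. -/
def doubleClass (φ ψ : ℂ →⋆ₙₐ[ℂ] 𝓜(ℂ, B)) (h : InAlg (φ 1 - ψ 1)) : K0Unital (Double B) :=
  K0Unital.ofProj ⟨(φ 1, ψ 1), h⟩ (CuntzPair.isStarProjection_pair φ ψ h)

/-- `κ` is the canonical identification of `KK_h(ℂ, B)` with `K₀(B)`: the class of a Cuntz pair
`(φ, ψ)` is sent to the element of `K₀(B)` whose image in `K₀(D(B))` is
`[(φ(1), ψ(1))] - [(ψ(1), ψ(1))]`. Since `K₀(B) → K₀(D(B))` is injective, this determines `κ`. -/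
def IsCanonical (κ : KKh ℂ B → K0 B) : Prop :=
  ∀ c : CuntzPair ℂ B, K0.toDouble B (κ (KKh.mk c)) =
    doubleClass c.φ c.ψ (c.sub_mem 1) -
      doubleClass c.ψ c.ψ (by rw [sub_self]; exact InAlg.zero)

end identification

/-! ### The generalized essential codimension -/

section codimension

variable {B : Type u} [NonUnitalCStarAlgebra B]

/-- The representation `λ ↦ λ p` of `ℂ` in `M(B)` given by a projection `p ∈ M(B)`. -/
def projRep (p : 𝓜(ℂ, B)) (hp : IsStarProjection p) : ℂ →⋆ₙₐ[ℂ] 𝓜(ℂ, B) where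
  toFun z := z • p
  map_smul' c z := by simp [mul_smul]
  map_zero' := zero_smul _ _
  map_add' a b := add_smul _ _ _
  map_mul' a b := by
    have h : p * p = p := hp.isIdempotentElem
    rw [smul_mul_smul_comm, h]
  map_star' z := by
    have h : star p = p := hp.isSelfAdjoint
    rw [star_smul, h]

/-- `p` and `q` are projections of `M(B)` with `p - q ∈ B`. -/
structure IsEssPair (p q : 𝓜(ℂ, B)) : Prop where
  left : IsStarProjection p
  right : IsStarProjection q
  sub_mem : InAlg (p - q)

lemma IsEssPair.symm {p q : 𝓜(ℂ, B)} (h : IsEssPair p q) : IsEssPair q p :=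
  ⟨h.right, h.left, by rw [← neg_sub]; exact h.sub_mem.neg⟩

lemma IsEssPair.trans {p q r : 𝓜(ℂ, B)} (h : IsEssPair p q) (h' : IsEssPair q r) :
    IsEssPair p r :=
  ⟨h.left, h'.right, by rw [← sub_add_sub_cancel p q r]; exact h.sub_mem.add h'.sub_mem⟩

lemma isStarProjection_add {p q : 𝓜(ℂ, B)} (hp : IsStarProjection p) (hq : IsStarProjection q)
    (h : p * q = 0) : IsStarProjection (p + q) where
  isIdempotentElem := by
    have hqp : q * p = 0 := by
      have := congrArg star h
      rwa [star_mul, hp.isSelfAdjoint.star_eq, hq.isSelfAdjoint.star_eq, star_zero] at this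
    have h1 : p * p = p := hp.isIdempotentElem
    have h2 : q * q = q := hq.isIdempotentElem
    change (p + q) * (p + q) = p + q
    rw [add_mul, mul_add, mul_add, h1, h2, h, hqp, add_zero, zero_add]
  isSelfAdjoint := hp.isSelfAdjoint.add hq.isSelfAdjoint

lemma IsEssPair.add {p₁ p₂ q₁ q₂ : 𝓜(ℂ, B)} (hp : IsEssPair p₁ p₂) (hq : IsEssPair q₁ q₂)
    (h₁ : p₁ * q₁ = 0) (h₂ : p₂ * q₂ = 0) : IsEssPair (p₁ + q₁) (p₂ + q₂) :=
  ⟨isStarProjection_add hp.left hq.left h₁, isStarProjection_add hp.right hq.right h₂, by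
    rw [add_sub_add_comm]; exact hp.sub_mem.add hq.sub_mem⟩

/-- The generalized essential codimension `[p : q] ∈ KK_h(ℂ, B)`: the class of the Cuntz pair
`(φ, ψ)` with `φ(1) = p` and `ψ(1) = q`. -/
def essCodim (p q : 𝓜(ℂ, B)) (h : IsEssPair p q) : KKh ℂ B :=
  KKh.mk ⟨projRep p h.left, projRep q h.right, fun z => by
    change InAlg (z • p - z • q)
    rw [← smul_sub]
    exact h.sub_mem.smul z⟩

end codimension

end

/-!
A Cuntz pair `ℂ → M(B)` is the same thing as a projection `d = (p, q)` of the double `D(B)`, and the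
theorem amounts to the statement that the map `κ` determined by
`ι_* κ [p : q] = [d] - [δ d]`, with `δ (x, y) = (y, y)`, is a well defined bijection from
`KK_h(ℂ, B)` to `K₀(B)`. The group structure on `KK_h(ℂ, B)` is then transported along `κ`, and all
the formulas are identities in `K₀(D(B))`, because `ι_*` is injective (`K0.toDouble_injective`). That
injectivity is algebraic: if `W` implements an equivalence over `D(B)` between a matrix over the
unitization of `B` and its scalar part, then `W (δ W)⋆` has scalar second component and so comes
from the unitization of `B`.

*The map `κ` is well defined.* A homotopy of Cuntz pairs is only strictly continuous. But a
self-adjoint unitary built from `δ d` conjugates `diag (d, 1 - δ d)` to a projection whose second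
component is the scalar projection `diag (1, 0)` (`rotatedPair`), and this projection lifts to
matrices over the unitization of `C([0,1], B)`, where evaluation is norm continuous. Projections at
distance less than one are Murray-von Neumann equivalent, so the class is constant along the path
(`DoubleEvalAt.ofProj_sub_eq`).

*The map `κ` is bijective.* Two deformations of Cuntz pairs are used.
* Conjugation by self-adjoint unitaries `s, s'` of `M(B)`, through the paths
  `cos θ + i sin θ s` and `cos θ + i sin θ s'`. It suffices that the two unitaries have the same
  commutators with the two projections modulo `B` (`essCodim_conj_eq`). In particular, projections
  of `D(B)` that are Murray-von Neumann equivalent have the same class once they are placed in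
  complementary corners (`InnerIso.ofDouble_eq_of_mvn`).
* Absorption of degenerate pairs, `[Θ (diag (p, r)) : Θ (diag (q, r))] = [p : q]`, for the inner
  isomorphism `Θ` that interleaves even and odd rows (`Stabilization.essCodim_diag`). For
  `n = 0, 1, 2, …` let `σₙ` be the injection of `ℕ` that fixes the numbers below `n` and sends
  `i ≥ n` to `2 i - n`. Then `σₙ₊₁` is `σₙ` followed by an involution of `ℕ` (`flip n`). Each
  involution is a self-adjoint unitary of `M(B)` and is connected to `1`, so there is a path of
  unitaries which carries the isometry `v₁`, given by `σ₀`, strictly to `1`. It deforms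
  `Θ (diag (p, r))` into `p`.

With the Cuntz isometries of `M(B)` a projection over `D(B)` of any size, identity matrices
included, is compressed to an element of `D(B)` (`Stabilization.compress`). So every class of
`K₀(B)` comes from a pair, and an equality of classes in `K₀(D(B))` becomes an equivalence of two
projections of `D(B)` after adding degenerate pairs.

*The formulas.* The sum formulas express that orthogonal sums become sums in `K₀(D(B))`. For the
cocycle identity `[p₁ : p₃] = [p₁ : p₂] + [p₂ : p₃]`, exchanging the two coordinates in the second
component deforms `(diag (p₁, p₂), diag (p₃, p₂))` into `(diag (p₁, p₂), diag (p₂, p₃))`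
(`kappa_essCodim_trans`).
-/

/-! ### Murray-von Neumann equivalence and equality in `K₀` -/

namespace KTheory

section MvN

variable {A : Type u} [Ring A] [StarRing A]

/-- Murray-von Neumann equivalence of two matrices over `A`, possibly of different sizes. -/
def MvN {ι κ : Type*} [Fintype ι] [Fintype κ] (P : Matrix ι ι A) (Q : Matrix κ κ A) : Prop :=
  ∃ w : Matrix ι κ A, w * wᴴ = P ∧ wᴴ * w = Q

variable {ι κ l ι' κ' : Type*} [Fintype ι] [Fintype κ] [Fintype l] [Fintype ι'] [Fintype κ']

lemma conjTranspose_of_isStarProjection {P : Matrix ι ι A} (hP : IsStarProjection P) : Pᴴ = P :=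
  hP.isSelfAdjoint

lemma mul_self_of_isStarProjection {P : Matrix ι ι A} (hP : IsStarProjection P) : P * P = P :=
  hP.isIdempotentElem

lemma MvN.refl {P : Matrix ι ι A} (hP : IsStarProjection P) : MvN P P := by
  refine ⟨P, ?_, ?_⟩ <;>
  rw [conjTranspose_of_isStarProjection hP, mul_self_of_isStarProjection hP]

lemma MvN.symm {P : Matrix ι ι A} {Q : Matrix κ κ A} : MvN P Q → MvN Q P := by
  rintro ⟨w, h1, h2⟩
  exact ⟨wᴴ, by simpa using h2, by simpa using h1⟩

lemma MvN.trans {P : Matrix ι ι A} {Q : Matrix κ κ A} {R : Matrix l l A}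
    (hP : IsStarProjection P) (hR : IsStarProjection R) : MvN P Q → MvN Q R → MvN P R := by
  rintro ⟨w, h1, h2⟩ ⟨x, h3, h4⟩
  refine ⟨w * x, ?_, ?_⟩
  · calc w * x * (w * x)ᴴ = w * (x * xᴴ) * wᴴ := by
          rw [Matrix.conjTranspose_mul]; simp only [Matrix.mul_assoc]
      _ = (w * wᴴ) * (w * wᴴ) := by rw [h3, ← h2]; simp only [Matrix.mul_assoc]
      _ = P := by rw [h1, mul_self_of_isStarProjection hP]
  · calc (w * x)ᴴ * (w * x) = xᴴ * (wᴴ * w) * x := by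
          rw [Matrix.conjTranspose_mul]; simp only [Matrix.mul_assoc]
      _ = (xᴴ * x) * (xᴴ * x) := by rw [h2, ← h3]; simp only [Matrix.mul_assoc]
      _ = R := by rw [h4, mul_self_of_isStarProjection hR]

lemma MvN.fromBlocks {P : Matrix ι ι A} {P' : Matrix ι' ι' A} {Q : Matrix κ κ A}
    {Q' : Matrix κ' κ' A} : MvN P P' → MvN Q Q' →
    MvN (Matrix.fromBlocks P 0 0 Q) (Matrix.fromBlocks P' 0 0 Q') := by
  rintro ⟨w, rfl, rfl⟩ ⟨x, rfl, rfl⟩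
  refine ⟨Matrix.fromBlocks w 0 0 x, ?_, ?_⟩ <;>
  simp [Matrix.fromBlocks_conjTranspose, Matrix.fromBlocks_multiply]

lemma MvN.reindex {P : Matrix ι ι A} (hP : IsStarProjection P) (e : ι ≃ κ) :
    MvN (Matrix.reindex e e P) P := by
  have h1 := conjTranspose_of_isStarProjection hP
  have h2 := mul_self_of_isStarProjection hP
  refine ⟨P.submatrix e.symm id, ?_, ?_⟩
  · rw [Matrix.conjTranspose_submatrix, Matrix.reindex_apply, h1]
    conv_rhs => rw [← h2]
    exact Matrix.submatrix_mul_equiv P P e.symm (Equiv.refl _) e.symm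
  · rw [Matrix.conjTranspose_submatrix, h1, Matrix.submatrix_mul_equiv, h2, Matrix.submatrix_id_id]

lemma MvN.mk_eq {m n : ℕ} {P : Matrix (Fin m) (Fin m) A} {Q : Matrix (Fin n) (Fin n) A}
    (h : MvN P Q) (hP : IsStarProjection P) (hQ : IsStarProjection Q) :
    K0Unital.mk P hP = K0Unital.mk Q hQ := by
  obtain ⟨w, h1, h2⟩ := h
  exact QuotientAddGroup.eq_iff_sub_mem.2 (AddSubgroup.subset_closure
      (K0Rel.equiv ⟨_, P, hP⟩ ⟨_, Q, hQ⟩ w h1 h2))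

lemma K0Unital.mk_dsum {m n : ℕ} {P : Matrix (Fin m) (Fin m) A} {Q : Matrix (Fin n) (Fin n) A}
    (hP : IsStarProjection P) (hQ : IsStarProjection Q) :
    K0Unital.mk (dsum P Q) (isStarProjection_dsum hP hQ) = K0Unital.mk P hP + K0Unital.mk Q hQ :=
  QuotientAddGroup.eq_iff_sub_mem.2 (AddSubgroup.subset_closure
    (K0Rel.dsum ⟨_, P, hP⟩ ⟨_, Q, hQ⟩))

lemma isStarProjection_fromBlocks {P : Matrix ι ι A} {Q : Matrix κ κ A}
    (hP : IsStarProjection P) (hQ : IsStarProjection Q) :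
    IsStarProjection (Matrix.fromBlocks P 0 0 Q) := by
  constructor
  · have h1 := hP.isIdempotentElem
    have h2 := hQ.isIdempotentElem
    unfold IsIdempotentElem at h1 h2 ⊢
    simp [Matrix.fromBlocks_multiply, h1, h2]
  · have h1 := conjTranspose_of_isStarProjection hP
    have h2 := conjTranspose_of_isStarProjection hQ
    unfold IsSelfAdjoint
    rw [Matrix.star_eq_conjTranspose]
    simp [Matrix.fromBlocks_conjTranspose, h1, h2]

lemma MvN.dsum_fromBlocks {m n : ℕ} {P : Matrix (Fin m) (Fin m) A} {Q : Matrix (Fin n) (Fin n) A}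
    (hP : IsStarProjection P) (hQ : IsStarProjection Q) :
    MvN (dsum P Q) (Matrix.fromBlocks P 0 0 Q) :=
  MvN.reindex (isStarProjection_fromBlocks hP hQ) _

/-- The block-diagonal sum of two orthogonal projections is equivalent to their sum. -/
lemma MvN.dsum_add {n : ℕ} {P Q : Matrix (Fin n) (Fin n) A}
    (hP : IsStarProjection P) (hQ : IsStarProjection Q) (hPQ : P * Q = 0) :
    MvN (Matrix.fromBlocks P 0 0 Q) (P + Q) := by
  have h1 := conjTranspose_of_isStarProjection hP
  have h2 := conjTranspose_of_isStarProjection hQ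
  have hQP : Q * P = 0 := by simpa [h1, h2] using congrArg Matrix.conjTranspose hPQ
  refine ⟨Matrix.fromRows P Q, ?_, ?_⟩
  · rw [Matrix.conjTranspose_fromRows_eq_fromCols_conjTranspose, Matrix.fromRows_mul_fromCols]
    simp [h1, h2, hPQ, hQP, mul_self_of_isStarProjection hP, mul_self_of_isStarProjection hQ]
  · rw [Matrix.conjTranspose_fromRows_eq_fromCols_conjTranspose, Matrix.fromCols_mul_fromRows]
    simp [h1, h2, mul_self_of_isStarProjection hP, mul_self_of_isStarProjection hQ]

lemma K0Unital.mk_add_of_orthogonal {n : ℕ} {P Q : Matrix (Fin n) (Fin n) A}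
    (hP : IsStarProjection P) (hQ : IsStarProjection Q) (hPQ : P * Q = 0)
    (hs : IsStarProjection (P + Q)) :
    K0Unital.mk (P + Q) hs = K0Unital.mk P hP + K0Unital.mk Q hQ := by
  rw [← K0Unital.mk_dsum]
  exact (((MvN.dsum_fromBlocks hP hQ).trans (isStarProjection_dsum hP hQ) hs
    (MvN.dsum_add hP hQ hPQ)).mk_eq _ _).symm

lemma K0Unital.mk_one_sub {n : ℕ} {P : Matrix (Fin n) (Fin n) A} (hP : IsStarProjection P) :
    K0Unital.mk P hP + K0Unital.mk (1 - P) hP.one_sub =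
      K0Unital.mk (1 : Matrix (Fin n) (Fin n) A) (IsStarProjection.one _) := by
  rw [← K0Unital.mk_add_of_orthogonal hP hP.one_sub
    (by rw [mul_sub, mul_one, mul_self_of_isStarProjection hP, sub_self])
    (by rw [add_sub_cancel]; exact IsStarProjection.one _)]
  congr 1
  rw [add_sub_cancel]

lemma K0Unital.ofProj_add_of_orthogonal {p q : A}
    (hp : IsStarProjection p) (hq : IsStarProjection q) (h : p * q = 0)
    (hs : IsStarProjection (p + q)) :
    K0Unital.ofProj (p + q) hs = K0Unital.ofProj p hp + K0Unital.ofProj q hq := by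
  unfold K0Unital.ofProj
  have e : (!![p + q] : Matrix (Fin 1) (Fin 1) A) = !![p] + !![q] := by
    ext i j; fin_cases i; fin_cases j; rfl
  rw [← K0Unital.mk_add_of_orthogonal (isStarProjection_single hp) (isStarProjection_single hq)]
  · congr 1
  · ext i j; fin_cases i; fin_cases j; simpa [Matrix.mul_apply] using h
  · rw [← e]; exact isStarProjection_single hs

/-- Every element of `K₀` of a unital algebra is a difference of classes of projections. -/
lemma K0Unital.exists_eq_sub (x : K0Unital A) : ∃ (m n : ℕ) (P : Matrix (Fin m) (Fin m) A)
    (Q : Matrix (Fin n) (Fin n) A) (hP : IsStarProjection P) (hQ : IsStarProjection Q),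
    x = K0Unital.mk P hP - K0Unital.mk Q hQ := by
  obtain ⟨x, rfl⟩ := QuotientAddGroup.mk_surjective x
  have h0 : IsStarProjection (0 : Matrix (Fin 0) (Fin 0) A) := IsStarProjection.zero _
  induction x using FreeAbelianGroup.induction_on with
  | zero =>
    refine ⟨0, 0, 0, 0, h0, h0, ?_⟩
    rw [sub_self]; rfl
  | of x =>
    refine ⟨x.1, 0, x.2.1, 0, x.2.2, h0, ?_⟩
    rw [K0Unital.mk_zero, sub_zero]; rfl
  | neg x h =>
    obtain ⟨m, n, P, Q, hP, hQ, e⟩ := h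
    refine ⟨n, m, Q, P, hQ, hP, ?_⟩
    rw [QuotientAddGroup.mk_neg, e, neg_sub]
  | add x y hx hy =>
    obtain ⟨m, n, P, Q, hP, hQ, e⟩ := hx
    obtain ⟨m', n', P', Q', hP', hQ', e'⟩ := hy
    refine ⟨_, _, _, _, isStarProjection_dsum hP hP', isStarProjection_dsum hQ hQ', ?_⟩
    rw [QuotientAddGroup.mk_add, e, e', K0Unital.mk_dsum hP hP', K0Unital.mk_dsum hQ hQ']
    abel

variable (A) in
/-- Murray-von Neumann equivalence as a setoid on the projections in matrices over `A`. -/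
def mvnSetoid : Setoid (MatProj A) where
  r x y := MvN x.2.1 y.2.1
  iseqv :=
    { refl := fun x => MvN.refl x.2.2
      symm := fun h => h.symm
      trans := fun {x _ z} h h' => h.trans x.2.2 z.2.2 h' }

variable (A) in
/-- The monoid of Murray-von Neumann classes of projections in matrices over `A`. -/
def MvNClass : Type u := Quotient (mvnSetoid A)

/-- The Murray-von Neumann class of a projection in a matrix algebra. -/
def MvNClass.mk (x : MatProj A) : MvNClass A := Quotient.mk (mvnSetoid A) x

lemma MvNClass.mk_eq_mk {x y : MatProj A} : MvNClass.mk x = MvNClass.mk y ↔ MvN x.2.1 y.2.1 :=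
  Quotient.eq (r := mvnSetoid A)

lemma MvN.dsum {m n m' n' : ℕ} {P : Matrix (Fin m) (Fin m) A} {Q : Matrix (Fin n) (Fin n) A}
    {P' : Matrix (Fin m') (Fin m') A} {Q' : Matrix (Fin n') (Fin n') A}
    (hP : IsStarProjection P) (hQ : IsStarProjection Q)
    (hP' : IsStarProjection P') (hQ' : IsStarProjection Q') (h : MvN P P') (h' : MvN Q Q') :
    MvN (KTheory.dsum P Q) (KTheory.dsum P' Q') := by
  have s1 := isStarProjection_dsum hP hQ
  have s2 := isStarProjection_fromBlocks hP' hQ'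
  exact ((MvN.dsum_fromBlocks hP hQ).trans s1 s2 (h.fromBlocks h')).trans s1
    (isStarProjection_dsum hP' hQ') (MvN.dsum_fromBlocks hP' hQ').symm

lemma MvN.dsum_comm {m n : ℕ} {P : Matrix (Fin m) (Fin m) A} {Q : Matrix (Fin n) (Fin n) A}
    (hP : IsStarProjection P) (hQ : IsStarProjection Q) :
    MvN (KTheory.dsum P Q) (KTheory.dsum Q P) := by
  have s1 := isStarProjection_dsum hP hQ
  have s2 := isStarProjection_fromBlocks hQ hP
  have e : Matrix.reindex (Equiv.sumComm _ _) (Equiv.sumComm _ _) (Matrix.fromBlocks Q 0 0 P) =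
      Matrix.fromBlocks P 0 0 Q := by
    ext (i | i) (j | j) <;> rfl
  have h := MvN.reindex s2 (Equiv.sumComm _ _)
  rw [e] at h
  exact ((MvN.dsum_fromBlocks hP hQ).trans s1 s2 h).trans s1
    (isStarProjection_dsum hQ hP) (MvN.dsum_fromBlocks hQ hP).symm

lemma MvN.dsum_assoc {m n k : ℕ} {P : Matrix (Fin m) (Fin m) A} {Q : Matrix (Fin n) (Fin n) A}
    {R : Matrix (Fin k) (Fin k) A} (hP : IsStarProjection P) (hQ : IsStarProjection Q)
    (hR : IsStarProjection R) :
    MvN (KTheory.dsum (KTheory.dsum P Q) R) (KTheory.dsum P (KTheory.dsum Q R)) := by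
  have s1 := isStarProjection_dsum hP hQ
  have s2 := isStarProjection_dsum hQ hR
  have s3 := isStarProjection_dsum s1 hR
  have t1 := isStarProjection_fromBlocks hP hQ
  have t2 := isStarProjection_fromBlocks hQ hR
  have t3 := isStarProjection_fromBlocks hP t2
  have t4 := isStarProjection_fromBlocks t1 hR
  have e : Matrix.reindex (Equiv.sumAssoc _ _ _) (Equiv.sumAssoc _ _ _)
      (Matrix.fromBlocks (Matrix.fromBlocks P 0 0 Q) 0 0 R) =
      Matrix.fromBlocks P 0 0 (Matrix.fromBlocks Q 0 0 R) := by
    ext (i | i | i) (j | j | j) <;> rfl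
  have h := MvN.reindex t4 (Equiv.sumAssoc _ _ _)
  rw [e] at h
  have h1 := (MvN.dsum_fromBlocks s1 hR).trans s3 t4
    ((MvN.dsum_fromBlocks hP hQ).fromBlocks (MvN.refl hR))
  have h2 := (h1.trans s3 t3 h.symm).trans s3 (isStarProjection_fromBlocks hP s2)
    ((MvN.refl hP).fromBlocks (MvN.dsum_fromBlocks hQ hR).symm)
  exact h2.trans s3 (isStarProjection_dsum hP s2) (MvN.dsum_fromBlocks hP s2).symm

lemma MvN.dsum_zero {m n : ℕ} {P : Matrix (Fin m) (Fin m) A} (hP : IsStarProjection P) :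
    MvN (KTheory.dsum P (0 : Matrix (Fin n) (Fin n) A)) P := by
  have h0 : IsStarProjection (0 : Matrix (Fin n) (Fin n) A) := IsStarProjection.zero _
  refine (MvN.dsum_fromBlocks hP h0).trans (isStarProjection_dsum hP h0) hP ?_
  have h1 := conjTranspose_of_isStarProjection hP
  have h2 := mul_self_of_isStarProjection hP
  refine ⟨Matrix.fromRows P 0, ?_, ?_⟩
  · rw [Matrix.conjTranspose_fromRows_eq_fromCols_conjTranspose, Matrix.fromRows_mul_fromCols]
    simp [h1, h2]
  · rw [Matrix.conjTranspose_fromRows_eq_fromCols_conjTranspose, Matrix.fromCols_mul_fromRows]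
    simp [h1, h2]

instance : Add (MvNClass A) where
  add := Quotient.map₂ MatProj.dsum fun x x' h y y' h' =>
    MvN.dsum x.2.2 y.2.2 x'.2.2 y'.2.2 h h'

instance : Zero (MvNClass A) where
  zero := MvNClass.mk ⟨0, 0, IsStarProjection.zero _⟩

instance : AddCommMonoid (MvNClass A) where
  add_assoc := by
    rintro ⟨x⟩ ⟨y⟩ ⟨z⟩
    exact MvNClass.mk_eq_mk.2 (MvN.dsum_assoc x.2.2 y.2.2 z.2.2)
  add_comm := by
    rintro ⟨x⟩ ⟨y⟩
    exact MvNClass.mk_eq_mk.2 (MvN.dsum_comm x.2.2 y.2.2)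
  zero_add := by
    rintro ⟨x⟩
    exact MvNClass.mk_eq_mk.2 (((MvN.dsum_comm (IsStarProjection.zero _) x.2.2).trans
      (isStarProjection_dsum (IsStarProjection.zero _) x.2.2) x.2.2 (MvN.dsum_zero x.2.2)))
  add_zero := by
    rintro ⟨x⟩
    exact MvNClass.mk_eq_mk.2 (MvN.dsum_zero x.2.2)
  nsmul := nsmulRec

lemma MvNClass.mk_dsum (x y : MatProj A) :
    MvNClass.mk (x.dsum y) = MvNClass.mk x + MvNClass.mk y := rfl

lemma MvNClass.mk_add_one_sub {n : ℕ} {P : Matrix (Fin n) (Fin n) A} (hP : IsStarProjection P) :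
    MvNClass.mk ⟨n, P, hP⟩ + MvNClass.mk ⟨n, 1 - P, hP.one_sub⟩ =
      MvNClass.mk ⟨n, 1, IsStarProjection.one _⟩ := by
  rw [← MvNClass.mk_dsum]
  refine MvNClass.mk_eq_mk.2 ?_
  have h := MvN.dsum_add hP hP.one_sub
    (by rw [mul_sub, mul_one, mul_self_of_isStarProjection hP, sub_self])
  rw [add_sub_cancel] at h
  exact (MvN.dsum_fromBlocks hP hP.one_sub).trans (isStarProjection_dsum hP hP.one_sub)
    (IsStarProjection.one _) h

variable (A) in
/-- The comparison of `K₀`, given by generators and relations, with the Grothendieck group of the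
monoid of Murray-von Neumann classes. -/
noncomputable def K0Unital.toGrothendieck :
    K0Unital A →+ Algebra.GrothendieckAddGroup (MvNClass A) :=
  QuotientAddGroup.lift _
    (FreeAbelianGroup.lift fun x => Algebra.GrothendieckAddGroup.of (MvNClass.mk x)) (by
      rw [AddSubgroup.closure_le]
      intro x hx
      rw [SetLike.mem_coe, AddMonoidHom.mem_ker]
      cases hx with
      | equiv x y w hx hy =>
        rw [map_sub, FreeAbelianGroup.lift_apply_of, FreeAbelianGroup.lift_apply_of,
          (MvNClass.mk_eq_mk (x := x) (y := y)).2 ⟨w, hx, hy⟩, sub_self]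
      | dsum x y =>
        rw [map_sub, map_add, FreeAbelianGroup.lift_apply_of, FreeAbelianGroup.lift_apply_of,
          FreeAbelianGroup.lift_apply_of, MvNClass.mk_dsum, map_add, sub_self])

/-- Projections with the same class in `K₀` become Murray-von Neumann equivalent after adding
a large enough identity matrix. -/
lemma K0Unital.exists_mvn_of_mk_eq {m n : ℕ} {P : Matrix (Fin m) (Fin m) A}
    {Q : Matrix (Fin n) (Fin n) A} (hP : IsStarProjection P) (hQ : IsStarProjection Q)
    (h : K0Unital.mk P hP = K0Unital.mk Q hQ) : ∃ k : ℕ,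
    MvN (KTheory.dsum P (1 : Matrix (Fin k) (Fin k) A))
      (KTheory.dsum Q (1 : Matrix (Fin k) (Fin k) A)) := by
  have h1 : Algebra.GrothendieckAddGroup.of (MvNClass.mk ⟨m, P, hP⟩) =
      Algebra.GrothendieckAddGroup.of (MvNClass.mk ⟨n, Q, hQ⟩) := by
    have h2 := congrArg (K0Unital.toGrothendieck A) h
    have h3 (x : MatProj A) : K0Unital.toGrothendieck A (K0Unital.mk x.2.1 x.2.2) =
        Algebra.GrothendieckAddGroup.of (MvNClass.mk x) :=
      FreeAbelianGroup.lift_apply_of _ _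
    exact (h3 ⟨m, P, hP⟩).symm.trans (h2.trans (h3 ⟨n, Q, hQ⟩))
  obtain ⟨⟨c, _⟩, hc⟩ := ((AddLocalization.addMonoidOf
    (⊤ : AddSubmonoid (MvNClass A))).eq_iff_exists).1 h1
  revert hc
  refine Quotient.inductionOn c ?_
  rintro ⟨k, R, hR⟩ hc
  refine ⟨k, ?_⟩
  change MvNClass.mk ⟨k, R, hR⟩ + _ = MvNClass.mk ⟨k, R, hR⟩ + _ at hc
  have h4 : MvNClass.mk ⟨m, P, hP⟩ + MvNClass.mk ⟨k, 1, IsStarProjection.one _⟩ =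
      MvNClass.mk ⟨n, Q, hQ⟩ + MvNClass.mk ⟨k, 1, IsStarProjection.one _⟩ := by
    rw [← MvNClass.mk_add_one_sub hR, ← add_assoc, ← add_assoc,
      add_comm _ (MvNClass.mk ⟨k, R, hR⟩), add_comm _ (MvNClass.mk ⟨k, R, hR⟩), hc]
  exact MvNClass.mk_eq_mk.1 h4

end MvN

end KTheory

/-! ### Paths of projections -/

/-- Two projections of a C⋆-algebra at distance less than one are Murray-von Neumann equivalent,
through the partial isometry `p q (1 - (p - q)²) ^ (-1/2)`. -/
lemma exists_mul_star_eq_of_norm_sub_lt_one {A : Type*} [CStarAlgebra A] {p q : A}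
    (hp : IsStarProjection p) (hq : IsStarProjection q) (h : ‖p - q‖ < 1) :
    ∃ w : A, w * star w = p ∧ star w * w = q := by
  nontriviality A
  have hp1 : p * p = p := hp.isIdempotentElem
  have hq1 : q * q = q := hq.isIdempotentElem
  have hp2 : star p = p := hp.isSelfAdjoint
  have hq2 : star q = q := hq.isSelfAdjoint
  set e := (p - q) * (p - q) with he
  have hesa : IsSelfAdjoint e := by
    rw [IsSelfAdjoint, he, star_mul, star_sub, hp2, hq2]
  have hen : ‖e‖ < 1 := (norm_mul_le _ _).trans_lt (by nlinarith [norm_nonneg (p - q)])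
  have hspec : ∀ x ∈ spectrum ℝ e, 0 < 1 - x := fun x hx => by
    have := spectrum.norm_le_norm_of_mem hx
    have := (le_abs_self x).trans (this.trans_lt hen).le
    have h2 := (le_abs_self x).trans_lt ((spectrum.norm_le_norm_of_mem hx).trans_lt hen)
    linarith
  set d := cfc (fun x : ℝ => (√(1 - x))⁻¹) e with hd
  have hcont : ContinuousOn (fun x : ℝ => (√(1 - x))⁻¹) (spectrum ℝ e) :=
    ContinuousOn.inv₀ (by fun_prop) fun x hx => (Real.sqrt_pos.2 (hspec x hx)).ne'
  have hdsa : star d = d := IsSelfAdjoint.cfc (f := fun x : ℝ => (√(1 - x))⁻¹) (a := e)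
  have hdd : d * d * (1 - e) = 1 := by
    have e1 : (1 - e) = cfc (fun x : ℝ => 1 - x) e := by
      rw [cfc_sub .., cfc_const_one .., cfc_id' ..]
    rw [e1, hd, ← cfc_mul _ _ e hcont hcont, ← cfc_mul (fun x : ℝ => (√(1 - x))⁻¹ * (√(1 - x))⁻¹)
      (fun x : ℝ => 1 - x) e (hcont.mul hcont) (by fun_prop), ← cfc_one ℝ e]
    refine cfc_congr fun x hx => ?_
    have := hspec x hx
    have h3 := (Real.sqrt_pos.2 this).ne'
    have h4 := Real.mul_self_sqrt this.le
    simp only [Pi.one_apply]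
    field_simp
    rw [sq]; linarith
  have hp3 (x : A) : p * (p * x) = p * x := by rw [← mul_assoc, hp1]
  have hq3 (x : A) : q * (q * x) = q * x := by rw [← mul_assoc, hq1]
  have hpe : e * p = p * e := by
    simp only [he, sub_mul, mul_sub, mul_assoc, hp1, hq1, hp3]; abel
  have hqe : e * q = q * e := by
    simp only [he, sub_mul, mul_sub, mul_assoc, hp1, hq1, hq3]; abel
  have hdp : d * p = p * d :=
    (Commute.cfc (𝕜 := ℝ) hpe (by rw [hesa.star_eq]; exact hpe) _ : Commute d p)
  have hdq : d * q = q * d :=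
    (Commute.cfc (𝕜 := ℝ) hqe (by rw [hesa.star_eq]; exact hqe) _ : Commute d q)
  have hdp' (x : A) : p * (d * x) = d * (p * x) := by rw [← mul_assoc, ← hdp, mul_assoc]
  have hdq' (x : A) : q * (d * x) = d * (q * x) := by rw [← mul_assoc, ← hdq, mul_assoc]
  have hpqp : p * (q * p) = (1 - e) * p := by
    simp only [he, sub_mul, mul_sub, mul_assoc, hp1, one_mul, hq3]; abel
  have hqpq : q * (p * q) = (1 - e) * q := by
    simp only [he, sub_mul, mul_sub, mul_assoc, hq1, one_mul, hp3]; abel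
  refine ⟨p * q * d, ?_, ?_⟩
  · calc p * q * d * star (p * q * d) = d * d * (p * (q * p)) := by
          simp only [star_mul, hp2, hq2, hdsa, mul_assoc, hdp', hdq', hq3]
      _ = p := by rw [hpqp, ← mul_assoc, hdd, one_mul]
  · calc star (p * q * d) * (p * q * d) = d * d * (q * (p * q)) := by
          simp only [star_mul, hp2, hq2, hdsa, mul_assoc, hdp', hdq', hp3, ← hdq]
      _ = q := by rw [hqpq, ← mul_assoc, hdd, one_mul]

namespace KTheory

/-- The class in `K₀` is constant along a norm continuous path of projections. -/
lemma K0Unital.mk_eq_of_path {A : Type*} [CStarAlgebra A] {n : ℕ}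
    (P : I → Matrix (Fin n) (Fin n) A) (hP : ∀ t, IsStarProjection (P t))
    (hc : ∀ i j, Continuous fun t => P t i j) (s t : I) :
    K0Unital.mk (P s) (hP s) = K0Unital.mk (P t) (hP t) := by
  let _ := CStarAlgebra.spectralOrder A
  have _ := CStarAlgebra.spectralOrderedRing A
  have hc' : Continuous fun t => CStarMatrix.ofMatrix (P t) :=
    continuous_pi fun i => continuous_pi fun j => hc i j
  refine IsLocallyConstant.apply_eq_of_preconnectedSpace
    (f := fun t => K0Unital.mk (P t) (hP t)) ?_ s t
  rw [IsLocallyConstant.iff_eventually_eq]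
  intro s
  have hn : Continuous fun t => ‖CStarMatrix.ofMatrix (P t) - CStarMatrix.ofMatrix (P s)‖ :=
    continuous_norm.comp (hc'.sub continuous_const)
  have h0 : ‖CStarMatrix.ofMatrix (P s) - CStarMatrix.ofMatrix (P s)‖ < 1 := by simp
  filter_upwards [hn.continuousAt.eventually_lt continuousAt_const h0] with t ht
  obtain ⟨w, h1, h2⟩ := exists_mul_star_eq_of_norm_sub_lt_one
    (A := CStarMatrix (Fin n) (Fin n) A) (p := CStarMatrix.ofMatrix (P t))
    (q := CStarMatrix.ofMatrix (P s)) ⟨(hP t).1, (hP t).2⟩ ⟨(hP s).1, (hP s).2⟩ ht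
  exact MvN.mk_eq ⟨w, h1, h2⟩ _ _

end KTheory

/-! ### The split extension `0 → B → D(B) → M(B) → 0` in `K₀` -/

namespace KTheory

section functoriality

variable {A C E : Type*} [Ring A] [StarRing A] [Algebra ℂ A]
  [Ring C] [StarRing C] [Algebra ℂ C] [Ring E] [StarRing E] [Algebra ℂ E]

lemma K0Unital.map_comp (g : C →⋆ₐ[ℂ] E) (f : A →⋆ₐ[ℂ] C) (x : K0Unital A) :
    K0Unital.map (g.comp f) x = K0Unital.map g (K0Unital.map f x) := by
  obtain ⟨m, n, P, Q, hP, hQ, rfl⟩ := K0Unital.exists_eq_sub x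
  simp only [map_sub, K0Unital.map_mk]
  rfl

lemma dsum_map (f : A →⋆ₐ[ℂ] C) {m n : ℕ} (P : Matrix (Fin m) (Fin m) A)
    (Q : Matrix (Fin n) (Fin n) A) : (dsum P Q).map f = dsum (P.map f) (Q.map f) := by
  simp only [dsum, Matrix.reindex_apply, ← Matrix.submatrix_map, Matrix.fromBlocks_map]
  congr 2 <;> (ext i j; simp)

end functoriality

variable {B : Type u} [NonUnitalCStarAlgebra B]

variable (B) in
/-- The unital homomorphism `b + λ ↦ (b + λ, λ)` from the unitization of `B` to `D(B)`. -/
noncomputable def unitizationToDouble : Unitization ℂ B →⋆ₐ[ℂ] Double B :=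
  Unitization.starLift (inclDouble B)

variable (B) in
/-- The endomorphism `b + λ ↦ λ` of the unitization of `B`. -/
noncomputable def scalarEnd : Unitization ℂ B →⋆ₐ[ℂ] Unitization ℂ B :=
  (StarAlgHom.ofId ℂ (Unitization ℂ B)).comp (scalarPart B)

variable (B) in
/-- The endomorphism `(x, y) ↦ (y, y)` of `D(B)`. -/
noncomputable def doubleDiag : Double B →⋆ₐ[ℂ] Double B where
  toFun x := ⟨(x.1.2, x.1.2), by
    change InAlg (x.1.2 - x.1.2)
    rw [sub_self]; exact InAlg.zero⟩
  map_one' := rfl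
  map_mul' _ _ := rfl
  map_zero' := rfl
  map_add' _ _ := rfl
  commutes' _ := rfl
  map_star' _ := rfl

lemma scalarPart_apply (x : Unitization ℂ B) : scalarPart B x = x.fst := by
  change algebraMap ℂ ℂ x.fst + 0 = x.fst
  simp

lemma scalarEnd_fst (x : Unitization ℂ B) : (scalarEnd B x).fst = x.fst := by
  change (algebraMap ℂ (Unitization ℂ B) (scalarPart B x)).fst = x.fst
  rw [scalarPart_apply]; rfl

lemma scalarEnd_snd (x : Unitization ℂ B) : (scalarEnd B x).snd = 0 := by
  change (algebraMap ℂ (Unitization ℂ B) (scalarPart B x)).snd = 0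
  rfl

lemma unitizationToDouble_fst (x : Unitization ℂ B) : (unitizationToDouble B x).1.1 =
    algebraMap ℂ 𝓜(ℂ, B) x.fst + DoubleCentralizer.coeHom (𝕜 := ℂ) x.snd := rfl

lemma unitizationToDouble_snd (x : Unitization ℂ B) : (unitizationToDouble B x).1.2 =
    algebraMap ℂ 𝓜(ℂ, B) x.fst :=
  add_zero _

lemma unitizationToDouble_scalarEnd (x : Unitization ℂ B) :
    unitizationToDouble B (scalarEnd B x) = doubleDiag B (unitizationToDouble B x) := by
  refine Subtype.ext (Prod.ext ?_ ?_)
  · change _ = (unitizationToDouble B x).1.2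
    rw [unitizationToDouble_fst, unitizationToDouble_snd, scalarEnd_fst, scalarEnd_snd, map_zero,
      add_zero]
  · change _ = (unitizationToDouble B x).1.2
    rw [unitizationToDouble_snd, unitizationToDouble_snd, scalarEnd_fst]

lemma coeHom_injective :
    Function.Injective (DoubleCentralizer.coeHom (𝕜 := ℂ) (A := B)) := by
  rw [injective_iff_map_eq_zero]
  intro b hb
  have h := congrArg (fun m : 𝓜(ℂ, B) => m.fst (star b)) hb
  exact (CStarRing.mul_star_self_eq_zero_iff b).1 h

lemma unitization_ext {x y : Unitization ℂ B}
    (h : unitizationToDouble B x = unitizationToDouble B y) (h' : x.fst = y.fst) : x = y := by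
  refine Unitization.ext h' (coeHom_injective ?_)
  have h1 := congrArg (fun d : Double B => d.1.1) h
  simp only [unitizationToDouble_fst, h'] at h1
  exact add_left_cancel h1

lemma exists_unitizationToDouble_eq (d : Double B) (c : ℂ)
    (h : d.1.2 = algebraMap ℂ 𝓜(ℂ, B) c) : ∃ x, unitizationToDouble B x = d ∧ x.fst = c := by
  obtain ⟨b, hb⟩ := d.2
  refine ⟨Unitization.inl c + Unitization.inr b, Subtype.ext (Prod.ext ?_ ?_), by simp⟩
  · rw [unitizationToDouble_fst]
    simp [hb, h]
  · rw [unitizationToDouble_snd, h]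
    simp

section matrices

variable {m n : Type}

/-- The unitization of `B` is the pullback of `D(B)` and `ℂ`. The scalar parts are needed for the
case `B = 0`, where `D(B) = 0`. -/
lemma matrix_unitization_ext {w w' : Matrix m n (Unitization ℂ B)}
    (h : w.map (unitizationToDouble B) = w'.map (unitizationToDouble B))
    (h' : w.map (scalarPart B) = w'.map (scalarPart B)) : w = w' := by
  ext1 i j
  refine unitization_ext (congrFun (congrFun h i) j) ?_
  rw [← scalarPart_apply, ← scalarPart_apply]
  exact congrFun (congrFun h' i) j

lemma exists_matrix_unitizationToDouble_eq (W : Matrix m n (Double B)) (Z : Matrix m n ℂ)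
    (h : ∀ i j, (W i j).1.2 = algebraMap ℂ 𝓜(ℂ, B) (Z i j)) :
    ∃ w : Matrix m n (Unitization ℂ B), w.map (unitizationToDouble B) = W ∧
      w.map (scalarPart B) = Z := by
  choose f h1 h2 using fun i j => exists_unitizationToDouble_eq (W i j) (Z i j) (h i j)
  refine ⟨Matrix.of f, ?_, ?_⟩
  · ext1 i j; exact h1 i j
  · ext1 i j
    rw [Matrix.map_apply, scalarPart_apply]; exact h2 i j

lemma scalarPart_map_scalarEnd (P : Matrix m n (Unitization ℂ B)) :
    (P.map (scalarEnd B)).map (scalarPart B) = P.map (scalarPart B) := by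
  ext1 i j
  simp only [Matrix.map_apply, scalarPart_apply, scalarEnd_fst]

lemma unitizationToDouble_map_scalarEnd (P : Matrix m n (Unitization ℂ B)) :
    (P.map (scalarEnd B)).map (unitizationToDouble B) =
      (P.map (unitizationToDouble B)).map (doubleDiag B) := by
  ext1 i j
  simp only [Matrix.map_apply, unitizationToDouble_scalarEnd]

end matrices

/-- An equivalence in `D(B)` between a projection over the unitization of `B` and its scalar part
comes from an equivalence over the unitization: if `W` implements it, then so does
`W (δ W)⋆` with `δ (x, y) = (y, y)`, and this matrix has scalar second components. -/
lemma MvN.of_map_unitizationToDouble {n : ℕ} {P : Matrix (Fin n) (Fin n) (Unitization ℂ B)}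
    (hP : IsStarProjection P) (h : MvN (P.map (unitizationToDouble B))
      ((P.map (scalarEnd B)).map (unitizationToDouble B))) : MvN P (P.map (scalarEnd B)) := by
  obtain ⟨W, h1, h2⟩ := h
  have hX := isStarProjection_map (unitizationToDouble B) hP
  rw [unitizationToDouble_map_scalarEnd] at h2
  have hY := isStarProjection_map (doubleDiag B) hX
  set X := P.map (unitizationToDouble B) with hXdef
  set Y := X.map (doubleDiag B) with hYdef
  set V := W.map (doubleDiag B) with hV
  have h3 : V * Vᴴ = Y := by
    rw [hV, conjTranspose_map', ← Matrix.map_mul, h1]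
  have h4 : Vᴴ * V = Y := by
    rw [hV, conjTranspose_map', ← Matrix.map_mul, h2]
    rfl
  have h5 : (W * Vᴴ) * (W * Vᴴ)ᴴ = X := by
    calc (W * Vᴴ) * (W * Vᴴ)ᴴ = W * (Vᴴ * V) * Wᴴ := by
          rw [Matrix.conjTranspose_mul]
          simp only [Matrix.mul_assoc, Matrix.conjTranspose_conjTranspose]
      _ = (W * Wᴴ) * (W * Wᴴ) := by rw [h4, ← h2]; simp only [Matrix.mul_assoc]
      _ = X := by rw [h1, mul_self_of_isStarProjection hX]
  have h6 : (W * Vᴴ)ᴴ * (W * Vᴴ) = Y := by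
    calc (W * Vᴴ)ᴴ * (W * Vᴴ) = V * (Wᴴ * W) * Vᴴ := by
          rw [Matrix.conjTranspose_mul]
          simp only [Matrix.mul_assoc, Matrix.conjTranspose_conjTranspose]
      _ = (V * Vᴴ) * (V * Vᴴ) := by rw [h2, ← h4]; simp only [Matrix.mul_assoc]
      _ = Y := by rw [h3, mul_self_of_isStarProjection hY]
  have h7 : (W * Vᴴ).map (doubleDiag B) = Y := by
    rw [Matrix.map_mul, ← h3]
    rfl
  obtain ⟨w, hw1, hw2⟩ := exists_matrix_unitizationToDouble_eq (W * Vᴴ) (P.map (scalarPart B))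
    (fun i j => by
      have h8 := congrArg (fun d : Double B => d.1.2) (congrFun (congrFun h7 i) j)
      refine h8.trans ?_
      change (unitizationToDouble B (P i j)).1.2 = _
      rw [unitizationToDouble_snd, Matrix.map_apply, scalarPart_apply])
  have hZ := isStarProjection_map (scalarPart B) hP
  refine ⟨w, matrix_unitization_ext ?_ ?_, matrix_unitization_ext ?_ ?_⟩
  · rw [Matrix.map_mul, ← conjTranspose_map', hw1, h5]
  · rw [Matrix.map_mul, ← conjTranspose_map', hw2, conjTranspose_of_isStarProjection hZ,
      mul_self_of_isStarProjection hZ]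
  · rw [Matrix.map_mul, ← conjTranspose_map', hw1, h6, unitizationToDouble_map_scalarEnd]
  · rw [Matrix.map_mul, ← conjTranspose_map', hw2, conjTranspose_of_isStarProjection hZ,
      mul_self_of_isStarProjection hZ, scalarPart_map_scalarEnd]

/-- The class `[P] - [s(P)] ∈ K₀(B)` of a projection `P` over the unitization of `B`, where
`s(P)` is the scalar part of `P`. -/
noncomputable def K0.ofMatrix {n : ℕ} (P : Matrix (Fin n) (Fin n) (Unitization ℂ B))
    (hP : IsStarProjection P) : K0 B :=
  ⟨K0Unital.mk P hP - K0Unital.mk (P.map (scalarEnd B)) (isStarProjection_map _ hP), by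
    rw [AddMonoidHom.mem_ker, map_sub, K0Unital.map_mk, K0Unital.map_mk, sub_eq_zero]
    congr 1
    rw [scalarPart_map_scalarEnd]⟩

/-- The standard picture of `K₀`: every element is of the form `[P] - [s(P)]`. -/
lemma K0.exists_eq_ofMatrix (x : K0 B) : ∃ (n : ℕ)
    (P : Matrix (Fin n) (Fin n) (Unitization ℂ B)) (hP : IsStarProjection P),
    x = K0.ofMatrix P hP := by
  obtain ⟨x, hx⟩ := x
  obtain ⟨m, n, P, Q, hP, hQ, e⟩ := K0Unital.exists_eq_sub x
  have hs := isStarProjection_dsum hP hQ.one_sub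
  refine ⟨m + n, dsum P (1 - Q), hs, Subtype.ext ?_⟩
  have h1 : x = K0Unital.mk _ hs - K0Unital.mk (1 : Matrix (Fin n) (Fin n) (Unitization ℂ B))
      (IsStarProjection.one _) := by
    rw [K0Unital.mk_dsum hP hQ.one_sub, ← K0Unital.mk_one_sub hQ, e]; abel
  have h2 : K0Unital.map (scalarEnd B) x = 0 := by
    rw [scalarEnd, K0Unital.map_comp, (AddMonoidHom.mem_ker).1 hx, map_zero]
  have h3 : (1 : Matrix (Fin n) (Fin n) (Unitization ℂ B)).map (scalarEnd B) = 1 :=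
    Matrix.map_one _ (map_zero _) (map_one _)
  rw [h1, map_sub, K0Unital.map_mk, K0Unital.map_mk] at h2
  simp only [h3] at h2
  rw [sub_eq_zero] at h2
  change x = K0Unital.mk _ hs - K0Unital.mk _ _
  rw [h1, ← h2]

lemma K0.toDouble_ofMatrix {n : ℕ} (P : Matrix (Fin n) (Fin n) (Unitization ℂ B))
    (hP : IsStarProjection P) : K0.toDouble B (K0.ofMatrix P hP) =
      K0Unital.mk (P.map (unitizationToDouble B)) (isStarProjection_map _ hP) -
      K0Unital.mk ((P.map (unitizationToDouble B)).map (doubleDiag B))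
        (isStarProjection_map _ (isStarProjection_map _ hP)) := by
  change K0Unital.map (unitizationToDouble B) (K0Unital.mk P hP -
    K0Unital.mk (P.map (scalarEnd B)) (isStarProjection_map _ hP)) = _
  rw [map_sub, K0Unital.map_mk, K0Unital.map_mk]
  congr 2
  exact unitizationToDouble_map_scalarEnd P

/-- The map `K₀(B) → K₀(D(B))` is injective. -/
lemma K0.toDouble_injective : Function.Injective (K0.toDouble B) := by
  rw [injective_iff_map_eq_zero]
  intro x hx
  obtain ⟨n, P, hP, rfl⟩ := K0.exists_eq_ofMatrix x
  rw [K0.toDouble_ofMatrix, sub_eq_zero] at hx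
  obtain ⟨k, hk⟩ := K0Unital.exists_mvn_of_mk_eq _ _ hx
  have h1 : (1 : Matrix (Fin k) (Fin k) (Unitization ℂ B)).map (unitizationToDouble B) = 1 :=
    Matrix.map_one _ (map_zero _) (map_one _)
  have h2 : (1 : Matrix (Fin k) (Fin k) (Unitization ℂ B)).map (scalarEnd B) = 1 :=
    Matrix.map_one _ (map_zero _) (map_one _)
  have hI : IsStarProjection (1 : Matrix (Fin k) (Fin k) (Unitization ℂ B)) :=
    IsStarProjection.one _
  have hs := isStarProjection_dsum hP hI
  have h3 : MvN (dsum P (1 : Matrix (Fin k) (Fin k) (Unitization ℂ B)))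
      ((dsum P (1 : Matrix (Fin k) (Fin k) (Unitization ℂ B))).map (scalarEnd B)) := by
    refine MvN.of_map_unitizationToDouble hs ?_
    rw [dsum_map, dsum_map, dsum_map, h2, h1, unitizationToDouble_map_scalarEnd]
    exact hk
  have h4 := h3.mk_eq hs (isStarProjection_map _ hs)
  have h5 : (dsum P (1 : Matrix (Fin k) (Fin k) (Unitization ℂ B))).map (scalarEnd B) =
      dsum (P.map (scalarEnd B)) 1 := by rw [dsum_map, h2]
  simp only [h5] at h4
  rw [K0Unital.mk_dsum hP hI, K0Unital.mk_dsum (isStarProjection_map _ hP) hI] at h4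
  refine Subtype.ext ?_
  change K0Unital.mk _ _ - K0Unital.mk _ _ = 0
  rw [sub_eq_zero]
  exact add_right_cancel h4

end KTheory

/-! ### The map `KK_h(ℂ, B) → K₀(B)` -/

namespace KTheory

section rotation

variable {A : Type u} [Ring A] [StarRing A]

/-- The conjugate of `diag (p, 1 - q)` by the unitary `[q, 1 - q; 1 - q, q]`, which takes
`diag (q, 1 - q)` to the scalar projection `diag (1, 0)`. -/
def rotatedPair (p q : A) : Matrix (Fin 2) (Fin 2) A :=
  !![q * p * q + (1 - q), q * p * (1 - q); (1 - q) * p * q, (1 - q) * p * (1 - q)]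

variable {p q : A} (hp : IsStarProjection p) (hq : IsStarProjection q)
include hp hq

lemma isStarProjection_diag : IsStarProjection (!![p, 0; 0, q] : Matrix (Fin 2) (Fin 2) A) := by
  have hp1 : p * p = p := hp.isIdempotentElem
  have hq1 : q * q = q := hq.isIdempotentElem
  have hp2 : star p = p := hp.isSelfAdjoint
  have hq2 : star q = q := hq.isSelfAdjoint
  constructor
  · change _ * _ = _
    ext i j; fin_cases i <;> fin_cases j <;> simp [Matrix.mul_apply, hp1, hq1]
  · change star _ = _
    ext i j; fin_cases i <;> fin_cases j <;> simp [Matrix.star_apply, hp2, hq2]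

lemma K0Unital.mk_diag : K0Unital.mk (!![p, 0; 0, q] : Matrix (Fin 2) (Fin 2) A)
    (isStarProjection_diag hp hq) = K0Unital.ofProj p hp + K0Unital.ofProj q hq := by
  unfold K0Unital.ofProj
  rw [← K0Unital.mk_dsum]
  congr 1
  ext i j; fin_cases i <;> fin_cases j <;> rfl

lemma mvn_rotatedPair : MvN (rotatedPair p q) !![p, 0; 0, 1 - q] := by
  have hp1 : p * p = p := hp.isIdempotentElem
  have hq1 : q * q = q := hq.isIdempotentElem
  have hp2 : star p = p := hp.isSelfAdjoint
  have hq2 : star q = q := hq.isSelfAdjoint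
  have hp3 (x : A) : p * (p * x) = p * x := by rw [← mul_assoc, hp1]
  have hq3 (x : A) : q * (q * x) = q * x := by rw [← mul_assoc, hq1]
  refine ⟨!![q * p, 1 - q; (1 - q) * p, 0], ?_, ?_⟩
  · ext i j; fin_cases i <;> fin_cases j <;>
    simp [rotatedPair, Matrix.mul_apply, Matrix.conjTranspose_apply, hp2, hq2, mul_assoc, mul_sub,
      sub_mul, hp1, hq1, hp3]
  · ext i j; fin_cases i <;> fin_cases j <;>
    simp [Matrix.mul_apply, Matrix.conjTranspose_apply, hp2, hq2, mul_assoc, mul_sub,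
      sub_mul, hp1, hq1, hq3]

lemma isStarProjection_rotatedPair : IsStarProjection (rotatedPair p q) := by
  have h := isStarProjection_diag hp hq.one_sub
  have hq1 : q * q = q := hq.isIdempotentElem
  have e : rotatedPair p q = !![q, 1 - q; 1 - q, q] * !![p, 0; 0, 1 - q] *
      !![q, 1 - q; 1 - q, q] := by
    ext i j; fin_cases i <;> fin_cases j <;>
    simp [rotatedPair, Matrix.mul_apply, mul_assoc, mul_sub, sub_mul, hq1]
  have hU : (!![q, 1 - q; 1 - q, q] : Matrix (Fin 2) (Fin 2) A) * !![q, 1 - q; 1 - q, q] = 1 := by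
    ext i j; fin_cases i <;> fin_cases j <;>
    simp [Matrix.mul_apply, mul_sub, sub_mul, hq1]
  have hU2 : star (!![q, 1 - q; 1 - q, q] : Matrix (Fin 2) (Fin 2) A) =
      !![q, 1 - q; 1 - q, q] := by
    have hq2 : star q = q := hq.isSelfAdjoint
    ext i j; fin_cases i <;> fin_cases j <;> simp [Matrix.star_apply, hq2]
  rw [e]
  constructor
  · change _ * _ = _
    rw [← mul_assoc, ← mul_assoc, mul_assoc _ !![q, 1 - q; 1 - q, q] !![q, 1 - q; 1 - q, q], hU,
      mul_one, mul_assoc !![q, 1 - q; 1 - q, q], h.1]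
  · change star _ = _
    rw [star_mul, star_mul, hU2, h.2, mul_assoc]

lemma K0Unital.mk_rotatedPair (h : IsStarProjection (rotatedPair p q)) :
    K0Unital.mk (rotatedPair p q) h =
      K0Unital.ofProj p hp + K0Unital.ofProj (1 - q) hq.one_sub := by
  rw [← K0Unital.mk_diag]
  exact (mvn_rotatedPair hp hq).mk_eq _ _

end rotation

variable {B : Type u} [NonUnitalCStarAlgebra B]

/-- The conjugate of `diag (r, 1 - δ r)` that has scalar second component lifts to the unitization
of `B`. -/
lemma exists_lift_rotatedPair {r : Double B} (hr : IsStarProjection r) :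
    ∃ P : Matrix (Fin 2) (Fin 2) (Unitization ℂ B), IsStarProjection P ∧
      P.map (unitizationToDouble B) = rotatedPair r (doubleDiag B r) ∧
      P.map (scalarPart B) = !![1, 0; 0, 0] := by
  have hq := hr.map (doubleDiag B)
  have hX := isStarProjection_rotatedPair hr hq
  have hE : IsStarProjection (!![1, 0; 0, 0] : Matrix (Fin 2) (Fin 2) ℂ) :=
    isStarProjection_diag (IsStarProjection.one _) (IsStarProjection.zero _)
  have hy : r.1.2 * r.1.2 = r.1.2 := congrArg (fun d : Double B => d.1.2) hr.isIdempotentElem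
  obtain ⟨P, h1, h2⟩ := exists_matrix_unitizationToDouble_eq (rotatedPair r (doubleDiag B r))
    (!![1, 0; 0, 0] : Matrix (Fin 2) (Fin 2) ℂ) (fun i j => by
      fin_cases i <;> fin_cases j
      · change r.1.2 * r.1.2 * r.1.2 + (1 - r.1.2) = algebraMap ℂ 𝓜(ℂ, B) 1
        rw [hy, hy, map_one]; abel
      · change r.1.2 * r.1.2 * (1 - r.1.2) = algebraMap ℂ 𝓜(ℂ, B) 0
        rw [hy, mul_sub, hy, map_zero, mul_one, sub_self]
      · change (1 - r.1.2) * r.1.2 * r.1.2 = algebraMap ℂ 𝓜(ℂ, B) 0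
        rw [mul_assoc, hy, sub_mul, hy, map_zero, one_mul, sub_self]
      · change (1 - r.1.2) * r.1.2 * (1 - r.1.2) = algebraMap ℂ 𝓜(ℂ, B) 0
        rw [sub_mul, hy, map_zero, one_mul, sub_self, zero_mul])
  refine ⟨P, ⟨matrix_unitization_ext ?_ ?_, matrix_unitization_ext ?_ ?_⟩, h1, h2⟩
  · rw [Matrix.map_mul, h1]; exact hX.1
  · rw [Matrix.map_mul, h2]; exact hE.1
  · rw [Matrix.star_eq_conjTranspose, ← conjTranspose_map', h1]; exact hX.2
  · rw [Matrix.star_eq_conjTranspose, ← conjTranspose_map', h2]; exact hE.2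

lemma toDouble_ofMatrix_of_lift {r : Double B} (hr : IsStarProjection r)
    {P : Matrix (Fin 2) (Fin 2) (Unitization ℂ B)} (hP : IsStarProjection P)
    (h : P.map (unitizationToDouble B) = rotatedPair r (doubleDiag B r)) :
    K0.toDouble B (K0.ofMatrix P hP) =
      K0Unital.ofProj r hr - K0Unital.ofProj (doubleDiag B r) (hr.map (doubleDiag B)) := by
  have hq := hr.map (doubleDiag B)
  rw [K0.toDouble_ofMatrix]
  have e : (P.map (unitizationToDouble B)).map (doubleDiag B) =
      rotatedPair (doubleDiag B r) (doubleDiag B r) := by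
    rw [h]; ext1 i j; fin_cases i <;> fin_cases j <;> rfl
  simp only [e]
  simp only [h]
  rw [K0Unital.mk_rotatedPair hr hq, K0Unital.mk_rotatedPair hq hq]
  abel

/-! #### Evaluation of multipliers of `C([0,1], B)` -/

section evaluation

variable {t : I} {m m' : 𝓜(ℂ, C(I, B))} {n n' : 𝓜(ℂ, B)}

lemma _root_.EvalAt.add (h : EvalAt t m n) (h' : EvalAt t m' n') :
    EvalAt t (m + m') (n + n') := fun f => by
  simp [(h f).1, (h f).2, (h' f).1, (h' f).2]

lemma _root_.EvalAt.sub (h : EvalAt t m n) (h' : EvalAt t m' n') :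
    EvalAt t (m - m') (n - n') := fun f => by
  simp [(h f).1, (h f).2, (h' f).1, (h' f).2]

lemma _root_.EvalAt.mul (h : EvalAt t m n) (h' : EvalAt t m' n') :
    EvalAt t (m * m') (n * n') := fun f => by
  simp [(h _).1, (h f).2, (h' f).1, (h' _).2]

lemma _root_.EvalAt.algebraMap (c : ℂ) :
    EvalAt (B := B) t (algebraMap ℂ _ c) (algebraMap ℂ _ c) := fun f => by
  simp [Algebra.algebraMap_eq_smul_one]

lemma _root_.EvalAt.one : EvalAt (B := B) t 1 1 := fun f => by simp

lemma _root_.EvalAt.coeHom (f : C(I, B)) :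
    EvalAt t (DoubleCentralizer.coeHom (𝕜 := ℂ) f) (DoubleCentralizer.coeHom (𝕜 := ℂ) (f t)) :=
  fun _ => ⟨rfl, rfl⟩

lemma _root_.EvalAt.unique (h : EvalAt t m n) (h' : EvalAt t m n') : n = n' := by
  refine DoubleCentralizer.ext ℂ B _ _ (Prod.ext ?_ ?_)
  · ext b
    exact (h (ContinuousMap.const I b)).1.symm.trans (h' (ContinuousMap.const I b)).1
  · ext b
    exact (h (ContinuousMap.const I b)).2.symm.trans (h' (ContinuousMap.const I b)).2

/-- The element `d` of `D(B)` is the value at `t` of the element `D` of `D(C([0,1], B))`. -/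
def DoubleEvalAt (t : I) (D : Double C(I, B)) (d : Double B) : Prop :=
  EvalAt t D.1.1 d.1.1 ∧ EvalAt t D.1.2 d.1.2

variable {D D' : Double C(I, B)} {d d' : Double B}

lemma DoubleEvalAt.add (h : DoubleEvalAt t D d) (h' : DoubleEvalAt t D' d') :
    DoubleEvalAt t (D + D') (d + d') := ⟨h.1.add h'.1, h.2.add h'.2⟩

lemma DoubleEvalAt.sub (h : DoubleEvalAt t D d) (h' : DoubleEvalAt t D' d') :
    DoubleEvalAt t (D - D') (d - d') := ⟨h.1.sub h'.1, h.2.sub h'.2⟩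

lemma DoubleEvalAt.mul (h : DoubleEvalAt t D d) (h' : DoubleEvalAt t D' d') :
    DoubleEvalAt t (D * D') (d * d') := ⟨h.1.mul h'.1, h.2.mul h'.2⟩

lemma DoubleEvalAt.one : DoubleEvalAt (B := B) t 1 1 := ⟨EvalAt.one, EvalAt.one⟩

lemma DoubleEvalAt.unique (h : DoubleEvalAt t D d) (h' : DoubleEvalAt t D d') : d = d' :=
  Subtype.ext (Prod.ext (h.1.unique h'.1) (h.2.unique h'.2))

variable (B) in
/-- Evaluation at `t`, as a homomorphism between unitizations. -/
noncomputable def unitizationEval (t : I) : Unitization ℂ C(I, B) →⋆ₐ[ℂ] Unitization ℂ B :=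
  Unitization.starMap
    { toFun := fun f : C(I, B) => f t
      map_smul' := fun _ _ => rfl
      map_zero' := rfl
      map_add' := fun _ _ => rfl
      map_mul' := fun _ _ => rfl
      map_star' := fun _ => rfl }

lemma unitizationEval_fst (x : Unitization ℂ C(I, B)) : (unitizationEval B t x).fst = x.fst := by
  change (algebraMap ℂ (Unitization ℂ B) x.fst + Unitization.inr (x.snd t)).fst = _
  rw [Unitization.fst_add, Unitization.fst_inr, add_zero]
  rfl

lemma unitizationEval_snd (x : Unitization ℂ C(I, B)) :
    (unitizationEval B t x).snd = x.snd t := by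
  change (algebraMap ℂ (Unitization ℂ B) x.fst + Unitization.inr (x.snd t)).snd = _
  rw [Unitization.snd_add, Unitization.snd_inr]
  exact zero_add _

lemma continuous_unitizationEval (x : Unitization ℂ C(I, B)) :
    Continuous fun t => unitizationEval B t x := by
  change Continuous fun t => (algebraMap ℂ (Unitization ℂ B) x.fst + Unitization.inr (x.snd t))
  exact continuous_const.add
    ((Unitization.isometry_inr (𝕜 := ℂ)).continuous.comp x.snd.continuous)

lemma DoubleEvalAt.unitizationToDouble (x : Unitization ℂ C(I, B)) :
    DoubleEvalAt t (unitizationToDouble C(I, B) x)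
      (KTheory.unitizationToDouble B (unitizationEval B t x)) := by
  constructor
  · rw [unitizationToDouble_fst, unitizationToDouble_fst, unitizationEval_fst, unitizationEval_snd]
    exact (EvalAt.algebraMap _).add (EvalAt.coeHom _)
  · rw [unitizationToDouble_snd, unitizationToDouble_snd, unitizationEval_fst]
    exact EvalAt.algebraMap _

lemma DoubleEvalAt.rotatedPair {d' : Double B} (h : DoubleEvalAt t D d)
    (h' : DoubleEvalAt t D' d') (i j : Fin 2) :
    DoubleEvalAt t (rotatedPair D D' i j) (KTheory.rotatedPair d d' i j) := by
  have h1 := DoubleEvalAt.one.sub h'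
  fin_cases i <;> fin_cases j
  · exact ((h'.mul h).mul h').add h1
  · exact (h'.mul h).mul h1
  · exact (h1.mul h).mul h'
  · exact (h1.mul h).mul h1

/-- The values at two points of a projection in `D(C([0,1], B))` have the same class
in `K₀(D(B))`, relative to the classes of their second components. No norm continuity of the values
is available, but the conjugate of the projection which is defined over the unitization of
`C([0,1], B)` has norm continuous values. -/
lemma DoubleEvalAt.ofProj_sub_eq {R : Double C(I, B)} (hR : IsStarProjection R) {s t : I}
    {a b : Double B} (ha : IsStarProjection a) (hb : IsStarProjection b)
    (hs : DoubleEvalAt s R a) (ht : DoubleEvalAt t R b) :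
    K0Unital.ofProj a ha - K0Unital.ofProj (doubleDiag B a) (ha.map (doubleDiag B)) =
      K0Unital.ofProj b hb - K0Unital.ofProj (doubleDiag B b) (hb.map (doubleDiag B)) := by
  obtain ⟨P, hP, h1, h2⟩ := exists_lift_rotatedPair hR
  have key : ∀ {t : I} {a : Double B} (_ : DoubleEvalAt t R a),
      (P.map (unitizationEval B t)).map (KTheory.unitizationToDouble B) =
        KTheory.rotatedPair a (doubleDiag B a) := by
    intro t a hta
    ext1 i j
    refine (DoubleEvalAt.unitizationToDouble (t := t) (P i j)).unique ?_
    have e : KTheory.unitizationToDouble C(I, B) (P i j) =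
      KTheory.rotatedPair R (doubleDiag _ R) i j := congrFun (congrFun h1 i) j
    rw [e]
    have h3 : DoubleEvalAt t (doubleDiag C(I, B) R) (doubleDiag B a) := ⟨hta.2, hta.2⟩
    exact hta.rotatedPair h3 i j
  rw [← toDouble_ofMatrix_of_lift ha (isStarProjection_map _ hP) (key hs),
    ← toDouble_ofMatrix_of_lift hb (isStarProjection_map _ hP) (key ht)]
  congr 1
  refine Subtype.ext ?_
  refine congrArg₂ (· - ·) ?_ ?_
  · exact K0Unital.mk_eq_of_path (fun t => P.map (unitizationEval B t))
      (fun t => isStarProjection_map _ hP) (fun i j => continuous_unitizationEval _) s t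
  · rfl

end evaluation

/-- The element `(φ(1), ψ(1))` of `D(B)`. -/
noncomputable def _root_.CuntzPair.double (c : CuntzPair ℂ B) : Double B :=
  ⟨(c.φ 1, c.ψ 1), c.sub_mem 1⟩

lemma _root_.CuntzPair.isStarProjection_double (c : CuntzPair ℂ B) :
    IsStarProjection c.double :=
  CuntzPair.isStarProjection_pair c.φ c.ψ (c.sub_mem 1)

lemma exists_toDouble_eq (c : CuntzPair ℂ B) : ∃ x : K0 B, K0.toDouble B x =
    doubleClass c.φ c.ψ (c.sub_mem 1) -
      doubleClass c.ψ c.ψ (by rw [sub_self]; exact InAlg.zero) := by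
  obtain ⟨P, hP, h1, -⟩ := exists_lift_rotatedPair c.isStarProjection_double
  exact ⟨K0.ofMatrix P hP, toDouble_ofMatrix_of_lift c.isStarProjection_double hP h1⟩

variable (B) in
/-- The canonical map `KK_h(ℂ, B) → K₀(B)`. -/
noncomputable def kappa : KKh ℂ B → K0 B :=
  Quot.lift (fun c => (exists_toDouble_eq c).choose) (by
    rintro c d ⟨H, hH⟩
    refine K0.toDouble_injective ?_
    rw [(exists_toDouble_eq c).choose_spec, (exists_toDouble_eq d).choose_spec]
    exact DoubleEvalAt.ofProj_sub_eq H.isStarProjection_double c.isStarProjection_double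
      d.isStarProjection_double ⟨(hH 1).1, (hH 1).2.1⟩ ⟨(hH 1).2.2.1, (hH 1).2.2.2⟩)

lemma isCanonical_kappa : IsCanonical (kappa B) :=
  fun c => (exists_toDouble_eq c).choose_spec

end KTheory

/-! ### Homotopies of Cuntz pairs from strictly continuous paths of projections -/

section multiplierAux

variable {B : Type u} [NonUnitalCStarAlgebra B]

lemma DoubleCentralizer.eq_of_fst_eq {m n : 𝓜(ℂ, B)} (h : ∀ b, m.fst b = n.fst b) : m = n := by
  rw [← sub_eq_zero, ← norm_eq_zero, ← DoubleCentralizer.norm_fst, norm_eq_zero]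
  ext b
  simp [h b]

lemma DoubleCentralizer.star_fst_mul (m : 𝓜(ℂ, B)) (x y : B) :
    star (m.fst x) * y = star x * (star m).fst y := by
  rw [DoubleCentralizer.star_fst]
  have h := congrArg star (m.central (star y) x)
  simpa using h.symm

lemma DoubleCentralizer.coeHom_fst (m : 𝓜(ℂ, B)) (b : B) :
    DoubleCentralizer.coeHom (𝕜 := ℂ) (m.fst b) = m * DoubleCentralizer.coeHom (𝕜 := ℂ) b := by
  refine DoubleCentralizer.eq_of_fst_eq fun x => ?_
  change m.fst b * x = m.fst (b * x)
  have key (z : B) : z * (m.fst b * x - m.fst (b * x)) = 0 := by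
    rw [mul_sub, ← m.central, ← mul_assoc, ← mul_assoc, ← m.central, sub_self]
  exact sub_eq_zero.1 ((CStarRing.star_mul_self_eq_zero_iff _).1 (key _))

/-- A multiplier from a pair of mutually adjoint operators. -/
noncomputable def DoubleCentralizer.ofAdjoint (L L' : B →L[ℂ] B)
    (h : ∀ x y, star (L x) * y = star x * L' y) : 𝓜(ℂ, B) where
  fst := L
  snd := ((starL ℂ : B ≃L⋆[ℂ] B) : B →L⋆[ℂ] B).comp
    (L'.comp ((starL ℂ : B ≃L⋆[ℂ] B) : B →L⋆[ℂ] B))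
  central x y := by
    change star (L' (star x)) * y = x * L y
    have := congrArg star (h y (star x))
    simpa using this.symm

lemma DoubleCentralizer.star_ofAdjoint_fst (L L' : B →L[ℂ] B)
    (h : ∀ x y, star (L x) * y = star x * L' y) (b : B) :
    (star (DoubleCentralizer.ofAdjoint L L' h)).fst b = L' b := by
  rw [DoubleCentralizer.star_fst]
  change star (star (L' (star (star b)))) = L' b
  simp

lemma essCodim_congr {p q p' q' : 𝓜(ℂ, B)} (hp : p = p') (hq : q = q') (h : IsEssPair p q)
    (h' : IsEssPair p' q') : essCodim p q h = essCodim p' q' h' := by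
  subst hp hq; rfl

lemma DoubleCentralizer.norm_fst_apply_le_of_isStarProjection {p : 𝓜(ℂ, B)}
    (hp : IsStarProjection p) (b : B) : ‖p.fst b‖ ≤ ‖b‖ := by
  refine (p.fst.le_opNorm b).trans ?_
  rw [DoubleCentralizer.norm_fst]
  exact mul_le_of_le_one_left (norm_nonneg _) hp.norm_le

section strictPath

variable (P : I → 𝓜(ℂ, B)) (hP : ∀ t, IsStarProjection (P t))
  (hc : ∀ b, Continuous fun t => (P t).fst b)

include hP hc in
lemma continuous_strictPath_apply (f : C(I, B)) : Continuous fun t => (P t).fst (f t) := by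
  rw [continuous_iff_continuousAt]
  intro s
  rw [ContinuousAt, tendsto_iff_norm_sub_tendsto_zero]
  have h1 : Filter.Tendsto (fun t => ‖f t - f s‖ + ‖(P t).fst (f s) - (P s).fst (f s)‖)
      (nhds s) (nhds 0) := by
    have : Continuous fun t => ‖f t - f s‖ + ‖(P t).fst (f s) - (P s).fst (f s)‖ :=
      (f.continuous.sub continuous_const).norm.add ((hc _).sub continuous_const).norm
    simpa using this.tendsto s
  refine squeeze_zero (fun _ => norm_nonneg _) (fun t => ?_) h1
  have e : (P t).fst (f t) - (P s).fst (f s) =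
      (P t).fst (f t - f s) + ((P t).fst (f s) - (P s).fst (f s)) := by
    rw [map_sub]; abel
  rw [e]
  exact (norm_add_le _ _).trans (add_le_add_left
    (DoubleCentralizer.norm_fst_apply_le_of_isStarProjection (hP t) _) _)

/-- Pointwise application of a strictly continuous path of projections to `C([0,1], B)`. -/
noncomputable def strictPathCLM : C(I, B) →L[ℂ] C(I, B) :=
  LinearMap.mkContinuous
    { toFun := fun f => ⟨fun t => (P t).fst (f t), continuous_strictPath_apply P hP hc f⟩
      map_add' := fun f g => by ext t; simp
      map_smul' := fun c f => by ext t; simp } 1 (fun f => by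
        rw [one_mul, ContinuousMap.norm_le _ (norm_nonneg _)]
        exact fun t => (DoubleCentralizer.norm_fst_apply_le_of_isStarProjection (hP t) _).trans
          (f.norm_coe_le_norm t))

/-- The projection in `M(C([0,1], B))` given by a strictly continuous path of projections. -/
noncomputable def strictPath : 𝓜(ℂ, C(I, B)) :=
  DoubleCentralizer.ofAdjoint (strictPathCLM P hP hc) (strictPathCLM P hP hc) (fun f g => by
    ext t
    change star ((P t).fst (f t)) * g t = star (f t) * (P t).fst (g t)
    rw [DoubleCentralizer.star_fst_mul, (hP t).isSelfAdjoint.star_eq])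

lemma isStarProjection_strictPath : IsStarProjection (strictPath P hP hc) where
  isIdempotentElem := by
    refine DoubleCentralizer.eq_of_fst_eq fun f => ?_
    ext t
    change (P t * P t).fst (f t) = (P t).fst (f t)
    rw [(hP t).isIdempotentElem]
  isSelfAdjoint := DoubleCentralizer.eq_of_fst_eq fun f =>
    DoubleCentralizer.star_ofAdjoint_fst _ _ _ f

lemma evalAt_strictPath (t : I) : EvalAt t (strictPath P hP hc) (P t) := fun f => by
  refine ⟨rfl, ?_⟩
  change star ((P t).fst (star (f t))) = _
  rw [← DoubleCentralizer.star_snd, (hP t).isSelfAdjoint.star_eq]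

end strictPath

lemma EvalAt.smul {t : I} {m : 𝓜(ℂ, C(I, B))} {n : 𝓜(ℂ, B)} (c : ℂ) (h : EvalAt t m n) :
    EvalAt t (c • m) (c • n) := fun f => by
  simp [(h f).1, (h f).2]

/-- A pair of strictly continuous paths of projections with norm continuous difference in `B` is
a homotopy of Cuntz pairs. -/
lemma essCodim_eq_of_path {P Q : I → 𝓜(ℂ, B)} (hP : ∀ t, IsStarProjection (P t))
    (hQ : ∀ t, IsStarProjection (Q t)) (hPc : ∀ b, Continuous fun t => (P t).fst b)
    (hQc : ∀ b, Continuous fun t => (Q t).fst b) (D : C(I, B))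
    (hD : ∀ t, DoubleCentralizer.coeHom (𝕜 := ℂ) (D t) = P t - Q t)
    (h₀ : IsEssPair (P 0) (Q 0)) (h₁ : IsEssPair (P 1) (Q 1)) :
    essCodim (P 0) (Q 0) h₀ = essCodim (P 1) (Q 1) h₁ := by
  have hpair : IsEssPair (strictPath P hP hPc) (strictPath Q hQ hQc) :=
    { left := isStarProjection_strictPath P hP hPc
      right := isStarProjection_strictPath Q hQ hQc
      sub_mem := by
        refine ⟨D, DoubleCentralizer.eq_of_fst_eq fun f => ?_⟩
        ext t
        exact congrArg (fun m : 𝓜(ℂ, B) => m.fst (f t)) (hD t) }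
  refine Quot.sound ⟨⟨projRep _ hpair.left, projRep _ hpair.right, fun z => ?_⟩, fun a =>
    ⟨(evalAt_strictPath P hP hPc 0).smul a, (evalAt_strictPath Q hQ hQc 0).smul a,
      (evalAt_strictPath P hP hPc 1).smul a, (evalAt_strictPath Q hQ hQc 1).smul a⟩⟩
  change InAlg (z • _ - z • _)
  rw [← smul_sub]
  exact hpair.sub_mem.smul z

lemma IsStarProjection.conj_of_isometry {A : Type*} [Ring A] [StarRing A] {v p : A}
    (hv : star v * v = 1) (hp : IsStarProjection p) : IsStarProjection (v * p * star v) where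
  isIdempotentElem := by
    have hpp : p * p = p := hp.isIdempotentElem
    change v * p * star v * (v * p * star v) = v * p * star v
    calc v * p * star v * (v * p * star v) = v * p * (star v * v) * p * star v := by
          simp only [mul_assoc]
      _ = v * p * star v := by rw [hv, mul_one, mul_assoc v p p, hpp]
  isSelfAdjoint := by
    change star _ = _
    rw [star_mul, star_mul, star_star, hp.isSelfAdjoint.star_eq, mul_assoc]

section rotateConj

variable {A : Type*} [Ring A] [StarRing A] [Algebra ℂ A] [StarModule ℂ A]

/-- The conjugate of `p` by the unitary `cos θ + i sin θ s`, when `s` is a self-adjoint unitary. -/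
noncomputable def rotateConj (s p : A) (θ : ℝ) : A :=
  ((Real.cos θ : ℂ) • 1 + (Complex.I * Real.sin θ) • s) * p *
    ((Real.cos θ : ℂ) • 1 - (Complex.I * Real.sin θ) • s)

omit [StarRing A] [StarModule ℂ A] in
lemma rotateConj_eq (s p : A) (θ : ℝ) : rotateConj s p θ =
    ((Real.cos θ : ℂ) * Real.cos θ) • p + ((Real.sin θ : ℂ) * Real.sin θ) • (s * p * s) +
      (Complex.I * Real.sin θ * Real.cos θ) • (s * p - p * s) := by
  simp only [rotateConj, add_mul, mul_sub, smul_mul_assoc, one_mul, mul_smul_comm, mul_one]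
  match_scalars <;> ring_nf
  rw [Complex.I_sq]; ring

lemma isStarProjection_rotateConj {s p : A} (hs : star s = s) (hss : s * s = 1)
    (hp : IsStarProjection p) (θ : ℝ) : IsStarProjection (rotateConj s p θ) := by
  have h1 : ((Real.cos θ : ℂ) • 1 - (Complex.I * Real.sin θ) • s) *
      ((Real.cos θ : ℂ) • 1 + (Complex.I * Real.sin θ) • s) = 1 := by
    have hcs : (Real.cos θ : ℂ) * Real.cos θ + Real.sin θ * Real.sin θ = 1 := by
      exact_mod_cast (by nlinarith [Real.sin_sq_add_cos_sq θ] :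
        Real.cos θ * Real.cos θ + Real.sin θ * Real.sin θ = 1)
    simp only [sub_mul, mul_add, smul_mul_assoc, one_mul, mul_smul_comm, mul_one, hss]
    match_scalars
    · push_cast at hcs ⊢
      linear_combination hcs - Complex.sin θ * Complex.sin θ * Complex.I_mul_I
    · ring
  have h2 : star ((Real.cos θ : ℂ) • (1 : A) + (Complex.I * Real.sin θ) • s) =
      ((Real.cos θ : ℂ) • 1 - (Complex.I * Real.sin θ) • s) := by
    have h4 (x : ℝ) : star (x : ℂ) = x := Complex.conj_ofReal x
    have h5 : star Complex.I = -Complex.I := Complex.conj_I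
    rw [star_add, star_smul, star_smul, hs, star_one, sub_eq_add_neg, ← neg_smul, star_mul, h4,
      h4, h5, mul_neg, mul_comm]
  rw [← h2] at h1
  rw [rotateConj, ← h2]
  exact hp.conj_of_isometry h1

end rotateConj

/-- Conjugation by a pair of self-adjoint unitaries does not change the class of a Cuntz pair,
since the path `cos θ + i sin θ s` connects the identity with a multiple of `s`. The two unitaries
need only have the same commutators with the projections modulo `B`. -/
lemma essCodim_conj_eq {s s' p q : 𝓜(ℂ, B)} (hs : star s = s) (hss : s * s = 1)
    (hs' : star s' = s') (hss' : s' * s' = 1) (h : IsEssPair p q)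
    (h1 : InAlg ((s * p - p * s) - (s' * q - q * s')))
    (h' : IsEssPair (s * p * s) (s' * q * s')) :
    essCodim p q h = essCodim (s * p * s) (s' * q * s') h' := by
  obtain ⟨d0, e0⟩ := h.sub_mem
  obtain ⟨d1, e1⟩ := h1
  obtain ⟨d3, e3⟩ := h'.sub_mem
  set P : I → 𝓜(ℂ, B) := fun t => rotateConj s p (Real.pi / 2 * t) with hP
  set Q : I → 𝓜(ℂ, B) := fun t => rotateConj s' q (Real.pi / 2 * t) with hQ
  have hP0 : P 0 = p := by simp [hP, rotateConj_eq]
  have hQ0 : Q 0 = q := by simp [hQ, rotateConj_eq]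
  have hP1 : P 1 = s * p * s := by simp [hP, rotateConj_eq]
  have hQ1 : Q 1 = s' * q * s' := by simp [hQ, rotateConj_eq]
  let D : C(I, B) :=
    { toFun := fun t => ((Real.cos (Real.pi / 2 * t) : ℂ) * Real.cos (Real.pi / 2 * t)) • d0 +
        ((Real.sin (Real.pi / 2 * t) : ℂ) * Real.sin (Real.pi / 2 * t)) • d3 +
        (Complex.I * Real.sin (Real.pi / 2 * t) * Real.cos (Real.pi / 2 * t)) • d1
      continuous_toFun := by fun_prop }
  rw [← essCodim_congr hP0 hQ0 (by rwa [hP0, hQ0]) h,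
    ← essCodim_congr hP1 hQ1 (by rwa [hP1, hQ1]) h']
  refine essCodim_eq_of_path (P := P) (Q := Q)
    (fun t => isStarProjection_rotateConj hs hss h.left _)
    (fun t => isStarProjection_rotateConj hs' hss' h.right _) (fun b => ?_) (fun b => ?_) D
    (fun t => ?_) _ _
  · simp only [hP, rotateConj_eq, DoubleCentralizer.add_fst, DoubleCentralizer.smul_fst,
      add_apply, smul_apply]
    fun_prop
  · simp only [hQ, rotateConj_eq, DoubleCentralizer.add_fst, DoubleCentralizer.smul_fst,
      add_apply, smul_apply]
    fun_prop
  · simp only [D, hP, hQ, rotateConj_eq, ContinuousMap.coe_mk, map_add, map_smul, e0, e1, e3,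
      smul_sub]
    abel

end multiplierAux

/-! ### Multipliers of a stable algebra -/

namespace Stabilization

variable {B₀ B : Type u} [NonUnitalCStarAlgebra B₀] [NonUnitalCStarAlgebra B]
  (S : Stabilization B₀ B)

/-- The map from finitely supported matrices over `B₀` to `B₀ ⊗ 𝒦`. -/
noncomputable def ofFinsupp : (ℕ × ℕ →₀ B₀) →ₗ[ℂ] B :=
  Finsupp.lsum ℂ fun ij => S.unit ij.1 ij.2

lemma ofFinsupp_single (ij : ℕ × ℕ) (b : B₀) :
    S.ofFinsupp (Finsupp.single ij b) = S.unit ij.1 ij.2 b := by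
  simp [ofFinsupp]

lemma denseRange_ofFinsupp : DenseRange S.ofFinsupp := by
  refine S.dense.mono ?_
  have h : (⨆ i, ⨆ j, LinearMap.range (S.unit i j) : Submodule ℂ B) ≤
      LinearMap.range S.ofFinsupp := by
    refine iSup_le fun i => iSup_le fun j => ?_
    rintro _ ⟨b, rfl⟩
    exact ⟨Finsupp.single (i, j) b, S.ofFinsupp_single (i, j) b⟩
  exact h

variable (B₀) in
/-- The action of a partial bijection of `ℕ` on the row indices of finitely supported matrices. -/
noncomputable def rowMap (f : ℕ ≃. ℕ) : (ℕ × ℕ →₀ B₀) →ₗ[ℂ] (ℕ × ℕ →₀ B₀) :=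
  Finsupp.lsum ℂ fun ij => (f ij.1).elim 0 fun k => Finsupp.lsingle (k, ij.2)

lemma rowMap_single_some {f : ℕ ≃. ℕ} {i j k : ℕ} (h : f i = some k) (b : B₀) :
    rowMap B₀ f (Finsupp.single (i, j) b) = Finsupp.single (k, j) b := by
  simp [rowMap, h]

lemma rowMap_single_none {f : ℕ ≃. ℕ} {i j : ℕ} (h : f i = none) (b : B₀) :
    rowMap B₀ f (Finsupp.single (i, j) b) = 0 := by
  simp [rowMap, h]

lemma rowMap_symm_rowMap (f : ℕ ≃. ℕ) (x : ℕ × ℕ →₀ B₀) :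
    rowMap B₀ f (rowMap B₀ f.symm (rowMap B₀ f x)) = rowMap B₀ f x := by
  induction x using Finsupp.induction_linear with
  | zero => simp
  | add x y hx hy => simp only [map_add, hx, hy]
  | single ij b =>
    obtain ⟨i, j⟩ := ij
    cases h : f i with
    | none => rw [rowMap_single_none h, map_zero, map_zero]
    | some k =>
      rw [rowMap_single_some h, rowMap_single_some ((f.eq_some_iff).2 h), rowMap_single_some h]

lemma star_rowMap_mul (f : ℕ ≃. ℕ) (x y : ℕ × ℕ →₀ B₀) :
    star (S.ofFinsupp (rowMap B₀ f x)) * S.ofFinsupp y =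
      star (S.ofFinsupp x) * S.ofFinsupp (rowMap B₀ f.symm y) := by
  induction x using Finsupp.induction_linear with
  | zero => simp
  | add x x' hx hx' => simp only [map_add, star_add, add_mul, hx, hx']
  | single ij b =>
  induction y using Finsupp.induction_linear with
  | zero => simp
  | add y y' hy hy' => simp only [map_add, mul_add, hy, hy']
  | single kl c =>
    obtain ⟨i, j⟩ := ij
    obtain ⟨k, l⟩ := kl
    cases h : f i with
    | none =>
      cases h' : f.symm k with
      | none => simp [rowMap_single_none h, rowMap_single_none h']
      | some i' =>
        have hi : i ≠ i' := by
          rintro rfl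
          rw [(f.eq_some_iff).1 h'] at h
          simp at h
        simp [rowMap_single_none h, rowMap_single_some h', ofFinsupp_single, S.star_unit,
          S.unit_mul_unit, hi]
    | some k' =>
      have h2 := (f.eq_some_iff).2 h
      cases h' : f.symm k with
      | none =>
        have hk : k' ≠ k := by
          rintro rfl
          rw [h2] at h'
          simp at h'
        simp [rowMap_single_none h', rowMap_single_some h, ofFinsupp_single, S.star_unit,
          S.unit_mul_unit, hk]
      | some i' =>
        have hk : k' = k ↔ i = i' := by
          have h3 := (f.eq_some_iff).1 h'
          constructor
          · rintro rfl
            exact Option.some_injective _ (h2.symm.trans h')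
          · rintro rfl
            exact Option.some_injective _ (h.symm.trans h3)
        simp [rowMap_single_some h', rowMap_single_some h, ofFinsupp_single, S.star_unit,
          S.unit_mul_unit, hk]

/-- A partial bijection of the rows is contractive: with `E = f⋆ f` and `‖f x‖ = ‖E x‖`, one has
`‖f x‖² = ‖x⋆ E x‖ ≤ ‖x‖ ‖f x‖`. -/
lemma norm_ofFinsupp_rowMap_le (f : ℕ ≃. ℕ) (x : ℕ × ℕ →₀ B₀) :
    ‖S.ofFinsupp (rowMap B₀ f x)‖ ≤ ‖S.ofFinsupp x‖ := by
  set y := rowMap B₀ f x with hy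
  set z := rowMap B₀ f.symm y with hz
  have h1 : ‖S.ofFinsupp y‖ * ‖S.ofFinsupp y‖ ≤ ‖S.ofFinsupp x‖ * ‖S.ofFinsupp z‖ := by
    rw [← CStarRing.norm_star_mul_self]
    nth_rw 1 [hy]
    rw [star_rowMap_mul]
    exact (norm_mul_le _ _).trans_eq (by rw [norm_star])
  have h2 : ‖S.ofFinsupp z‖ * ‖S.ofFinsupp z‖ = ‖S.ofFinsupp y‖ * ‖S.ofFinsupp y‖ := by
    rw [← CStarRing.norm_star_mul_self, ← CStarRing.norm_star_mul_self]
    nth_rw 1 [hz]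
    rw [star_rowMap_mul, PEquiv.symm_symm, hz, hy, rowMap_symm_rowMap]
  have h3 : ‖S.ofFinsupp z‖ = ‖S.ofFinsupp y‖ :=
    (mul_self_inj_of_nonneg (norm_nonneg _) (norm_nonneg _)).1 h2
  rw [h3] at h1
  rcases (norm_nonneg (S.ofFinsupp y)).eq_or_lt with h | h
  · rw [← h]; exact norm_nonneg _
  · exact le_of_mul_le_mul_right h1 h

/-- The action of a partial bijection of `ℕ` on the row indices of `B₀ ⊗ 𝒦`. -/
noncomputable def rowCLM (f : ℕ ≃. ℕ) : B →L[ℂ] B :=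
  (S.ofFinsupp ∘ₗ rowMap B₀ f).extendOfNorm S.ofFinsupp

lemma rowCLM_ofFinsupp (f : ℕ ≃. ℕ) (x : ℕ × ℕ →₀ B₀) :
    S.rowCLM f (S.ofFinsupp x) = S.ofFinsupp (rowMap B₀ f x) :=
  LinearMap.extendOfNorm_eq S.denseRange_ofFinsupp
    ⟨1, fun x => by rw [one_mul]; exact S.norm_ofFinsupp_rowMap_le f x⟩ x

/-- The partial isometry `1 ⊗ ∑ e (f i) i` of `M(B₀ ⊗ 𝒦)` given by a partial bijection `f`
of `ℕ`. -/
noncomputable def shift (f : ℕ ≃. ℕ) : 𝓜(ℂ, B) :=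
  DoubleCentralizer.ofAdjoint (S.rowCLM f) (S.rowCLM f.symm) (by
    have h (x : B) (y : ℕ × ℕ →₀ B₀) : star (S.rowCLM f x) * S.ofFinsupp y =
        star x * S.rowCLM f.symm (S.ofFinsupp y) := by
      refine S.denseRange_ofFinsupp.induction_on (p := fun x =>
        star (S.rowCLM f x) * S.ofFinsupp y = star x * S.rowCLM f.symm (S.ofFinsupp y)) x
        (isClosed_eq (by fun_prop) (by fun_prop)) fun x => ?_
      rw [rowCLM_ofFinsupp, rowCLM_ofFinsupp, star_rowMap_mul]
    intro x y
    exact S.denseRange_ofFinsupp.induction_on (p := fun y =>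
        star (S.rowCLM f x) * y = star x * S.rowCLM f.symm y) y
        (isClosed_eq (by fun_prop) (by fun_prop)) fun y => h x y)

lemma shift_unit_some {f : ℕ ≃. ℕ} {i k : ℕ} (h : f i = some k) (j : ℕ) (b : B₀) :
    (S.shift f).fst (S.unit i j b) = S.unit k j b := by
  change S.rowCLM f (S.unit i j b) = _
  rw [← S.ofFinsupp_single (i, j), rowCLM_ofFinsupp, rowMap_single_some h, ofFinsupp_single]

lemma shift_unit_none {f : ℕ ≃. ℕ} {i : ℕ} (h : f i = none) (j : ℕ) (b : B₀) :
    (S.shift f).fst (S.unit i j b) = 0 := by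
  change S.rowCLM f (S.unit i j b) = _
  rw [← S.ofFinsupp_single (i, j), rowCLM_ofFinsupp, rowMap_single_none h, map_zero]

lemma star_shift (f : ℕ ≃. ℕ) : star (S.shift f) = S.shift f.symm :=
  DoubleCentralizer.eq_of_fst_eq fun b =>
    DoubleCentralizer.star_ofAdjoint_fst _ _ _ b

lemma multiplier_ext {m n : 𝓜(ℂ, B)}
    (h : ∀ i j b, m.fst (S.unit i j b) = n.fst (S.unit i j b)) : m = n := by
  refine DoubleCentralizer.eq_of_fst_eq fun b => ?_
  refine S.denseRange_ofFinsupp.induction_on (p := fun b => m.fst b = n.fst b) b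
    (isClosed_eq (by fun_prop) (by fun_prop)) fun x => ?_
  induction x using Finsupp.induction_linear with
  | zero => simp
  | add x y hx hy => simp only [map_add, hx, hy]
  | single ij b => rw [ofFinsupp_single]; exact h _ _ _

lemma shift_mul_shift (f g : ℕ ≃. ℕ) : S.shift f * S.shift g = S.shift (g.trans f) := by
  refine S.multiplier_ext fun i j b => ?_
  change (S.shift f).fst ((S.shift g).fst (S.unit i j b)) = _
  cases h : g i with
  | none =>
    rw [S.shift_unit_none h, map_zero, S.shift_unit_none]
    simp [PEquiv.trans, h]
  | some k =>
    rw [S.shift_unit_some h]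
    cases h' : f k with
    | none =>
      rw [S.shift_unit_none h', S.shift_unit_none]
      simp [PEquiv.trans, h, h']
    | some l =>
      rw [S.shift_unit_some h', S.shift_unit_some]
      simp [PEquiv.trans, h, h']

lemma shift_refl : S.shift (PEquiv.refl ℕ) = 1 :=
  S.multiplier_ext fun _ j b => S.shift_unit_some rfl j b

/-- The injection of `ℕ` that fixes the numbers below `n` and is `i ↦ 2 i - n` from `n` on. It
interpolates between `i ↦ 2 i`, for `n = 0`, and the identity. -/
def spread (n : ℕ) : ℕ ≃. ℕ where
  toFun i := some (if i < n then i else 2 * i - n)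
  invFun j := if j < n then some j else if (j - n) % 2 = 0 then some (n + (j - n) / 2) else none
  inv i j := by
    rw [Option.some_inj]
    split_ifs <;> simp only [Option.some_inj, false_iff] <;> omega

/-- The injection `i ↦ 2 i + 1`. -/
def odds : ℕ ≃. ℕ where
  toFun i := some (2 * i + 1)
  invFun j := if j % 2 = 1 then some (j / 2) else none
  inv i j := by
    rw [Option.some_inj]
    split_ifs <;> simp only [Option.some_inj, false_iff] <;> omega

/-- The involution of `ℕ` that fixes the numbers up to `n` and exchanges `n + 2 k - 1` and `n + 2 k`
for `k ≥ 1`. -/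
def flip (n : ℕ) : ℕ ≃. ℕ where
  toFun i := some (if i ≤ n then i else if (i - n) % 2 = 0 then i - 1 else i + 1)
  invFun i := some (if i ≤ n then i else if (i - n) % 2 = 0 then i - 1 else i + 1)
  inv i j := by
    rw [Option.some_inj, Option.some_inj]
    split_ifs <;> omega

lemma spread_trans_flip (n : ℕ) : (spread n).trans (flip n) = spread (n + 1) := by
  refine PEquiv.ext fun i => ?_
  change some _ = some _
  rw [Option.some_inj]
  split_ifs <;> omega

lemma star_shift_mul_shift {f : ℕ ≃. ℕ} {g : ℕ → ℕ} (h : ∀ i, f i = some (g i)) :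
    star (S.shift f) * S.shift f = 1 := by
  refine S.multiplier_ext fun i j b => ?_
  rw [star_shift]
  change (S.shift f.symm).fst ((S.shift f).fst (S.unit i j b)) = S.unit i j b
  rw [S.shift_unit_some (h i), S.shift_unit_some (f.eq_some_iff.2 (h i))]

lemma symm_eq_none {f : ℕ ≃. ℕ} {j : ℕ} (h : ∀ i, f i ≠ some j) : f.symm j = none := by
  cases h' : f.symm j with
  | none => rfl
  | some i => exact absurd (f.eq_some_iff.1 h') (h i)

lemma spread_apply (n i : ℕ) : spread n i = some (if i < n then i else 2 * i - n) := rfl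

lemma odds_apply (i : ℕ) : odds i = some (2 * i + 1) := rfl

/-- The inner isomorphism `M₂(B₀ ⊗ 𝒦) → B₀ ⊗ 𝒦` that interleaves the two rows and columns. -/
noncomputable def innerIso : InnerIso B where
  v₁ := S.shift (spread 0)
  v₂ := S.shift odds
  isometry₁ := S.star_shift_mul_shift (spread_apply 0)
  isometry₂ := S.star_shift_mul_shift odds_apply
  range_add_range := by
    refine S.multiplier_ext fun i j b => ?_
    rw [star_shift, star_shift]
    change (S.shift (spread 0)).fst ((S.shift (spread 0).symm).fst (S.unit i j b)) +
      (S.shift odds).fst ((S.shift odds.symm).fst (S.unit i j b)) = S.unit i j b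
    rcases Nat.even_or_odd' i with ⟨k, rfl | rfl⟩
    · have h3 : spread 0 k = some (2 * k) := by simp [spread_apply]
      have h2 : odds.symm (2 * k) = none :=
        symm_eq_none fun i => by rw [odds_apply, ne_eq, Option.some_inj]; omega
      rw [S.shift_unit_some ((spread 0).eq_some_iff.2 h3), S.shift_unit_none h2,
        S.shift_unit_some h3, map_zero, add_zero]
    · have h1 : (spread 0).symm (2 * k + 1) = none :=
        symm_eq_none fun i => by
          rw [spread_apply, ne_eq, Option.some_inj, if_neg (Nat.not_lt_zero i)]; omega
      rw [S.shift_unit_none h1, S.shift_unit_some (odds.eq_some_iff.2 (odds_apply k)),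
        S.shift_unit_some (odds_apply k), map_zero, zero_add]

end Stabilization

/-! ### Absorption of degenerate Cuntz pairs -/

section contractive

variable {B : Type u} [NonUnitalCStarAlgebra B]

lemma DoubleCentralizer.continuous_fst : Continuous fun m : 𝓜(ℂ, B) => m.fst := by
  refine LipschitzWith.continuous (K := 1) (LipschitzWith.of_dist_le_mul fun m n => ?_)
  rw [dist_eq_norm, dist_eq_norm, ← DoubleCentralizer.sub_fst, DoubleCentralizer.norm_fst,
    NNReal.coe_one, one_mul]

lemma DoubleCentralizer.norm_fst_apply_of_isometry {m : 𝓜(ℂ, B)} (h : star m * m = 1) (b : B) :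
    ‖m.fst b‖ = ‖b‖ := by
  have h1 : ‖m.fst b‖ * ‖m.fst b‖ = ‖b‖ * ‖b‖ := by
    rw [← CStarRing.norm_star_mul_self, ← CStarRing.norm_star_mul_self,
      DoubleCentralizer.star_fst_mul]
    change ‖star b * (star m * m).fst b‖ = _
    rw [h]; rfl
  exact (mul_self_inj_of_nonneg (norm_nonneg _) (norm_nonneg _)).1 h1

lemma DoubleCentralizer.norm_star_fst_apply_le_of_isometry {m : 𝓜(ℂ, B)} (h : star m * m = 1)
    (b : B) : ‖(star m).fst b‖ ≤ ‖b‖ := by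
  have h1 : ‖star m‖ ≤ 1 := by
    rw [norm_star, ← DoubleCentralizer.norm_fst]
    exact ContinuousLinearMap.opNorm_le_bound _ zero_le_one fun x => by
      rw [one_mul, DoubleCentralizer.norm_fst_apply_of_isometry h]
  refine ((star m).fst.le_opNorm b).trans ?_
  rw [DoubleCentralizer.norm_fst]
  exact mul_le_of_le_one_left (norm_nonneg _) h1

lemma DoubleCentralizer.tendsto_fst_apply {ι : Type*} {l : Filter ι} {m : ι → 𝓜(ℂ, B)}
    (hm : ∀ᶠ s in l, ∀ b, ‖(m s).fst b‖ ≤ ‖b‖) {y : ι → B} {y₀ z : B}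
    (hy : Filter.Tendsto y l (nhds y₀))
    (hz : Filter.Tendsto (fun s => (m s).fst y₀) l (nhds z)) :
    Filter.Tendsto (fun s => (m s).fst (y s)) l (nhds z) := by
  have h1 : Filter.Tendsto (fun s => (m s).fst (y s - y₀)) l (nhds 0) :=
    squeeze_zero_norm' (hm.mono fun s hs => hs _) (by
      simpa using (hy.sub_const y₀).norm)
  refine (h1.add hz).congr' (Filter.Eventually.of_forall fun s => ?_) |>.trans (by rw [zero_add])
  simp

end contractive

/-- The half-line path `f` with limit `l` at infinity, as a path on `[0,1]`. -/
lemma continuous_ite_one {E : Type*} [TopologicalSpace E] {f : ℝ → E} (hf : Continuous f) {l : E}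
    (hl : Filter.Tendsto f Filter.atTop (nhds l)) :
    Continuous fun t : I => if t = 1 then l else f (t / (1 - t)) := by
  rw [continuous_iff_continuousAt]
  intro t
  by_cases ht : t = 1
  · subst ht
    rw [continuousAt_iff_punctured_nhds, if_pos rfl]
    have h1 : Filter.Tendsto (fun t : I => (t : ℝ) / (1 - t)) (nhdsWithin 1 {1}ᶜ)
        Filter.atTop := by
      have h2 : Filter.Tendsto (fun t : I => (1 - t : ℝ)) (nhdsWithin 1 {1}ᶜ)
          (nhdsWithin 0 (Set.Ioi 0)) := by
        refine tendsto_nhdsWithin_iff.2 ⟨?_, ?_⟩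
        · have : Continuous fun t : I => (1 - t : ℝ) := by fun_prop
          simpa using (this.tendsto 1).mono_left nhdsWithin_le_nhds
        · filter_upwards [self_mem_nhdsWithin] with t ht
          have h3 : (t : ℝ) < 1 := lt_of_le_of_ne t.2.2 fun h => ht (Subtype.ext h)
          simpa using h3
      have h4 : Filter.Tendsto (fun t : I => (t : ℝ)) (nhdsWithin 1 {1}ᶜ) (nhds 1) :=
        (continuous_subtype_val.tendsto (1 : I)).mono_left nhdsWithin_le_nhds
      have h5 := h4.pos_mul_atTop one_pos (tendsto_inv_nhdsGT_zero.comp h2)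
      simpa [div_eq_mul_inv] using h5
    refine (hl.comp h1).congr' ?_
    filter_upwards [self_mem_nhdsWithin] with t ht
    rw [if_neg (by simpa using ht)]
    rfl
  · have h1 : (1 - t : ℝ) ≠ 0 := fun h => ht (Subtype.ext (sub_eq_zero.1 h).symm)
    have h2 : ContinuousAt (fun t : I => f (t / (1 - t))) t :=
      hf.continuousAt.comp (ContinuousAt.div (by fun_prop) (by fun_prop) h1)
    refine h2.congr ?_
    filter_upwards [isOpen_ne.mem_nhds ht] with s hs
    rw [if_neg hs]

section diag

variable {B : Type u} [NonUnitalCStarAlgebra B] (Θ : InnerIso B)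

lemma InnerIso.isStarProjection_diag {p r : 𝓜(ℂ, B)} (hp : IsStarProjection p)
    (hr : IsStarProjection r) : IsStarProjection (Θ.diag p r) where
  isIdempotentElem := by
    change _ * _ = _
    rw [← Θ.diag_mul, hp.isIdempotentElem, hr.isIdempotentElem]
  isSelfAdjoint := by
    change star _ = _
    simp [InnerIso.diag, hp.isSelfAdjoint.star_eq, hr.isSelfAdjoint.star_eq, mul_assoc]

lemma InnerIso.diag_sub (x y x' y' : 𝓜(ℂ, B)) :
    Θ.diag x y - Θ.diag x' y' = Θ.diag (x - x') (y - y') := by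
  simp only [InnerIso.diag, mul_sub, sub_mul]
  abel

lemma InnerIso.inAlg_diag {x y : 𝓜(ℂ, B)} (hx : InAlg x) (hy : InAlg y) : InAlg (Θ.diag x y) :=
  ((hx.mul_left _).mul_right _).add ((hy.mul_left _).mul_right _)

lemma IsEssPair.refl {p : 𝓜(ℂ, B)} (hp : IsStarProjection p) : IsEssPair p p :=
  ⟨hp, hp, by rw [sub_self]; exact InAlg.zero⟩

lemma IsEssPair.diag {p q p' q' : 𝓜(ℂ, B)} (h : IsEssPair p q) (h' : IsEssPair p' q') :
    IsEssPair (Θ.diag p p') (Θ.diag q q') :=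
  ⟨Θ.isStarProjection_diag h.left h'.left, Θ.isStarProjection_diag h.right h'.right, by
    rw [Θ.diag_sub]; exact Θ.inAlg_diag h.sub_mem h'.sub_mem⟩

/-- A Cuntz pair absorbs a degenerate one, if there is a norm continuous path `G` of unitaries
starting at `1` such that the isometries `G s v₁` tend strictly to `1`. Then `G s v₂` has range
tending strictly to `0`, and conjugation by `G s` deforms `Θ (diag (p, r))` into `p`. -/
lemma essCodim_diag_of_path {G : ℝ → 𝓜(ℂ, B)} (hG : Continuous G) (hG0 : G 0 = 1)
    (hu : ∀ s, 0 ≤ s → star (G s) * G s = 1)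
    (h1 : ∀ b, Filter.Tendsto (fun s => (G s * Θ.v₁).fst b) Filter.atTop (nhds b))
    (h2 : ∀ b, Filter.Tendsto (fun s => (star (G s * Θ.v₁)).fst b) Filter.atTop (nhds b))
    {p q r : 𝓜(ℂ, B)} (hr : IsStarProjection r) (h : IsEssPair p q)
    (h' : IsEssPair (Θ.diag p r) (Θ.diag q r)) :
    essCodim (Θ.diag p r) (Θ.diag q r) h' = essCodim p q h := by
  set X : ℝ → 𝓜(ℂ, B) := fun s => G s * Θ.v₁ with hX
  set Y : ℝ → 𝓜(ℂ, B) := fun s => G s * Θ.v₂ with hY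
  have hXX (s) (hs : 0 ≤ s) : star (X s) * X s = 1 := by
    rw [hX, star_mul, mul_assoc, ← mul_assoc _ (G s), hu s hs, one_mul, Θ.isometry₁]
  have hYY (s) (hs : 0 ≤ s) : star (Y s) * Y s = 1 := by
    rw [hY, star_mul, mul_assoc, ← mul_assoc _ (G s), hu s hs, one_mul, Θ.isometry₂]
  have hXY (s) (hs : 0 ≤ s) : star (Y s) * X s = 0 := by
    rw [hX, hY, star_mul, mul_assoc, ← mul_assoc _ (G s), hu s hs, one_mul, Θ.orthogonal']
  have hX1 : ∀ᶠ s in Filter.atTop, ∀ b, ‖(X s).fst b‖ ≤ ‖b‖ := by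
    filter_upwards [Filter.eventually_ge_atTop 0] with s hs b
    exact (DoubleCentralizer.norm_fst_apply_of_isometry (hXX s hs) b).le
  have hY1 : ∀ᶠ s in Filter.atTop, ∀ b, ‖(Y s).fst b‖ ≤ ‖b‖ := by
    filter_upwards [Filter.eventually_ge_atTop 0] with s hs b
    exact (DoubleCentralizer.norm_fst_apply_of_isometry (hYY s hs) b).le
  have hY2 : ∀ᶠ s in Filter.atTop, ∀ b, ‖(star (Y s)).fst b‖ ≤ ‖b‖ := by
    filter_upwards [Filter.eventually_ge_atTop 0] with s hs b
    exact DoubleCentralizer.norm_star_fst_apply_le_of_isometry (hYY s hs) b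
  have hYlim (b : B) : Filter.Tendsto (fun s => (star (Y s)).fst b) Filter.atTop (nhds 0) := by
    have h3 : Filter.Tendsto (fun s => b - (X s).fst ((star (X s)).fst b)) Filter.atTop
        (nhds 0) := by
      have h4 := (DoubleCentralizer.tendsto_fst_apply hX1 (h2 b) (h1 b)).const_sub b
      rwa [sub_self] at h4
    have h4 := DoubleCentralizer.tendsto_fst_apply hY2 h3 (z := 0) (by simp)
    refine h4.congr' ?_
    filter_upwards [Filter.eventually_ge_atTop 0] with s hs
    have e : star (Y s) * (X s * star (X s)) = 0 := by rw [← mul_assoc, hXY s hs, zero_mul]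
    rw [map_sub]
    change (star (Y s)).fst b - (star (Y s) * (X s * star (X s))).fst b = _
    rw [e]
    simp
  have hR (x : 𝓜(ℂ, B)) (b : B) : Filter.Tendsto
      (fun s => (G s * Θ.diag x r * star (G s)).fst b) Filter.atTop (nhds (x.fst b)) := by
    have h3 := DoubleCentralizer.tendsto_fst_apply hX1
      ((x.fst.continuous.tendsto b).comp (h2 b)) (h1 (x.fst b))
    have h4 : Filter.Tendsto (fun s => (Y s).fst (r.fst ((star (Y s)).fst b))) Filter.atTop
        (nhds 0) := by
      have h5 := (r.fst.continuous.tendsto 0).comp (hYlim b)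
      rw [map_zero] at h5
      exact DoubleCentralizer.tendsto_fst_apply hY1 h5 (by simp)
    have h5 := h3.add h4
    rw [add_zero] at h5
    refine h5.congr fun s => ?_
    have e : G s * Θ.diag x r * star (G s) = X s * x * star (X s) + Y s * r * star (Y s) := by
      simp only [hX, hY, InnerIso.diag, star_mul, mul_add, add_mul, mul_assoc]
    rw [e]
    rfl
  obtain ⟨d, hd⟩ := h.sub_mem
  have hDlim : Filter.Tendsto (fun s => (X s).fst (star ((X s).fst (star d)))) Filter.atTop
      (nhds d) := by
    refine DoubleCentralizer.tendsto_fst_apply hX1 ?_ (h1 d)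
    have h3 := (continuous_star.tendsto _).comp (h1 (star d))
    rwa [star_star] at h3
  have hproj {x : 𝓜(ℂ, B)} (hx : IsStarProjection x) (t : I) : IsStarProjection
      (if t = 1 then x else G (t / (1 - t)) * Θ.diag x r * star (G (t / (1 - t)))) := by
    split_ifs with ht
    · exact hx
    · have h0 : (0 : ℝ) ≤ t / (1 - t) := div_nonneg t.2.1 (sub_nonneg.2 t.2.2)
      exact (Θ.isStarProjection_diag hx hr).conj_of_isometry (hu _ h0)
  have hcont (x : 𝓜(ℂ, B)) (b : B) : Continuous fun t : I =>
      (if t = 1 then x else G (t / (1 - t)) * Θ.diag x r * star (G (t / (1 - t)))).fst b := by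
    have e : (fun t : I =>
        (if t = 1 then x else G (t / (1 - t)) * Θ.diag x r * star (G (t / (1 - t)))).fst b) =
        fun t : I => if t = 1 then x.fst b else
          (fun s => (G s * Θ.diag x r * star (G s)).fst b) (t / (1 - t)) := by
      funext t
      split_ifs <;> rfl
    rw [e]
    exact continuous_ite_one ((DoubleCentralizer.continuous_fst.comp
      ((hG.mul continuous_const).mul hG.star)).clm_apply continuous_const) (hR x b)
  have hDcont : Continuous fun s => (X s).fst (star ((X s).fst (star d))) := by
    have hXc : Continuous fun s => (X s).fst :=
      DoubleCentralizer.continuous_fst.comp (hG.mul continuous_const)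
    fun_prop
  have key := essCodim_eq_of_path (P := fun t : I => if t = 1 then p else
      G (t / (1 - t)) * Θ.diag p r * star (G (t / (1 - t))))
    (Q := fun t : I => if t = 1 then q else
      G (t / (1 - t)) * Θ.diag q r * star (G (t / (1 - t))))
    (hproj h.left) (hproj h.right) (hcont p) (hcont q) ⟨_, continuous_ite_one hDcont hDlim⟩
    (fun t => by
      rw [ContinuousMap.coe_mk]
      split_ifs with ht
      · exact hd
      · rw [DoubleCentralizer.coeHom_fst, map_star, DoubleCentralizer.coeHom_fst, map_star, hd,
          ← sub_mul, ← mul_sub, Θ.diag_sub, sub_self]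
        simp [hX, InnerIso.diag, mul_assoc])
  have h0 : (0 : I) ≠ 1 := zero_ne_one
  have e0 (x : 𝓜(ℂ, B)) : (if (0 : I) = 1 then x else
      G ((0 : I) / (1 - (0 : I))) * Θ.diag x r * star (G ((0 : I) / (1 - (0 : I))))) =
      Θ.diag x r := by
    rw [if_neg h0]
    simp [hG0]
  have e1 (x : 𝓜(ℂ, B)) : (if (1 : I) = 1 then x else
      G ((1 : I) / (1 - (1 : I))) * Θ.diag x r * star (G ((1 : I) / (1 - (1 : I))))) = x :=
    if_pos rfl
  rw [← essCodim_congr (e0 p) (e0 q) (by rwa [e0, e0]) h',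
    ← essCodim_congr (e1 p) (e1 q) (by rwa [e1, e1]) h]
  exact key _ _

end diag

namespace Stabilization

variable {B₀ B : Type u} [NonUnitalCStarAlgebra B₀] [NonUnitalCStarAlgebra B]
  (S : Stabilization B₀ B)

/-- A family of contractive multipliers that eventually fixes each matrix unit tends strongly
to the identity. -/
lemma tendsto_fst_of_eventually_fix {m : ℝ → 𝓜(ℂ, B)}
    (hm : ∀ᶠ s in Filter.atTop, ∀ b, ‖(m s).fst b‖ ≤ ‖b‖)
    (h : ∀ i j b, ∀ᶠ s in Filter.atTop, (m s).fst (S.unit i j b) = S.unit i j b) (b : B) :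
    Filter.Tendsto (fun s => (m s).fst b) Filter.atTop (nhds b) := by
  have h1 (x : ℕ × ℕ →₀ B₀) :
      ∀ᶠ s in Filter.atTop, (m s).fst (S.ofFinsupp x) = S.ofFinsupp x := by
    induction x using Finsupp.induction_linear with
    | zero => simp
    | add x y hx hy =>
      filter_upwards [hx, hy] with s h1 h2
      rw [map_add, map_add, h1, h2]
    | single ij b => rw [ofFinsupp_single]; exact h _ _ _
  rw [Metric.tendsto_nhds]
  intro ε hε
  obtain ⟨_, ⟨x, rfl⟩, hx⟩ := Metric.mem_closure_iff.1 (S.denseRange_ofFinsupp b) (ε / 2)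
    (half_pos hε)
  filter_upwards [hm, h1 x] with s hs hsx
  have e : (m s).fst b - b = (m s).fst (b - S.ofFinsupp x) - (b - S.ofFinsupp x) := by
    rw [map_sub, hsx]; abel
  rw [dist_eq_norm] at hx ⊢
  rw [e]
  calc _ ≤ _ := norm_sub_le _ _
    _ < ε := by linarith [hs (b - S.ofFinsupp x)]

/-- The phase of the `n`-th rotation at time `s`, running from `1` to `-1` on `[n, n + 1]`. -/
noncomputable def phase (n : ℕ) (s : ℝ) : ℂ :=
  Complex.exp ((Real.pi * max 0 (min 1 (s - n)) : ℝ) * Complex.I)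

lemma continuous_phase (n : ℕ) : Continuous (phase n) := by
  unfold phase
  fun_prop

lemma phase_of_le {n : ℕ} {s : ℝ} (h : s ≤ n) : phase n s = 1 := by
  have : max 0 (min 1 (s - n)) = 0 := max_eq_left ((min_le_right _ _).trans (sub_nonpos.2 h))
  simp [phase, this]

lemma phase_of_ge {n : ℕ} {s : ℝ} (h : n + 1 ≤ s) : phase n s = -1 := by
  have : max 0 (min 1 (s - n)) = 1 := by rw [min_eq_left (by linarith)]; simp
  simp [phase, this]

lemma phase_mul_star (n : ℕ) (s : ℝ) : phase n s * star (phase n s) = 1 := by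
  have h : ‖phase n s‖ = 1 := Complex.norm_exp_ofReal_mul_I _
  have := Complex.mul_conj' (phase n s)
  rw [h] at this
  simpa using this

/-- The products of the first `n` flips. -/
noncomputable def flipProd : ℕ → 𝓜(ℂ, B)
  | 0 => 1
  | n + 1 => S.shift (flip n) * flipProd n

lemma shift_flip_mul_self (n : ℕ) : S.shift (flip n) * S.shift (flip n) = 1 := by
  rw [shift_mul_shift, ← S.shift_refl]
  congr 1
  refine PEquiv.ext fun i => ?_
  change some _ = some _
  rw [Option.some_inj]
  split_ifs <;> first | rfl | omega

lemma star_shift_flip (n : ℕ) : star (S.shift (flip n)) = S.shift (flip n) := by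
  rw [star_shift]; rfl

lemma flipProd_mul (n : ℕ) : S.flipProd n * S.shift (spread 0) = S.shift (spread n) := by
  induction n with
  | zero => rw [flipProd, one_mul]
  | succ n ih => rw [flipProd, mul_assoc, ih, shift_mul_shift, spread_trans_flip]

lemma star_flipProd_mul (n : ℕ) : star (S.flipProd n) * S.flipProd n = 1 := by
  induction n with
  | zero => simp [flipProd]
  | succ n ih =>
    rw [flipProd, star_mul, star_shift_flip, mul_assoc, ← mul_assoc (S.shift (flip n)),
      shift_flip_mul_self, one_mul, ih]

/-- The rotation from `1` to the `n`-th flip that takes place on the time interval `[n, n + 1]`. -/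
noncomputable def flipRotation (n : ℕ) (s : ℝ) : 𝓜(ℂ, B) :=
  1 + ((phase n s - 1) / 2) • (1 - S.shift (flip n))

/-- The concatenation of the first `N` rotations, written as a telescoping sum. -/
noncomputable def flipPathAux (N : ℕ) (s : ℝ) : 𝓜(ℂ, B) :=
  1 + ∑ n ∈ Finset.range N, ((phase n s - 1) / 2) • ((1 - S.shift (flip n)) * S.flipProd n)

/-- The concatenation of all the rotations, a path of unitaries defined for `s ≥ 0` which passes
through `flipProd n` at time `n`. -/
noncomputable def flipPath (s : ℝ) : 𝓜(ℂ, B) := S.flipPathAux ⌈s⌉₊ s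

lemma flipPathAux_eq {N : ℕ} {s : ℝ} (h : s ≤ N) : S.flipPathAux N s = S.flipPath s := by
  have h1 : ⌈s⌉₊ ≤ N := Nat.ceil_le.2 h
  unfold flipPath flipPathAux
  congr 1
  symm
  refine Finset.sum_subset (Finset.range_mono h1) fun n _ hn => ?_
  rw [Finset.mem_range, not_lt] at hn
  rw [phase_of_le ((Nat.le_ceil s).trans (by exact_mod_cast hn))]
  simp

lemma continuous_flipPath : Continuous S.flipPath := by
  rw [continuous_iff_continuousAt]
  intro s
  have h : s < (⌈s⌉₊ + 1 : ℕ) := (Nat.le_ceil s).trans_lt (by push_cast; linarith)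
  have h1 : Continuous (S.flipPathAux (⌈s⌉₊ + 1)) :=
    continuous_const.add (continuous_finsetSum _ fun n _ =>
      (((continuous_phase n).sub continuous_const).div_const 2).smul continuous_const)
  refine h1.continuousAt.congr ?_
  filter_upwards [isOpen_Iio.mem_nhds h] with t ht
  exact S.flipPathAux_eq (le_of_lt ht)

lemma flipPath_eq {n : ℕ} {s : ℝ} (h1 : n ≤ s) (h2 : s ≤ n + 1) :
    S.flipPath s = S.flipRotation n s * S.flipProd n := by
  rw [← S.flipPathAux_eq (N := n + 1) (by exact_mod_cast h2), flipPathAux, Finset.sum_range_succ]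
  have h3 : ∑ k ∈ Finset.range n, ((phase k s - 1) / 2) • ((1 - S.shift (flip k)) * S.flipProd k) =
      ∑ k ∈ Finset.range n, (S.flipProd (k + 1) - S.flipProd k) := by
    refine Finset.sum_congr rfl fun k hk => ?_
    have h4 : ((k : ℝ) + 1) ≤ s := le_trans (by exact_mod_cast Finset.mem_range.1 hk) h1
    have h5 : ((-1 : ℂ) - 1) / 2 = -1 := by norm_num
    rw [phase_of_ge h4, h5, flipProd, sub_mul, one_mul, neg_smul, one_smul, neg_sub]
  rw [h3, Finset.sum_range_sub, flipProd, flipRotation, add_mul, one_mul, smul_mul_assoc]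
  abel

lemma star_flipRotation_mul (n : ℕ) (s : ℝ) :
    star (S.flipRotation n s) * S.flipRotation n s = 1 := by
  have h1 := S.star_shift_flip n
  have h2 := S.shift_flip_mul_self n
  have h3 := phase_mul_star n s
  have key (a b : ℂ) (h : a + b + 2 * (a * b) = 0) (u : 𝓜(ℂ, B)) (hu : u * u = 1) :
      (1 + a • (1 - u)) * (1 + b • (1 - u)) = 1 := by
    have e : (1 + a • (1 - u)) * (1 + b • (1 - u)) = 1 + (a + b + 2 * (a * b)) • (1 - u) := by
      simp only [mul_add, add_mul, mul_sub, sub_mul, one_mul, mul_one, smul_mul_assoc,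
        mul_smul_comm, hu, smul_sub]
      match_scalars <;> ring
    rw [e, h, zero_smul, add_zero]
  have e : star (S.flipRotation n s) =
      1 + ((star (phase n s) - 1) / 2) • (1 - S.shift (flip n)) := by
    rw [flipRotation, star_add, star_smul, star_sub, star_one, h1]
    simp
  rw [e, flipRotation]
  generalize phase n s = z at *
  exact key _ _ (by linear_combination h3 / 2) _ h2

lemma flipRotation_fix {n i : ℕ} (hi : i ≤ n) (s : ℝ) (j : ℕ) (b : B₀) :
    (S.flipRotation n s).fst (S.unit i j b) = S.unit i j b := by
  have h : flip n i = some i := by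
    change some _ = some _
    rw [if_pos hi]
  simp [flipRotation, S.shift_unit_some h]

lemma star_flipPath_mul (s : ℝ) (hs : 0 ≤ s) : star (S.flipPath s) * S.flipPath s = 1 := by
  rw [S.flipPath_eq (Nat.floor_le hs) (Nat.lt_floor_add_one s).le, star_mul, mul_assoc,
    ← mul_assoc _ (S.flipRotation _ s), S.star_flipRotation_mul _ s, one_mul,
    S.star_flipProd_mul]

lemma flipPath_zero : S.flipPath 0 = 1 := by
  simp [flipPath, flipPathAux]

/-- Cuntz pairs over a stable algebra absorb degenerate Cuntz pairs. -/
lemma essCodim_diag {p q r : 𝓜(ℂ, B)} (hr : IsStarProjection r) (h : IsEssPair p q) :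
    essCodim (S.innerIso.diag p r) (S.innerIso.diag q r)
      (IsEssPair.diag _ h (IsEssPair.refl hr)) = essCodim p q h := by
  have hiso (s : ℝ) (hs : 0 ≤ s) : star (S.flipPath s * S.innerIso.v₁) *
      (S.flipPath s * S.innerIso.v₁) = 1 := by
    rw [star_mul, mul_assoc, ← mul_assoc _ (S.flipPath s), S.star_flipPath_mul s hs, one_mul,
      S.innerIso.isometry₁]
  -- for `i + 1 ≤ s` the isometry `flipPath s * v₁` fixes the row `i`, and hence so does its adjoint
  have hfix (i j : ℕ) (b : B₀) (s : ℝ) (hs : (i + 1 : ℕ) ≤ s) :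
      (S.flipPath s * S.innerIso.v₁).fst (S.unit i j b) = S.unit i j b := by
    have h0 : (0 : ℝ) ≤ s := (Nat.cast_nonneg _).trans hs
    have hn : i + 1 ≤ ⌊s⌋₊ := Nat.le_floor hs
    rw [S.flipPath_eq (Nat.floor_le h0) (Nat.lt_floor_add_one s).le, mul_assoc]
    change (S.flipRotation ⌊s⌋₊ s).fst ((S.flipProd ⌊s⌋₊ * S.shift (spread 0)).fst _) = _
    have h1 : spread ⌊s⌋₊ i = some i := by rw [spread_apply, if_pos (by omega)]
    rw [flipProd_mul, S.shift_unit_some h1, S.flipRotation_fix (by omega)]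
  refine essCodim_diag_of_path S.innerIso S.continuous_flipPath S.flipPath_zero
    S.star_flipPath_mul (S.tendsto_fst_of_eventually_fix ?_ fun i j b => ?_)
    (S.tendsto_fst_of_eventually_fix ?_ fun i j b => ?_) hr h _
  · filter_upwards [Filter.eventually_ge_atTop 0] with s hs b
    exact (DoubleCentralizer.norm_fst_apply_of_isometry (hiso s hs) b).le
  · filter_upwards [Filter.eventually_ge_atTop ((i + 1 : ℕ) : ℝ)] with s hs
    exact hfix i j b s hs
  · filter_upwards [Filter.eventually_ge_atTop 0] with s hs b
    exact DoubleCentralizer.norm_star_fst_apply_le_of_isometry (hiso s hs) b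
  · filter_upwards [Filter.eventually_ge_atTop ((i + 1 : ℕ) : ℝ)] with s hs
    have h0 : (0 : ℝ) ≤ s := (Nat.cast_nonneg _).trans hs
    nth_rw 1 [← hfix i j b s hs]
    change (star (S.flipPath s * S.innerIso.v₁) * (S.flipPath s * S.innerIso.v₁)).fst _ = _
    rw [hiso s h0]
    rfl

end Stabilization

/-! ### Block matrices over a ring with two orthogonal isometries -/

section blocks

variable {A : Type*} [Ring A] [StarRing A]

/-- The image `∑ vᵢ xᵢⱼ vⱼ⋆` of a `2 × 2` matrix. -/
def blockSum (v₁ v₂ a b c d : A) : A :=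
  v₁ * a * star v₁ + v₁ * b * star v₂ + v₂ * c * star v₁ + v₂ * d * star v₂

variable {v₁ v₂ : A}

lemma star_blockSum (a b c d : A) :
    star (blockSum v₁ v₂ a b c d) = blockSum v₁ v₂ (star a) (star c) (star b) (star d) := by
  simp only [blockSum, star_add, star_mul, star_star, mul_assoc]
  abel

lemma blockSum_one (h : v₁ * star v₁ + v₂ * star v₂ = 1) : blockSum v₁ v₂ 1 0 0 1 = 1 := by
  simpa [blockSum] using h

lemma blockSum_mul (h₁ : star v₁ * v₁ = 1) (h₂ : star v₂ * v₂ = 1) (h₁₂ : star v₁ * v₂ = 0)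
    (h₂₁ : star v₂ * v₁ = 0) (a b c d a' b' c' d' : A) :
    blockSum v₁ v₂ a b c d * blockSum v₁ v₂ a' b' c' d' =
      blockSum v₁ v₂ (a * a' + b * c') (a * b' + b * d') (c * a' + d * c') (c * b' + d * d') := by
  have e₁ (x : A) : star v₁ * (v₁ * x) = x := by rw [← mul_assoc, h₁, one_mul]
  have e₂ (x : A) : star v₂ * (v₂ * x) = x := by rw [← mul_assoc, h₂, one_mul]
  have e₃ (x : A) : star v₁ * (v₂ * x) = 0 := by rw [← mul_assoc, h₁₂, zero_mul]
  have e₄ (x : A) : star v₂ * (v₁ * x) = 0 := by rw [← mul_assoc, h₂₁, zero_mul]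
  simp only [blockSum, mul_add, add_mul, mul_assoc, e₁, e₂, e₃, e₄, mul_zero, add_zero, zero_add]
  abel

end blocks

/-! ### Projections in `D(B)` and Cuntz pairs -/

section double

open KTheory

variable {B : Type u} [NonUnitalCStarAlgebra B]

variable (B) in
/-- The diagonal inclusion of `M(B)` in `D(B)`. -/
noncomputable def doubleConst : 𝓜(ℂ, B) →⋆ₐ[ℂ] Double B where
  toFun m := ⟨(m, m), by
    change InAlg (m - m)
    rw [sub_self]; exact InAlg.zero⟩
  map_one' := rfl
  map_mul' _ _ := rfl
  map_zero' := rfl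
  map_add' _ _ := rfl
  commutes' _ := rfl
  map_star' _ := rfl

lemma isEssPair_of_double {d : Double B} (hd : IsStarProjection d) : IsEssPair d.1.1 d.1.2 :=
  ⟨⟨congrArg (fun d : Double B => d.1.1) hd.1, congrArg (fun d : Double B => d.1.1) hd.2⟩,
    ⟨congrArg (fun d : Double B => d.1.2) hd.1, congrArg (fun d : Double B => d.1.2) hd.2⟩, d.2⟩

/-- The class in `KK_h(ℂ, B)` of a projection of `D(B)`. -/
noncomputable def KKh.ofDouble (d : Double B) (hd : IsStarProjection d) : KKh ℂ B :=
  essCodim d.1.1 d.1.2 (isEssPair_of_double hd)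

/-- The projection `(p, q)` of `D(B)`. -/
def IsEssPair.double {p q : 𝓜(ℂ, B)} (h : IsEssPair p q) : Double B := ⟨(p, q), h.sub_mem⟩

lemma IsEssPair.isStarProjection_double {p q : 𝓜(ℂ, B)} (h : IsEssPair p q) :
    IsStarProjection h.double :=
  ⟨Subtype.ext (Prod.ext h.left.1 h.right.1), Subtype.ext (Prod.ext h.left.2 h.right.2)⟩

/-- The class `[d] - [δ d]` in `K₀(D(B))`, where `δ (x, y) = (y, y)`. -/
noncomputable def relClass (d : Double B) (hd : IsStarProjection d) : K0Unital (Double B) :=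
  K0Unital.ofProj d hd - K0Unital.ofProj (doubleDiag B d) (hd.map (doubleDiag B))

lemma K0Unital.ofProj_congr {A : Type*} [Ring A] [StarRing A] {p q : A} (h : p = q)
    (hp : IsStarProjection p) (hq : IsStarProjection q) :
    K0Unital.ofProj p hp = K0Unital.ofProj q hq := by
  subst h; rfl

lemma toDouble_kappa_essCodim {p q : 𝓜(ℂ, B)} (h : IsEssPair p q) :
    K0.toDouble B (kappa B (essCodim p q h)) = relClass h.double h.isStarProjection_double := by
  refine (isCanonical_kappa _).trans (congrArg₂ (· - ·) ?_ ?_)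
  · exact K0Unital.ofProj_congr
      (Subtype.ext (Prod.ext (one_smul ℂ p) (one_smul ℂ q))) _ _
  · exact K0Unital.ofProj_congr
      (Subtype.ext (Prod.ext (one_smul ℂ q) (one_smul ℂ q))) _ _

lemma KKh.mk_eq_ofDouble (c : CuntzPair ℂ B) :
    KKh.mk c = KKh.ofDouble c.double c.isStarProjection_double := by
  have h (f : ℂ →⋆ₙₐ[ℂ] 𝓜(ℂ, B)) (hf : IsStarProjection (f 1)) : f = projRep (f 1) hf := by
    refine NonUnitalStarAlgHom.ext fun z => ?_
    change f z = z • f 1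
    rw [← map_smul, smul_eq_mul, mul_one]
  refine congrArg KKh.mk ?_
  obtain ⟨φ, ψ, hc⟩ := c
  have hd := isEssPair_of_double (CuntzPair.isStarProjection_double ⟨φ, ψ, hc⟩)
  simp only [CuntzPair.mk.injEq]
  exact ⟨h φ hd.left, h ψ hd.right⟩

lemma mvn_single {A : Type*} [Ring A] [StarRing A] {x y : A} :
    MvN (!![x] : Matrix (Fin 1) (Fin 1) A) (!![y] : Matrix (Fin 1) (Fin 1) A) ↔
      ∃ w : A, w * star w = x ∧ star w * w = y := by
  constructor
  · rintro ⟨w, h1, h2⟩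
    refine ⟨w 0 0, ?_, ?_⟩
    · simpa [Matrix.mul_apply] using congrFun (congrFun h1 0) 0
    · simpa [Matrix.mul_apply] using congrFun (congrFun h2 0) 0
  · rintro ⟨w, rfl, rfl⟩
    refine ⟨!![w], ?_, ?_⟩ <;>
    · ext i j
      fin_cases i; fin_cases j
      simp [Matrix.mul_apply]

lemma mvn_conj_isometry {A : Type*} [Ring A] [StarRing A] {v p : A}
    (hv : star v * v = 1) (hp : IsStarProjection p) :
    MvN (!![v * p * star v] : Matrix (Fin 1) (Fin 1) A) (!![p] : Matrix (Fin 1) (Fin 1) A) := by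
  have hp1 : p * p = p := hp.isIdempotentElem
  have hp2 : star p = p := hp.isSelfAdjoint
  refine mvn_single.2 ⟨v * p, ?_, ?_⟩
  · rw [star_mul, hp2, mul_assoc, ← mul_assoc p p, hp1, mul_assoc]
  · rw [star_mul, hp2, mul_assoc, ← mul_assoc (star v), hv, one_mul, hp1]

lemma K0Unital.ofProj_conj_isometry {A : Type*} [Ring A] [StarRing A] {v p : A}
    (hv : star v * v = 1) (hp : IsStarProjection p) :
    K0Unital.ofProj (v * p * star v) (hp.conj_of_isometry hv) = K0Unital.ofProj p hp :=
  (mvn_conj_isometry hv hp).mk_eq _ _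

/-- The image of `diag (x, y)` under the inner isomorphism `M₂(D(B)) → D(B)` given by `Θ`. -/
noncomputable def InnerIso.double (Θ : InnerIso B) (x y : Double B) : Double B :=
  doubleConst B Θ.v₁ * x * star (doubleConst B Θ.v₁) +
    doubleConst B Θ.v₂ * y * star (doubleConst B Θ.v₂)

section innerIso

variable (Θ : InnerIso B) {x y : Double B}

lemma InnerIso.isStarProjection_double (hx : IsStarProjection x) (hy : IsStarProjection y) :
    IsStarProjection (Θ.double x y) := by
  have h := (isEssPair_of_double hx).diag Θ (isEssPair_of_double hy)
  exact h.isStarProjection_double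

lemma InnerIso.double_isometry₁ : star (doubleConst B Θ.v₁) * doubleConst B Θ.v₁ = 1 := by
  rw [← map_star, ← map_mul, Θ.isometry₁, map_one]

lemma InnerIso.double_isometry₂ : star (doubleConst B Θ.v₂) * doubleConst B Θ.v₂ = 1 := by
  rw [← map_star, ← map_mul, Θ.isometry₂, map_one]

lemma InnerIso.double_orthogonal : star (doubleConst B Θ.v₁) * doubleConst B Θ.v₂ = 0 := by
  rw [← map_star, ← map_mul, Θ.orthogonal, map_zero]

lemma InnerIso.double_orthogonal' : star (doubleConst B Θ.v₂) * doubleConst B Θ.v₁ = 0 := by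
  rw [← map_star, ← map_mul, Θ.orthogonal', map_zero]

lemma InnerIso.double_range_add_range :
    doubleConst B Θ.v₁ * star (doubleConst B Θ.v₁) +
      doubleConst B Θ.v₂ * star (doubleConst B Θ.v₂) = 1 := by
  rw [← map_star, ← map_star, ← map_mul, ← map_mul, ← map_add, Θ.range_add_range, map_one]

lemma InnerIso.double_eq_blockSum (x y : Double B) : Θ.double x y =
    blockSum (doubleConst B Θ.v₁) (doubleConst B Θ.v₂) x 0 0 y := by
  simp [InnerIso.double, blockSum]

lemma InnerIso.ofProj_double (hx : IsStarProjection x) (hy : IsStarProjection y) :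
    K0Unital.ofProj (Θ.double x y) (Θ.isStarProjection_double hx hy) =
      K0Unital.ofProj x hx + K0Unital.ofProj y hy := by
  rw [← K0Unital.ofProj_conj_isometry Θ.double_isometry₁ hx,
    ← K0Unital.ofProj_conj_isometry Θ.double_isometry₂ hy]
  refine K0Unital.ofProj_add_of_orthogonal _ _ ?_ _
  rw [mul_assoc, mul_assoc (doubleConst B Θ.v₂), ← mul_assoc (star _) (doubleConst B Θ.v₂),
    Θ.double_orthogonal, zero_mul, mul_zero]

lemma InnerIso.relClass_double (hx : IsStarProjection x) (hy : IsStarProjection y) :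
    relClass (Θ.double x y) (Θ.isStarProjection_double hx hy) = relClass x hx + relClass y hy := by
  have h := Θ.ofProj_double (hx.map (doubleDiag B)) (hy.map (doubleDiag B))
  change _ - K0Unital.ofProj (Θ.double (doubleDiag B x) (doubleDiag B y)) _ = _
  rw [h, Θ.ofProj_double hx hy, relClass, relClass]
  abel

end innerIso

lemma KKh.ofDouble_congr {d d' : Double B} (h : d = d') (hd : IsStarProjection d)
    (hd' : IsStarProjection d') : KKh.ofDouble d hd = KKh.ofDouble d' hd' := by
  subst h; rfl

lemma KKh.ofDouble_conj {s d : Double B} (hs : star s = s) (hss : s * s = 1)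
    (hd : IsStarProjection d) (hd' : IsStarProjection (s * d * s)) :
    KKh.ofDouble d hd = KKh.ofDouble (s * d * s) hd' :=
  essCodim_conj_eq (congrArg (fun d : Double B => d.1.1) hs)
    (congrArg (fun d : Double B => d.1.1) hss) (congrArg (fun d : Double B => d.1.2) hs)
    (congrArg (fun d : Double B => d.1.2) hss) _ (s * d - d * s).2 _

end double

/-! ### The canonical map is bijective -/

section bijective

open KTheory

variable {B : Type u} [NonUnitalCStarAlgebra B]

/-- If `d` and `d'` are equivalent, then `diag (d, 0)` and `diag (0, d')` are conjugate by the
self-adjoint unitary `[1 - d, w; w⋆, 1 - d']`. -/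
lemma InnerIso.ofDouble_eq_of_mvn (Θ : InnerIso B) {d d' w : Double B} (hd : IsStarProjection d)
    (hd' : IsStarProjection d') (h : w * star w = d) (h' : star w * w = d') :
    KKh.ofDouble (Θ.double d 0) (Θ.isStarProjection_double hd (IsStarProjection.zero _)) =
      KKh.ofDouble (Θ.double 0 d') (Θ.isStarProjection_double (IsStarProjection.zero _) hd') := by
  -- replacing `w` by `d * w` gives a partial isometry with the expected support projections
  wlog hdw : d * w = w generalizing w
  · have hd1 : d * d = d := hd.isIdempotentElem
    have hd2 : star d = d := hd.isSelfAdjoint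
    have hd1' : d' * d' = d' := hd'.isIdempotentElem
    refine this (w := d * w) ?_ ?_ ?_
    · rw [star_mul, hd2, mul_assoc, ← mul_assoc w, h, hd1, hd1]
    · rw [star_mul, hd2, mul_assoc, ← mul_assoc d, hd1, ← h, mul_assoc w, h', ← mul_assoc, h', hd1']
    · rw [← mul_assoc, hd1]
  have hd1 : d * d = d := hd.isIdempotentElem
  have hd1' : d' * d' = d' := hd'.isIdempotentElem
  have hd2 : star d = d := hd.isSelfAdjoint
  have hd2' : star d' = d' := hd'.isSelfAdjoint
  have hwd : w * d' = w := by rw [← h', ← mul_assoc, h, hdw]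
  have hdw' : star w * d = star w := by rw [← hd2, ← star_mul, hdw]
  have hwd' : d' * star w = star w := by rw [← hd2', ← star_mul, hwd]
  have hmul := blockSum_mul Θ.double_isometry₁ Θ.double_isometry₂ Θ.double_orthogonal
    Θ.double_orthogonal'
  set s := blockSum (doubleConst B Θ.v₁) (doubleConst B Θ.v₂) (1 - d) w (star w) (1 - d') with hs
  have hs1 : star s = s := by
    rw [hs, star_blockSum, star_sub, star_sub, star_one, hd2, hd2', star_star]
  have hs2 : s * s = 1 := by
    rw [hs, hmul]
    refine Eq.trans ?_ (blockSum_one Θ.double_range_add_range)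
    congr 1 <;> simp [mul_sub, sub_mul, hd1, hd1', h, h', hdw, hwd, hdw', hwd']
  have hs3 : s * Θ.double d 0 * s = Θ.double 0 d' := by
    rw [hs, Θ.double_eq_blockSum, Θ.double_eq_blockSum, hmul, hmul]
    congr 1 <;> simp [mul_sub, sub_mul, hd1, h', hdw']
  have hs4 : IsStarProjection (s * Θ.double d 0 * s) :=
    hs3 ▸ Θ.isStarProjection_double (IsStarProjection.zero _) hd'
  rw [KKh.ofDouble_conj hs1 hs2 _ hs4]
  exact KKh.ofDouble_congr hs3 _ _

end bijective

namespace Stabilization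

open KTheory

variable {B₀ B : Type u} [NonUnitalCStarAlgebra B₀] [NonUnitalCStarAlgebra B]
  (S : Stabilization B₀ B)

/-- Adding the degenerate pair given by a projection `e = (y, y)` does not change the class. -/
lemma ofDouble_diag {d e : Double B} (hd : IsStarProjection d) (he : IsStarProjection e)
    (h : e.1.1 = e.1.2) :
    KKh.ofDouble (S.innerIso.double d e) (S.innerIso.isStarProjection_double hd he) =
      KKh.ofDouble d hd := by
  have hr := (isEssPair_of_double he).left
  refine Eq.trans ?_ (S.essCodim_diag hr (isEssPair_of_double hd))
  refine essCodim_congr rfl ?_ _ _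
  change S.innerIso.diag d.1.2 e.1.2 = _
  rw [h]

include S in
/-- Murray-von Neumann equivalent projections of `D(B)` have the same class. -/
lemma ofDouble_eq_of_mvn {d d' w : Double B} (hd : IsStarProjection d)
    (hd' : IsStarProjection d') (h : w * star w = d) (h' : star w * w = d') :
    KKh.ofDouble d hd = KKh.ofDouble d' hd' := by
  have h0 : IsStarProjection (0 : Double B) := IsStarProjection.zero _
  have hd1' : d' * d' = d' := hd'.isIdempotentElem
  have hd2' : star d' = d' := hd'.isSelfAdjoint
  rw [← S.ofDouble_diag hd h0 rfl, S.innerIso.ofDouble_eq_of_mvn hd hd' h h',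
    ← S.innerIso.ofDouble_eq_of_mvn (w := d') hd' hd' (by rw [hd2', hd1']) (by rw [hd2', hd1']),
    S.ofDouble_diag hd' h0 rfl]

/-- The isometries `v₁, v₂ v₁, v₂² v₁, …`, which have orthogonal ranges. -/
noncomputable def isometries : ℕ → 𝓜(ℂ, B)
  | 0 => S.innerIso.v₁
  | n + 1 => S.innerIso.v₂ * isometries n

lemma star_isometries_mul (m n : ℕ) :
    star (S.isometries m) * S.isometries n = if m = n then 1 else 0 := by
  induction m generalizing n with
  | zero =>
    cases n with
    | zero => simp [isometries, S.innerIso.isometry₁]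
    | succ n => simp [isometries, ← mul_assoc, S.innerIso.orthogonal]
  | succ m ih =>
    cases n with
    | zero => simp [isometries, mul_assoc, S.innerIso.orthogonal']
    | succ n =>
      simp only [isometries, star_mul, Nat.add_right_cancel_iff]
      rw [mul_assoc, ← mul_assoc (star S.innerIso.v₂), S.innerIso.isometry₂, one_mul, ih]

/-- The row of the first `k` isometries. -/
noncomputable def isometryRow (k : ℕ) : Matrix (Fin 1) (Fin k) 𝓜(ℂ, B) :=
  Matrix.of fun _ j => S.isometries j

lemma isometryRow_mul (k : ℕ) : (S.isometryRow k)ᴴ * S.isometryRow k = 1 := by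
  ext1 i j
  simp [Matrix.mul_apply, isometryRow, star_isometries_mul, Matrix.one_apply, Fin.ext_iff]

/-- The compression `∑ wᵢ Pᵢⱼ wⱼ⋆` of a matrix over `D(B)` to an element of `D(B)`, where
`w₀, w₁, …` is the sequence of isometries. -/
noncomputable def compress {k : ℕ} (P : Matrix (Fin k) (Fin k) (Double B)) : Double B :=
  ((S.isometryRow k).map (doubleConst B) * P * ((S.isometryRow k).map (doubleConst B))ᴴ) 0 0

lemma single_compress {k : ℕ} (P : Matrix (Fin k) (Fin k) (Double B)) :
    (!![S.compress P] : Matrix (Fin 1) (Fin 1) (Double B)) =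
      (S.isometryRow k).map (doubleConst B) * P * ((S.isometryRow k).map (doubleConst B))ᴴ := by
  ext1 i j
  fin_cases i; fin_cases j; rfl

lemma map_isometryRow_mul (k : ℕ) : ((S.isometryRow k).map (doubleConst B))ᴴ *
    (S.isometryRow k).map (doubleConst B) = 1 := by
  rw [conjTranspose_map', ← Matrix.map_mul, isometryRow_mul,
    Matrix.map_one _ (map_zero _) (map_one _)]

lemma mvn_compress {k : ℕ} {P : Matrix (Fin k) (Fin k) (Double B)} (hP : IsStarProjection P) :
    MvN (!![S.compress P] : Matrix (Fin 1) (Fin 1) (Double B)) P := by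
  rw [single_compress]
  have h1 := conjTranspose_of_isStarProjection hP
  have h2 := mul_self_of_isStarProjection hP
  have h3 := S.map_isometryRow_mul k
  set V := (S.isometryRow k).map (doubleConst B)
  refine ⟨V * P, ?_, ?_⟩
  · rw [Matrix.conjTranspose_mul, h1, Matrix.mul_assoc, ← Matrix.mul_assoc P P, h2,
      Matrix.mul_assoc]
  · rw [Matrix.conjTranspose_mul, h1, Matrix.mul_assoc, ← Matrix.mul_assoc _ V, h3,
      Matrix.one_mul, h2]

lemma isStarProjection_compress {k : ℕ} {P : Matrix (Fin k) (Fin k) (Double B)}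
    (hP : IsStarProjection P) : IsStarProjection (S.compress P) := by
  have h1 := conjTranspose_of_isStarProjection hP
  have h2 := mul_self_of_isStarProjection hP
  have h3 := S.map_isometryRow_mul k
  have h4 := S.single_compress P
  set V := (S.isometryRow k).map (doubleConst B)
  have h5 : (!![S.compress P] : Matrix (Fin 1) (Fin 1) (Double B)) * !![S.compress P] =
      !![S.compress P] := by
    rw [h4]
    calc V * P * Vᴴ * (V * P * Vᴴ) = V * P * (Vᴴ * V) * P * Vᴴ := by simp only [Matrix.mul_assoc]
      _ = _ := by rw [h3, Matrix.mul_one, Matrix.mul_assoc V P P, h2]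
  have h6 : (!![S.compress P] : Matrix (Fin 1) (Fin 1) (Double B))ᴴ = !![S.compress P] := by
    rw [h4, Matrix.conjTranspose_mul, Matrix.conjTranspose_mul, h1,
      Matrix.conjTranspose_conjTranspose, Matrix.mul_assoc]
  constructor
  · have h7 := congrFun (congrFun h5 0) 0
    change _ * _ = _
    simpa [Matrix.mul_apply] using h7
  · have h7 := congrFun (congrFun h6 0) 0
    change star _ = _
    simpa using h7

lemma compress_doubleDiag {k : ℕ} (P : Matrix (Fin k) (Fin k) (Double B)) :
    S.compress (P.map (doubleDiag B)) = doubleDiag B (S.compress P) := by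
  have e : (S.isometryRow k).map (doubleConst B) * P.map (doubleDiag B) *
      ((S.isometryRow k).map (doubleConst B))ᴴ = ((S.isometryRow k).map (doubleConst B) * P *
        ((S.isometryRow k).map (doubleConst B))ᴴ).map (doubleDiag B) := by
    rw [Matrix.map_mul, Matrix.map_mul]
    rfl
  exact congrFun (congrFun e 0) 0

include S in
/-- The class `[P] - [s(P)]` is the image of the pair that compresses `P`. -/
lemma kappa_surjective : Function.Surjective (kappa B) := by
  intro x
  obtain ⟨n, P, hP, rfl⟩ := K0.exists_eq_ofMatrix x
  have hX := isStarProjection_map (unitizationToDouble B) hP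
  have hd := S.isStarProjection_compress hX
  refine ⟨KKh.ofDouble _ hd, K0.toDouble_injective ?_⟩
  rw [KKh.ofDouble, toDouble_kappa_essCodim, K0.toDouble_ofMatrix]
  refine congrArg₂ (· - ·) ?_ ?_
  · exact (S.mvn_compress hX).mk_eq _ _
  · have h := (S.mvn_compress (isStarProjection_map (doubleDiag B) hX)).mk_eq
      (isStarProjection_single (S.isStarProjection_compress (isStarProjection_map _ hX)))
      (isStarProjection_map (doubleDiag B) hX)
    rw [← h]
    exact K0Unital.ofProj_congr (S.compress_doubleDiag _).symm _
      (S.isStarProjection_compress (isStarProjection_map _ hX))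

/-- The projection `diag (a, 1ₖ)` over `D(B)` is equivalent to a projection of `D(B)`. -/
lemma mvn_double_compress_one {a : Double B} (ha : IsStarProjection a) (k : ℕ) :
    MvN (dsum !![a] (1 : Matrix (Fin k) (Fin k) (Double B)))
      (!![S.innerIso.double a (S.compress (1 : Matrix (Fin k) (Fin k) (Double B)))] :
        Matrix (Fin 1) (Fin 1) (Double B)) := by
  have hI : IsStarProjection (1 : Matrix (Fin k) (Fin k) (Double B)) := IsStarProjection.one _
  have he := S.isStarProjection_compress hI
  have hs := S.innerIso.isStarProjection_double ha he
  set e := S.compress (1 : Matrix (Fin k) (Fin k) (Double B))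
  have h1 := (S.mvn_compress hI).symm
  have ha' := isStarProjection_single ha
  have he' := isStarProjection_single he
  have v1 := ha.conj_of_isometry S.innerIso.double_isometry₁
  have v2 := he.conj_of_isometry S.innerIso.double_isometry₂
  have v1' := isStarProjection_single v1
  have v2' := isStarProjection_single v2
  have h2 := (mvn_conj_isometry S.innerIso.double_isometry₁ ha).symm
  have h3 := (mvn_conj_isometry S.innerIso.double_isometry₂ he).symm
  have h4 := MvN.dsum_add v1' v2' (by
    ext1 i j
    fin_cases i; fin_cases j
    simp only [Matrix.mul_apply, Finset.univ_unique, Finset.sum_singleton]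
    change _ * _ * _ * (_ * _ * _) = (0 : Double B)
    rw [mul_assoc, mul_assoc (doubleConst B S.innerIso.v₂),
      ← mul_assoc (star _) (doubleConst B S.innerIso.v₂), S.innerIso.double_orthogonal, zero_mul,
      mul_zero])
  have e5 : (!![doubleConst B S.innerIso.v₁ * a * star (doubleConst B S.innerIso.v₁)] +
      !![doubleConst B S.innerIso.v₂ * e * star (doubleConst B S.innerIso.v₂)] :
      Matrix (Fin 1) (Fin 1) (Double B)) = !![S.innerIso.double a e] := by
    ext1 i j
    fin_cases i; fin_cases j; rfl
  rw [e5] at h4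
  have s0 := isStarProjection_dsum ha' hI
  have s1 := isStarProjection_single hs
  exact ((MvN.dsum_fromBlocks ha' hI).trans s0 (isStarProjection_fromBlocks v1' v2')
    (h2.fromBlocks (h1.trans hI v2' h3))).trans s0 s1 h4

include S in
/-- If `[d] - [δ d] = [d'] - [δ d']`, then `diag (d, δ d')` and `diag (d', δ d)` become equivalent
after adding an identity matrix. All the summands added to `d` and `d'` are degenerate. -/
lemma ofDouble_eq_of_kappa_eq {d d' : Double B} (hd : IsStarProjection d)
    (hd' : IsStarProjection d')
    (h : kappa B (KKh.ofDouble d hd) = kappa B (KKh.ofDouble d' hd')) :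
    KKh.ofDouble d hd = KKh.ofDouble d' hd' := by
  have hq := hd.map (doubleDiag B)
  have hq' := hd'.map (doubleDiag B)
  have h1 := congrArg (K0.toDouble B) h
  rw [KKh.ofDouble, KKh.ofDouble, toDouble_kappa_essCodim, toDouble_kappa_essCodim] at h1
  change K0Unital.ofProj d hd - K0Unital.ofProj (doubleDiag B d) hq =
    K0Unital.ofProj d' hd' - K0Unital.ofProj (doubleDiag B d') hq' at h1
  have ha := S.innerIso.isStarProjection_double hd hq'
  have ha' := S.innerIso.isStarProjection_double hd' hq
  have h2 : K0Unital.ofProj (S.innerIso.double d (doubleDiag B d')) ha =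
      K0Unital.ofProj (S.innerIso.double d' (doubleDiag B d)) ha' := by
    rw [S.innerIso.ofProj_double hd hq', S.innerIso.ofProj_double hd' hq]
    rw [sub_eq_iff_eq_add] at h1
    rw [h1]; abel
  obtain ⟨k, hk⟩ := K0Unital.exists_mvn_of_mk_eq _ _ h2
  have hI : IsStarProjection (1 : Matrix (Fin k) (Fin k) (Double B)) := IsStarProjection.one _
  have he := S.isStarProjection_compress hI
  have hs := S.innerIso.isStarProjection_double ha he
  have hs' := S.innerIso.isStarProjection_double ha' he
  have h3 := ((S.mvn_double_compress_one ha k).symm.trans (isStarProjection_single hs)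
    (isStarProjection_dsum (isStarProjection_single ha') hI) hk).trans (isStarProjection_single hs)
    (isStarProjection_single hs') (S.mvn_double_compress_one ha' k)
  obtain ⟨w, hw, hw'⟩ := mvn_single.1 h3
  have h4 : (S.compress (1 : Matrix (Fin k) (Fin k) (Double B))).1.1 =
      (S.compress (1 : Matrix (Fin k) (Fin k) (Double B))).1.2 := by
    have h5 := S.compress_doubleDiag (1 : Matrix (Fin k) (Fin k) (Double B))
    rw [Matrix.map_one _ (map_zero _) (map_one _)] at h5
    exact congrArg (fun d : Double B => d.1.1) h5
  have h6 := S.ofDouble_eq_of_mvn hs hs' hw hw'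
  rwa [S.ofDouble_diag ha he h4, S.ofDouble_diag ha' he h4, S.ofDouble_diag hd hq' rfl,
    S.ofDouble_diag hd' hq rfl] at h6

include S in
lemma kappa_injective : Function.Injective (kappa B) := by
  intro x y hxy
  obtain ⟨c, rfl⟩ := Quot.exists_rep x
  obtain ⟨c', rfl⟩ := Quot.exists_rep y
  change kappa B (KKh.mk c) = kappa B (KKh.mk c') at hxy
  change KKh.mk c = KKh.mk c'
  rw [KKh.mk_eq_ofDouble, KKh.mk_eq_ofDouble] at hxy ⊢
  exact S.ofDouble_eq_of_kappa_eq _ _ hxy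

end Stabilization

/-! ### Algebraic properties of the essential codimension -/

section algebra

open KTheory

variable {B : Type u} [NonUnitalCStarAlgebra B]

lemma toDouble_kappa_ofDouble (d : Double B) (hd : IsStarProjection d) :
    K0.toDouble B (kappa B (KKh.ofDouble d hd)) = relClass d hd :=
  toDouble_kappa_essCodim _

lemma kappa_sum (Θ : InnerIso B) (c d : CuntzPair ℂ B) :
    kappa B (KKh.mk (CuntzPair.sum Θ c d)) = kappa B (KKh.mk c) + kappa B (KKh.mk d) := by
  refine K0.toDouble_injective ?_
  rw [map_add, KKh.mk_eq_ofDouble, KKh.mk_eq_ofDouble, KKh.mk_eq_ofDouble,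
    toDouble_kappa_ofDouble, toDouble_kappa_ofDouble, toDouble_kappa_ofDouble]
  exact Θ.relClass_double c.isStarProjection_double d.isStarProjection_double

lemma kappa_essCodim_self (p : 𝓜(ℂ, B)) (h : IsEssPair p p) :
    kappa B (essCodim p p h) = 0 := by
  refine K0.toDouble_injective ?_
  rw [toDouble_kappa_essCodim, map_zero]
  exact sub_self _

/-- Both sides stabilize to the class of a pair on `M₂`: exchanging the two coordinates by a
unitary turns `(diag (p₁, p₂), diag (p₃, p₂))` into `(diag (p₁, p₂), diag (p₂, p₃))`, and that
unitary commutes with `diag (p₃, p₂)` modulo `B`. -/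
lemma kappa_essCodim_trans (Θ : InnerIso B) {p₁ p₂ p₃ : 𝓜(ℂ, B)} (h₁₂ : IsEssPair p₁ p₂)
    (h₂₃ : IsEssPair p₂ p₃) :
    kappa B (essCodim p₁ p₃ (h₁₂.trans h₂₃)) =
      kappa B (essCodim p₁ p₂ h₁₂) + kappa B (essCodim p₂ p₃ h₂₃) := by
  have h₁₃ := h₁₂.trans h₂₃
  have h₂₂ := IsEssPair.refl h₂₃.left
  have hmul := blockSum_mul Θ.isometry₁ Θ.isometry₂ Θ.orthogonal Θ.orthogonal'
  have hdiag (x y : 𝓜(ℂ, B)) : Θ.diag x y = blockSum Θ.v₁ Θ.v₂ x 0 0 y := by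
    simp [InnerIso.diag, blockSum]
  set s := blockSum Θ.v₁ Θ.v₂ 0 1 1 0 with hs
  have hs1 : star s = s := by rw [hs, star_blockSum, star_zero, star_one]
  have hs2 : s * s = 1 := by
    rw [hs, hmul]
    refine Eq.trans ?_ (blockSum_one Θ.range_add_range)
    congr 1 <;> simp
  have hs3 : s * Θ.diag p₃ p₂ * s = Θ.diag p₂ p₃ := by
    rw [hs, hdiag, hdiag, hmul, hmul]
    congr 1 <;> simp
  have hs4 : InAlg (1 * Θ.diag p₁ p₂ - Θ.diag p₁ p₂ * 1 -
      (s * Θ.diag p₃ p₂ - Θ.diag p₃ p₂ * s)) := by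
    have e : 1 * Θ.diag p₁ p₂ - Θ.diag p₁ p₂ * 1 - (s * Θ.diag p₃ p₂ - Θ.diag p₃ p₂ * s) =
        Θ.v₂ * (p₂ - p₃) * star Θ.v₁ - Θ.v₁ * (p₂ - p₃) * star Θ.v₂ := by
      rw [one_mul, mul_one, hs, hdiag p₃, hmul, hmul]
      simp only [blockSum]
      noncomm_ring
    rw [e, sub_eq_add_neg]
    exact ((h₂₃.sub_mem.mul_left _).mul_right _).add ((h₂₃.sub_mem.mul_left _).mul_right _).neg
  have h := h₁₃.diag Θ h₂₂
  have h' := h₁₂.diag Θ h₂₃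
  have e1 : (1 : 𝓜(ℂ, B)) * Θ.diag p₁ p₂ * 1 = Θ.diag p₁ p₂ := by rw [one_mul, mul_one]
  have key : essCodim _ _ h = essCodim _ _ h' := by
    rw [essCodim_conj_eq (star_one _) (one_mul 1) hs1 hs2 h hs4 (by rw [e1, hs3]; exact h')]
    exact essCodim_congr e1 hs3 _ _
  have key' := congrArg (fun x => K0.toDouble B (kappa B x)) key
  simp only [toDouble_kappa_essCodim] at key'
  have r1 := Θ.relClass_double h₁₃.isStarProjection_double h₂₂.isStarProjection_double
  have r2 := Θ.relClass_double h₁₂.isStarProjection_double h₂₃.isStarProjection_double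
  have r3 := (r1.symm.trans key').trans r2
  have r4 : relClass h₂₂.double h₂₂.isStarProjection_double = 0 := sub_self _
  rw [r4, add_zero] at r3
  refine K0.toDouble_injective ?_
  rw [map_add, toDouble_kappa_essCodim, toDouble_kappa_essCodim, toDouble_kappa_essCodim]
  exact r3

lemma kappa_essCodim_add {p₁ p₂ q₁ q₂ : 𝓜(ℂ, B)} (hp : IsEssPair p₁ p₂) (hq : IsEssPair q₁ q₂)
    (h₁ : p₁ * q₁ = 0) (h₂ : p₂ * q₂ = 0) :
    kappa B (essCodim (p₁ + q₁) (p₂ + q₂) (hp.add hq h₁ h₂)) =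
      kappa B (essCodim p₁ p₂ hp) + kappa B (essCodim q₁ q₂ hq) := by
  refine K0.toDouble_injective ?_
  rw [map_add, toDouble_kappa_essCodim, toDouble_kappa_essCodim, toDouble_kappa_essCodim]
  have hs := (hp.add hq h₁ h₂).isStarProjection_double
  have e1 := K0Unital.ofProj_add_of_orthogonal hp.isStarProjection_double
    hq.isStarProjection_double (Subtype.ext (Prod.ext h₁ h₂)) hs
  have e2 := K0Unital.ofProj_add_of_orthogonal
    (hp.isStarProjection_double.map (doubleDiag B)) (hq.isStarProjection_double.map (doubleDiag B))
    (Subtype.ext (Prod.ext h₂ h₂)) (hs.map (doubleDiag B))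
  refine (congrArg₂ (· - ·) e1 e2).trans ?_
  simp only [relClass]
  abel

lemma toDouble_ofProj {a : B} (ha : IsStarProjection a) :
    K0.toDouble B (K0.ofProj a ha) =
      K0Unital.ofProj (inclDouble B a) (ha.map (inclDouble B)) := by
  change K0Unital.map _ (K0Unital.mk _ _) = _
  rw [K0Unital.map_mk]
  have e : (!![Unitization.inrNonUnitalStarAlgHom ℂ B a] :
      Matrix (Fin 1) (Fin 1) (Unitization ℂ B)).map (Unitization.starLift (inclDouble B)) =
      !![inclDouble B a] := by
    ext1 i j
    fin_cases i; fin_cases j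
    exact congrArg (fun g : B →⋆ₙₐ[ℂ] Double B => g a)
      (Unitization.starLift.symm_apply_apply (inclDouble B))
  simp only [e]
  rfl

lemma isStarProjection_of_coeHom {a : B}
    (h : IsStarProjection (DoubleCentralizer.coeHom (𝕜 := ℂ) a)) : IsStarProjection a :=
  ⟨coeHom_injective ((map_mul _ a a).trans h.1), coeHom_injective ((map_star _ a).trans h.2)⟩

lemma kappa_essCodim_coeHom {a₁ a₂ : B} (ha₁ : IsStarProjection a₁) (ha₂ : IsStarProjection a₂)
    (h : IsEssPair (DoubleCentralizer.coeHom (𝕜 := ℂ) a₁) (DoubleCentralizer.coeHom (𝕜 := ℂ) a₂)) :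
    kappa B (essCodim _ _ h) = K0.ofProj a₁ ha₁ - K0.ofProj a₂ ha₂ := by
  refine K0.toDouble_injective ?_
  rw [map_sub, toDouble_kappa_essCodim, toDouble_ofProj, toDouble_ofProj]
  have h0 : InAlg ((0 : 𝓜(ℂ, B)) - DoubleCentralizer.coeHom (𝕜 := ℂ) a₂) := by
    rw [zero_sub]
    exact InAlg.neg ⟨a₂, rfl⟩
  have hz : IsEssPair (0 : 𝓜(ℂ, B)) (DoubleCentralizer.coeHom (𝕜 := ℂ) a₂) :=
    ⟨IsStarProjection.zero _, h.right, h0⟩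
  -- `(a, a₂)` is the sum of the orthogonal projections `(a, 0)` and `(0, a₂)`
  have key (a : B) (ha : IsStarProjection a)
      (ha' : IsEssPair (DoubleCentralizer.coeHom (𝕜 := ℂ) a)
        (DoubleCentralizer.coeHom (𝕜 := ℂ) a₂)) :
      K0Unital.ofProj ha'.double ha'.isStarProjection_double =
        K0Unital.ofProj (inclDouble B a) (ha.map (inclDouble B)) +
          K0Unital.ofProj hz.double hz.isStarProjection_double := by
    have e : ha'.double = inclDouble B a + hz.double :=
      Subtype.ext (Prod.ext (add_zero _).symm (zero_add _).symm)
    rw [K0Unital.ofProj_congr e _ (e ▸ ha'.isStarProjection_double)]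
    exact K0Unital.ofProj_add_of_orthogonal _ _
      (Subtype.ext (Prod.ext (mul_zero _) (zero_mul _))) _
  have h22 := IsEssPair.refl h.right
  change K0Unital.ofProj h.double _ - K0Unital.ofProj h22.double _ = _
  rw [key a₁ ha₁ h, key a₂ ha₂ h22]
  abel

lemma InAlg.and_of_or {p₁ p₂ : 𝓜(ℂ, B)} (h : InAlg (p₁ - p₂)) (h' : InAlg p₁ ∨ InAlg p₂) :
    InAlg p₁ ∧ InAlg p₂ := by
  rcases h' with h' | h'
  · refine ⟨h', ?_⟩
    have := h'.add h.neg
    rwa [← sub_eq_add_neg, sub_sub_cancel] at this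
  · refine ⟨?_, h'⟩
    have := h.add h'
    rwa [sub_add_cancel] at this

end algebra

theorem mainTheorem7 {B : Type*} [NonUnitalCStarAlgebra B] (hB : IsStable B) :
    Nonempty (InnerIso B) ∧
    -- the Cuntz sum makes `KK_h(ℂ, B)` an abelian group, canonically isomorphic to `K₀(B)`
    ∃ _G : AddCommGroup (KKh ℂ B),
      (∀ (Θ : InnerIso B) (c d : CuntzPair ℂ B),
        KKh.mk (CuntzPair.sum Θ c d) = KKh.mk c + KKh.mk d) ∧
      ∃ κ : KKh ℂ B ≃+ KTheory.K0 B, IsCanonical κ ∧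
        -- (1)
        (∀ (p₁ p₂ : 𝓜(ℂ, B)) (h : IsEssPair p₁ p₂), (InAlg p₁ ∨ InAlg p₂) →
          ∃ (a₁ a₂ : B) (ha₁ : IsStarProjection a₁) (ha₂ : IsStarProjection a₂),
            DoubleCentralizer.coeHom (𝕜 := ℂ) a₁ = p₁ ∧
            DoubleCentralizer.coeHom (𝕜 := ℂ) a₂ = p₂ ∧
            κ (essCodim p₁ p₂ h) = KTheory.K0.ofProj a₁ ha₁ - KTheory.K0.ofProj a₂ ha₂) ∧
        -- (2)
        (∀ (p₁ p₂ : 𝓜(ℂ, B)) (h : IsEssPair p₁ p₂),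
          essCodim p₁ p₂ h = -essCodim p₂ p₁ h.symm) ∧
        -- (3)
        (∀ (p₁ p₂ p₃ : 𝓜(ℂ, B)) (h₁₂ : IsEssPair p₁ p₂) (h₂₃ : IsEssPair p₂ p₃),
          essCodim p₁ p₃ (h₁₂.trans h₂₃) = essCodim p₁ p₂ h₁₂ + essCodim p₂ p₃ h₂₃) ∧
        -- (4)
        (∀ (p₁ p₂ q₁ q₂ : 𝓜(ℂ, B)) (hp : IsEssPair p₁ p₂) (hq : IsEssPair q₁ q₂)
          (h₁ : p₁ * q₁ = 0) (h₂ : p₂ * q₂ = 0),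
          essCodim (p₁ + q₁) (p₂ + q₂) (hp.add hq h₁ h₂) =
            essCodim p₁ p₂ hp + essCodim q₁ q₂ hq) := by
  obtain ⟨B₀, _, ⟨S⟩⟩ := hB
  have Θ := S.innerIso
  let e : KKh ℂ B ≃ KTheory.K0 B :=
    Equiv.ofBijective (KTheory.kappa B) ⟨S.kappa_injective, S.kappa_surjective⟩
  let G : AddCommGroup (KKh ℂ B) := e.addCommGroup
  have hadd (x y : KKh ℂ B) :
      KTheory.kappa B (x + y) = KTheory.kappa B x + KTheory.kappa B y :=
    map_add e.addEquiv x y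
  have htrans (p₁ p₂ p₃ : 𝓜(ℂ, B)) (h₁₂ : IsEssPair p₁ p₂) (h₂₃ : IsEssPair p₂ p₃) :
      essCodim p₁ p₃ (h₁₂.trans h₂₃) = essCodim p₁ p₂ h₁₂ + essCodim p₂ p₃ h₂₃ :=
    S.kappa_injective (by rw [hadd, kappa_essCodim_trans Θ])
  refine ⟨⟨Θ⟩, G, fun Θ c d => S.kappa_injective (by rw [hadd, kappa_sum]), e.addEquiv,
    KTheory.isCanonical_kappa, fun p₁ p₂ h hor => ?_, fun p₁ p₂ h => ?_, htrans,
    fun p₁ p₂ q₁ q₂ hp hq h₁ h₂ => S.kappa_injective (by rw [hadd, kappa_essCodim_add hp hq h₁ h₂])⟩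
  · obtain ⟨⟨a₁, rfl⟩, ⟨a₂, rfl⟩⟩ := h.sub_mem.and_of_or hor
    exact ⟨a₁, a₂, isStarProjection_of_coeHom h.left, isStarProjection_of_coeHom h.right, rfl, rfl,
      kappa_essCodim_coeHom _ _ h⟩
  · refine eq_neg_of_add_eq_zero_left ((htrans p₁ p₂ p₁ h h.symm).symm.trans ?_)
    have h0 : KTheory.kappa B 0 = 0 := map_zero e.addEquiv
    exact S.kappa_injective (by rw [kappa_essCodim_self, h0])
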